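/- **Setting.** Consider a control-affine two-input system $\dot x=f(x)+g_1(x)u^1+g_2(x)u^2$ with smooth $f,g_1,g_2$ on an open set $\mathcal X\subset\mathbb R^n$, and a pair of smooth functions $\varphi=(\varphi^1(x),\varphi^2(x))$ on $\mathcal X$. On the space with coordinates $(x,u,u_{[1]},\dots,u_{[N]})$, $N$ large enough, the time derivatives $\varphi^j_{[a]}$ are the iterated Lie derivatives of $\varphi^j$ along $$f_u=(f^i+u^1g_1^i+u^2g_2^i)\,\partial_{x^i}+\sum_{\alpha=0}^{N-1}u^j_{[\alpha+1]}\,\partial_{u^j_{[\alpha]}},\qquad u_{[0]}=u .$$ For a pair of integers $A=(a_1,a_2)$ write $\varphi_{[0,A]}=(\varphi^1_{[0]},\dots,\varphi^1_{[a_1]},\varphi^2_{[0]},\dots,\varphi^2_{[a_2]})$ and $A+l=(a_1+l,a_2+l)$; pairs are compared componentwise. Fix a point $p=(x_0,u_0,u_{[1],0},\dots)$ with $x_0\in\mathcal X$ and assume: * $\varphi$ is an $x$-flat output near $p$: for some pair $R$ there are smooth maps $F_x,F_u$ with $x=F_x(\varphi_{[0,R-1]})$ and $u=F_u(\varphi_{[0,R]})$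 near $p$; let $R=(r_1,r_2)$ be minimal with this property (and $N\ge r_1,r_2$); * $\varphi^j$ has relative degree $k_j\ge 1$ near $p$: the functions $\varphi^j_{[0]},\dots,\varphi^j_{[k_j-1]}$ depend on $x$ only near $p$, and $\partial_u\varphi^j_{[k_j]}\neq0$ at $p$; put $K=(k_1,k_2)$; * each codistribution $P_A=\mathrm{span}\{\mathrm d\varphi_{[0,A]}\}$, $A=K-1,K,K+1,\dots$ with $A\le R$, has constant rank near $p$. Put $Q_A=P_A\cap\mathrm{span}\{\mathrm dx\}$. A codistribution is called completely integrable near $p$ if near $p$ it has a basis consisting of exact differentials of smooth functions. **Theorem.** The following are equivalent. 1. Near $(x_0,u_0)$ the system is static feedback equivalent, that is, equivalent by a state transformation $z=\Phi_x(x)$ and a static feedback $v=\Phi_u(x,u)$ for which $\Phi_x$ and $(\Phi_x,\Phi_u)$ are local diffeomorphisms near $x_0$ and $(x_0,u_0)$, to a triangular form (where $k_1+k_2\le n$) $$\begin{aligned} \dot z^i&=z^{i+1}&&(1\le i<k_1),\qquad \dot z^{k_1}=v^1,\\ \dot z^{i}&=z^{i+1}&&(k_1<i<k_1+k_2),\\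 \dot z^{l}&=a^l(z^1,\dots,z^{l+1})+b^l(z^1,\dots,z^{l+1})\,v^1&&(k_1+k_2\le l\le n-1),\\ \dot z^n&=v^2 \end{aligned}$$ with smooth functions $a^l,b^l$, such that $\varphi=(z^1,z^{k_1+1})$, such that $b^{k_1+k_2}\ne0$ (a condition only if $k_1+k_2<n$), and such that at every point $\partial_{z^{l+1}}a^l\neq0$ or $\partial_{z^{l+1}}b^l\neq0$, for every $l=k_1+k_2,\dots,n-1$. 2. For every $A=K-1+l$, $l=0,1,2,\dots$, with $A\le R-1$, the codistribution $Q_A$ is completely integrable near $p$. -/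

import Mathlib

open Set Filter Topology
open scoped ContDiff

namespace TwoInput

/-! ### Codistributions -/

section Codistributions

variable {E : Type*} [NormedAddCommGroup E] [NormedSpace ℝ E]

/-- A codistribution on (an open subset of) `E`: a linear space of covectors at every point. -/
abbrev Codistribution (E : Type*) [NormedAddCommGroup E] [NormedSpace ℝ E] :=
  E → Submodule ℝ (E →L[ℝ] ℝ)

/-- `Q` has constant rank on a neighbourhood of `p`. -/
def ConstantRankNear (Q : Codistribution E) (p : E) : Prop :=
  ∀ᶠ q in 𝓝 p, Module.finrank ℝ (Q q) = Module.finrank ℝ (Q p)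

/-- `Q` is completely integrable near `p`: on a neighbourhood `W` of `p` it has a basis
`dh¹, …, dhʳ` of exact differentials of smooth functions. -/
def CompletelyIntegrableNear (Q : Codistribution E) (p : E) : Prop :=
  ∃ (W : Set E) (r : ℕ) (h : Fin r → E → ℝ), IsOpen W ∧ p ∈ W ∧
    (∀ i, ContDiffOn ℝ ∞ (h i) W) ∧
    ∀ q ∈ W, LinearIndependent ℝ (fun i => fderiv ℝ (h i) q) ∧
      Q q = Submodule.span ℝ (range fun i => fderiv ℝ (h i) q)

end Codistributions

/-! ### Two-input systems on the extended state and input space -/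

/-- A two-input system `ẋ = F(x, u)` on `ℝⁿ`. -/
abbrev System (n : ℕ) := (Fin n → ℝ) → (Fin 2 → ℝ) → (Fin n → ℝ)

/-- The control-affine system `ẋ = f(x) + g₁(x) u¹ + g₂(x) u²`. -/
def affineSystem {n : ℕ} (f : (Fin n → ℝ) → (Fin n → ℝ))
    (g : Fin 2 → (Fin n → ℝ) → (Fin n → ℝ)) : System n :=
  fun x u => f x + u 0 • g 0 x + u 1 • g 1 x

/-- The extended space with coordinates `(x, u, u_[1], …, u_[N])`. -/
abbrev Jet (n N : ℕ) := (Fin n → ℝ) × (Fin (N + 1) → Fin 2 → ℝ)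

/-- The vector field `f_u = Fⁱ(x,u) ∂_{xⁱ} + ∑_{α < N} u_[α+1] ∂_{u_[α]}`. -/
def totalField {n : ℕ} (F : System n) (N : ℕ) (p : Jet n N) : Jet n N :=
  (F p.1 (p.2 0), fun α => if h : (α : ℕ) + 1 < N + 1 then p.2 ⟨(α : ℕ) + 1, h⟩ else 0)

/-- The Lie derivative of a function along `f_u`. -/
noncomputable def timeDeriv {n : ℕ} (F : System n) (N : ℕ) (h : Jet n N → ℝ) : Jet n N → ℝ :=
  fun p => fderiv ℝ h p (totalField F N p)

/-- The `a`-th time derivative `φʲ_[a]` of the `j`-th component of `φ(x)`. -/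
noncomputable def outDeriv {n : ℕ} (F : System n) (N : ℕ) (φ : Fin 2 → (Fin n → ℝ) → ℝ)
    (j : Fin 2) (a : ℕ) : Jet n N → ℝ :=
  (timeDeriv F N)^[a] (fun p => φ j p.1)

/-- The space `span{dx}` spanned by `dx¹, …, dxⁿ`. -/
def spanDx (n N : ℕ) : Submodule ℝ (Jet n N →L[ℝ] ℝ) :=
  Submodule.span ℝ (range fun i : Fin n =>
    (ContinuousLinearMap.proj i : (Fin n → ℝ) →L[ℝ] ℝ).comp
      (ContinuousLinearMap.fst ℝ (Fin n → ℝ) (Fin (N + 1) → Fin 2 → ℝ)))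

/-- The output `φʲ` has relative degree `k` near `p`: near `p` its time derivatives of order
less than `k` depend on `x` only, whereas `φʲ_[k]` depends on `u`, regularly at `p`. -/
def HasRelativeDegree {n : ℕ} (F : System n) (N : ℕ) (φ : Fin 2 → (Fin n → ℝ) → ℝ)
    (j : Fin 2) (k : ℕ) (p : Jet n N) : Prop :=
  1 ≤ k ∧ (∀ a < k, ∀ᶠ q in 𝓝 p, fderiv ℝ (outDeriv F N φ j a) q ∈ spanDx n N) ∧
    fderiv ℝ (outDeriv F N φ j k) p ∉ spanDx n N

/-- The tuple `(φ¹_[0], …, φ¹_[b₁-1], φ²_[0], …, φ²_[b₂-1])`, i.e. `φ_[0,B-1]`. -/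
noncomputable def outJet {n : ℕ} (F : System n) (N : ℕ) (φ : Fin 2 → (Fin n → ℝ) → ℝ)
    (B : Fin 2 → ℕ) (p : Jet n N) : (j : Fin 2) → Fin (B j) → ℝ :=
  fun j a => outDeriv F N φ j a p

/-- Near `p`, the identities `x = F_x(φ_[0,R-1])` and `u = F_u(φ_[0,R])` hold with smooth
maps `F_x`, `F_u`. -/
def FlatParametrization {n : ℕ} (F : System n) (N : ℕ) (φ : Fin 2 → (Fin n → ℝ) → ℝ)
    (p : Jet n N) (R : Fin 2 → ℕ) : Prop :=
  ∃ (Vx : Set ((j : Fin 2) → Fin (R j) → ℝ)) (Vu : Set ((j : Fin 2) → Fin (R j + 1) → ℝ))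
    (Fx : ((j : Fin 2) → Fin (R j) → ℝ) → (Fin n → ℝ))
    (Fu : ((j : Fin 2) → Fin (R j + 1) → ℝ) → (Fin 2 → ℝ)),
    IsOpen Vx ∧ IsOpen Vu ∧ ContDiffOn ℝ ∞ Fx Vx ∧ ContDiffOn ℝ ∞ Fu Vu ∧
    ∀ᶠ q in 𝓝 p,
      outJet F N φ R q ∈ Vx ∧ q.1 = Fx (outJet F N φ R q) ∧
      outJet F N φ (fun j => R j + 1) q ∈ Vu ∧
        q.2 0 = Fu (outJet F N φ (fun j => R j + 1) q)

/-- `P_A = span{dφ_[0,A]}`. -/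
noncomputable def codistP {n : ℕ} (F : System n) (N : ℕ) (φ : Fin 2 → (Fin n → ℝ) → ℝ)
    (A : Fin 2 → ℕ) : Codistribution (Jet n N) :=
  fun q => Submodule.span ℝ {η | ∃ j, ∃ a ≤ A j, η = fderiv ℝ (outDeriv F N φ j a) q}

/-- `Q_A = P_A ∩ span{dx}`. -/
noncomputable def codistQ {n : ℕ} (F : System n) (N : ℕ) (φ : Fin 2 → (Fin n → ℝ) → ℝ)
    (A : Fin 2 → ℕ) : Codistribution (Jet n N) :=
  fun q => codistP F N φ A q ⊓ spanDx n N

/-! ### Static feedback equivalence and the triangular form -/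

/-- A static feedback equivalence, near `(x₀, u₀)`, of the system `F` with the system `G`:
a local diffeomorphism `z = Φ_x(x)` near `x₀` and a local diffeomorphism
`(z, v) = (Φ_x(x), Φ_u(x, u))` near `(x₀, u₀)` that carries `F` into `G`. -/
structure StaticFeedbackEquiv {n : ℕ} (F G : System n) (x₀ : Fin n → ℝ) (u₀ : Fin 2 → ℝ) where
  Φx : OpenPartialHomeomorph (Fin n → ℝ) (Fin n → ℝ)
  Φ : OpenPartialHomeomorph ((Fin n → ℝ) × (Fin 2 → ℝ)) ((Fin n → ℝ) × (Fin 2 → ℝ))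
  mem_x : x₀ ∈ Φx.source
  mem : (x₀, u₀) ∈ Φ.source
  smooth_x : ContDiffOn ℝ ∞ Φx Φx.source
  smooth_x_symm : ContDiffOn ℝ ∞ Φx.symm Φx.target
  smooth : ContDiffOn ℝ ∞ Φ Φ.source
  smooth_symm : ContDiffOn ℝ ∞ Φ.symm Φ.target
  source_x : ∀ q ∈ Φ.source, q.1 ∈ Φx.source
  fst_eq : ∀ q ∈ Φ.source, (Φ q).1 = Φx q.1
  conj : ∀ q ∈ Φ.source, fderiv ℝ Φx q.1 (F q.1 q.2) = G (Φ q).1 (Φ q).2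

/-- The first `m` coordinates `(z¹, …, zᵐ)` of a point of `ℝⁿ`, `m ≤ n`. -/
def firstCoords {n m : ℕ} (h : m ≤ n) (z : Fin n → ℝ) : Fin m → ℝ :=
  fun i => z (Fin.castLE h i)

/-- The triangular form. The coordinate `i : Fin n` is `z^{i+1}`, and
`a l`, `b l` are the functions `aˡ(z¹, …, z^{l+1})`, `bˡ(z¹, …, z^{l+1})`, which are used for
`k₁ + k₂ ≤ l ≤ n - 1` only. It is meant for `k₁, k₂ ≥ 1`, `k₁ + k₂ ≤ n`. -/
def triangularSystem {n : ℕ} (k : Fin 2 → ℕ) (a b : (l : ℕ) → (Fin (l + 1) → ℝ) → ℝ) :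
    System n :=
  fun z v i =>
    if hn : (i : ℕ) + 1 = n then v 1
    else if (i : ℕ) + 1 = k 0 then v 0
    else if (i : ℕ) + 1 < k 0 + k 1 then z ⟨(i : ℕ) + 1, by omega⟩
    else a ((i : ℕ) + 1) (firstCoords (by omega) z) +
      b ((i : ℕ) + 1) (firstCoords (by omega) z) * v 0

/-- The partial derivative `∂_{z^{l+1}}` of a function of `(z¹, …, z^{l+1})`. -/
noncomputable def partialLast {l : ℕ} (c : (Fin (l + 1) → ℝ) → ℝ) (y : Fin (l + 1) → ℝ) : ℝ :=
  fderiv ℝ c y (Pi.single (Fin.last l) 1)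

/-- Near `(x₀, u₀)` the system `F` is static feedback equivalent to a triangular form with
`φ = (z¹, z^{k₁+1})`, `b^{k₁+k₂} ≠ 0` (a condition only if `k₁ + k₂ < n`) and
`∂_{z^{l+1}} aˡ ≠ 0` or `∂_{z^{l+1}} bˡ ≠ 0` for `l = k₁ + k₂, …, n - 1`. -/
def EquivToTriangular {n : ℕ} (F : System n) (φ : Fin 2 → (Fin n → ℝ) → ℝ) (k : Fin 2 → ℕ)
    (x₀ : Fin n → ℝ) (u₀ : Fin 2 → ℝ) : Prop :=
  k 0 + k 1 ≤ n ∧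
  ∃ (a b : (l : ℕ) → (Fin (l + 1) → ℝ) → ℝ)
    (E : StaticFeedbackEquiv F (triangularSystem k a b) x₀ u₀),
    (∃ i₀ i₁ : Fin n, (i₀ : ℕ) = 0 ∧ (i₁ : ℕ) = k 0 ∧
      ∀ x ∈ E.Φx.source, φ 0 x = E.Φx x i₀ ∧ φ 1 x = E.Φx x i₁) ∧
    (∀ l, k 0 + k 1 ≤ l → ∀ hl : l + 1 ≤ n,
      ContDiffOn ℝ ∞ (a l) (firstCoords hl '' E.Φx.target) ∧
      ContDiffOn ℝ ∞ (b l) (firstCoords hl '' E.Φx.target)) ∧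
    (∀ hk : k 0 + k 1 + 1 ≤ n, ∀ z ∈ E.Φx.target, b (k 0 + k 1) (firstCoords hk z) ≠ 0) ∧
    (∀ l, k 0 + k 1 ≤ l → ∀ hl : l + 1 ≤ n, ∀ z ∈ E.Φx.target,
      partialLast (a l) (firstCoords hl z) ≠ 0 ∨ partialLast (b l) (firstCoords hl z) ≠ 0)

end TwoInput

/-!
# Triangular forms for flat outputs of two-input systems

The proof works with differentials on the jet space. Given coordinates `z` of the state, the
`dzⁱ`, the `dφʲ_[kⱼ+i]` for one output `φʲ`, and the differentials of the jets of the input component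
that is not read off from `φʲ_[kⱼ]` form a basis of the cotangent space near `p`
(`linearIndependent_frame`), so spans of parts of such a coframe (`frameSpan`) have known
dimensions and intersections. A relation between differentials can be differentiated along `f_u`:
the coefficients of its leading terms are kept (`fderiv_lieDeriv_sub_sum_mem_span`,
`exists_leading_coeff`).

*Ranks.* Let `ρ` be the first number for which `φ²_[k₂+ρ]` is not a function of `x` and the
derivatives of `φ¹` near `p`. From the order `k₂ + ρ` on, every derivative of `φ²` brings in one
more derivative of the second input, at least on an open set close to `p`. As the outputs determine
`x`, a count of dimensions gives `n ≤ k₁ + k₂ + ρ` (`dim_le_of_leading_input`). On the other hand,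
a relation between the derivatives of the outputs below the order `K + ρ`, if it held on an open
set, could be differentiated until it contradicts the choice of `ρ`; so they are independent
somewhere (`exists_finrank_outSpan_eq`), whence `ρ = m := n - k₁ - k₂`. Since the ranks are constant
near `p`, `P_{K-1+l}` has rank `k₁ + k₂ + 2 l` for `l ≤ m + 1`, and `Q_{K-1+l}` has rank
`k₁ + k₂ + l` for `l ≤ m`; moreover `K + m ≤ R` (`exists_defect`). In particular `Q_{K-1+m}` is
`span{dx}`, and the values `l ≤ m` are among those that the second condition concerns.

*The triangular form implies integrability.* In triangular coordinates the outputs of order at most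
`K - 1 + l` are functions of `z¹, …, z^{k₁+k₂+l}` and `v¹, …, v¹_[l-1]`, and by the ranks `P_{K-1+l}`
is spanned by the differentials of the latter (`outSpan_le_of_triangular`). Hence `Q_{K-1+l}` is
spanned by `dz¹, …, dz^{k₁+k₂+l}` (`completelyIntegrableNear_of_equiv`).

*Integrability implies the triangular form.* The output derivatives that depend on `x` only are the
first `k₁ + k₂` coordinates. As the rank of `Q_{K-1+l}` grows by one at every step, each step
contributes one more function, whose differential lies in `Q_{K-1+l}` (`exists_adapted_coords`).
In these coordinates `P_{K-1+l}` is spanned by `dz¹, …, dz^{k₁+k₂+l}` and derivatives of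
`v¹ = φ¹_[k₁]`, and differentiating the relation that expresses `φ²_[k₂+l-1]` shows that the last of
these coordinates has a derivative in terms of `v¹` and one further coordinate, on which it does
depend (`fderiv_timeDeriv_coord_of_outSpan_eq`). The system being affine in `u`, this derivative
is `a + b v¹`, and varying `u` shows that `a` and `b` are both functions of these coordinates
(`AffineFrame.fderiv_coeff_eq_zero`). With `v² = ż^n` this is the triangular form
(`equivToTriangular_of_integrable`).
-/


namespace TwoInput

/-! ### Differentials and Lie derivatives -/

section Calculus

variable {E : Type*} [NormedAddCommGroup E] [NormedSpace ℝ E]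

theorem mem_span_of_common_kernel {ι : Type*} [Finite ι] (L : ι → E →L[ℝ] ℝ) (K : E →L[ℝ] ℝ)
    (h : ∀ ξ, (∀ i, L i ξ = 0) → K ξ = 0) : K ∈ Submodule.span ℝ (range L) := by
  have := Fintype.ofFinite ι
  have h1 : (K : E →ₗ[ℝ] ℝ) ∈ Submodule.span ℝ (range fun i => (L i : E →ₗ[ℝ] ℝ)) := by
    apply mem_span_of_iInf_ker_le_ker
    intro ξ hξ
    simp only [Submodule.mem_iInf, LinearMap.mem_ker] at hξ
    exact h ξ hξ
  obtain ⟨c, hc⟩ := (Submodule.mem_span_range_iff_exists_fun ℝ).1 h1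
  refine (Submodule.mem_span_range_iff_exists_fun ℝ).2 ⟨c, ?_⟩
  ext ξ
  have := congrArg (fun l : E →ₗ[ℝ] ℝ => l ξ) hc
  simpa using this

theorem apply_eq_sum_single {ι : Type*} [Fintype ι] [DecidableEq ι] (f : (ι → ℝ) →ₗ[ℝ] ℝ)
    (y : ι → ℝ) : f y = ∑ i, f (Pi.single i 1) * y i := by
  rw [LinearMap.pi_apply_eq_sum_univ f y]
  refine Finset.sum_congr rfl fun i _ => ?_
  have : (fun j => if i = j then (1 : ℝ) else 0) = Pi.single i 1 := by
    funext j; simp [Pi.single_apply, eq_comm]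
  rw [this, smul_eq_mul, mul_comm]

/-- Independent covectors have dual vectors, the images of the basis vectors under `s`. -/
theorem exists_rightInverse_of_linearIndependent {ι : Type*} [Fintype ι] {L : ι → E →L[ℝ] ℝ}
    (h : LinearIndependent ℝ L) :
    ∃ s : (ι → ℝ) →L[ℝ] E, (ContinuousLinearMap.pi L).comp s = ContinuousLinearMap.id ℝ _ := by
  classical
  have hsurj : Function.Surjective (LinearMap.pi fun i => (L i : E →ₗ[ℝ] ℝ)) := by
    rw [← LinearMap.range_eq_top]
    by_contra hne
    obtain ⟨f, hf0, hf⟩ := Submodule.exists_le_ker_of_lt_top _ (lt_top_iff_ne_top.2 hne)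
    have hsum : ∑ i, f (Pi.single i 1) • L i = 0 := by
      ext ξ
      have h1 := hf ⟨ξ, rfl⟩
      rw [LinearMap.mem_ker, apply_eq_sum_single] at h1
      simpa using h1
    have h0 := Fintype.linearIndependent_iff.1 h _ hsum
    apply hf0
    ext i
    simpa using h0 i
  obtain ⟨s, hs⟩ := LinearMap.exists_rightInverse_of_surjective _
    (LinearMap.range_eq_top.2 hsurj)
  refine ⟨LinearMap.toContinuousLinearMap s, ?_⟩
  refine ContinuousLinearMap.ext fun y => ?_
  funext j
  have := congrArg (fun l : (ι → ℝ) →ₗ[ℝ] (ι → ℝ) => l y j) hs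
  simpa using this

/-- The formula `d(L_V h) ξ = d²h(V, ξ) + dh(dV ξ)`; the order of the arguments of `d²h` rests on
the symmetry of the second derivative. -/
theorem fderiv_lieDeriv {h : E → ℝ} {V : E → E} {q : E} (hh : ContDiffAt ℝ ∞ h q)
    (hV : DifferentiableAt ℝ V q) (ξ : E) :
    fderiv ℝ (fun x => fderiv ℝ h x (V x)) q ξ =
      fderiv ℝ (fderiv ℝ h) q (V q) ξ + fderiv ℝ h q (fderiv ℝ V q ξ) := by
  have h1 : DifferentiableAt ℝ (fderiv ℝ h) q :=
    (hh.fderiv_right (m := 1) (by norm_cast)).differentiableAt (by simp)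
  have h2 := (h1.hasFDerivAt.clm_apply hV.hasFDerivAt).fderiv
  have hs : IsSymmSndFDerivAt ℝ h q := hh.isSymmSndFDerivAt (by simpa using ENat.LEInfty.out)
  rw [h2]
  simp only [add_apply, ContinuousLinearMap.comp_apply,
    ContinuousLinearMap.flip_apply]
  rw [hs.eq, add_comm]

/-- If `dh` is a combination of independent differentials `dgᵢ` near `q`, then `d(L_V h)` is the
same combination of the `d(L_V gᵢ)` modulo the `dgᵢ`: the coefficients are differentiable, and
their derivatives only multiply the `dgᵢ`. -/
theorem fderiv_lieDeriv_sub_sum_mem_span {ι : Type*} [Fintype ι] {g : ι → E → ℝ} {h : E → ℝ}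
    {V : E → E} {q : E} (hg : ∀ i, ContDiffAt ℝ ∞ (g i) q) (hh : ContDiffAt ℝ ∞ h q)
    (hV : DifferentiableAt ℝ V q) (hli : LinearIndependent ℝ fun i => fderiv ℝ (g i) q)
    (hmem : ∀ᶠ x in 𝓝 q, fderiv ℝ h x ∈ Submodule.span ℝ (range fun i => fderiv ℝ (g i) x)) :
    ∃ c : ι → ℝ, fderiv ℝ h q = ∑ i, c i • fderiv ℝ (g i) q ∧
      fderiv ℝ (fun x => fderiv ℝ h x (V x)) q
        - ∑ i, c i • fderiv ℝ (fun x => fderiv ℝ (g i) x (V x)) q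
        ∈ Submodule.span ℝ (range fun i => fderiv ℝ (g i) q) := by
  classical
  obtain ⟨s, hs⟩ := exists_rightInverse_of_linearIndependent hli
  set DG : E → E →L[ℝ] (ι → ℝ) := fun x => ContinuousLinearMap.pi fun i => fderiv ℝ (g i) x
    with hDG
  have hdg : ∀ i, DifferentiableAt ℝ (fderiv ℝ (g i)) q := fun i =>
    ((hg i).fderiv_right (m := 1) (by norm_cast)).differentiableAt (by simp)
  have hdh : DifferentiableAt ℝ (fderiv ℝ h) q :=
    (hh.fderiv_right (m := 1) (by norm_cast)).differentiableAt (by simp)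
  have hDGd : HasFDerivAt DG (∑ i, (ContinuousLinearMap.compL ℝ E ℝ (ι → ℝ)
      (ContinuousLinearMap.single ℝ (fun _ : ι => ℝ) i)).comp (fderiv ℝ (fderiv ℝ (g i)) q)) q := by
    have : DG = fun x => ∑ i, ContinuousLinearMap.compL ℝ E ℝ (ι → ℝ)
      (ContinuousLinearMap.single ℝ (fun _ : ι => ℝ) i) (fderiv ℝ (g i) x) := by
      funext x
      ext ξ j
      simp [hDG, Finset.sum_apply, Pi.single_apply]
    rw [this]
    exact HasFDerivAt.fun_sum fun i _ => ((ContinuousLinearMap.compL ℝ E ℝ (ι → ℝ)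
      (ContinuousLinearMap.single ℝ (fun _ : ι => ℝ) i)).hasFDerivAt).comp q (hdg i).hasFDerivAt
  set A : E → (ι → ℝ) →L[ℝ] (ι → ℝ) := fun x => (DG x).comp s with hA
  have hAq : A q = 1 := hs
  have hAd : DifferentiableAt ℝ A q := hDGd.differentiableAt.clm_comp (differentiableAt_const s)
  have hinv : DifferentiableAt ℝ (fun x => Ring.inverse (A x)) q := by
    have h1 : DifferentiableAt ℝ (Ring.inverse : ((ι → ℝ) →L[ℝ] (ι → ℝ)) → _) (A q) := by
      rw [hAq]
      exact (contDiffAt_ringInverse ℝ (n := 1) (1 : ((ι → ℝ) →L[ℝ] (ι → ℝ))ˣ)).differentiableAt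
        (by simp)
    exact h1.comp q hAd
  set C : E → (ι → ℝ) →L[ℝ] ℝ := fun x => ((fderiv ℝ h x).comp s).comp (Ring.inverse (A x))
  have hCd : DifferentiableAt ℝ C q :=
    (hdh.clm_comp (differentiableAt_const s)).clm_comp hinv
  have hunit : ∀ᶠ x in 𝓝 q, IsUnit (A x) := by
    have : {a : (ι → ℝ) →L[ℝ] (ι → ℝ) | IsUnit a} ∈ 𝓝 (A q) :=
      Units.isOpen.mem_nhds (by rw [hAq]; exact isUnit_one)
    exact hAd.continuousAt this
  have heq : ∀ᶠ x in 𝓝 q, fderiv ℝ h x = (C x).comp (DG x) := by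
    filter_upwards [hmem, hunit] with x hx hu
    obtain ⟨c, hc⟩ := (Submodule.mem_span_range_iff_exists_fun ℝ).1 hx
    set c' : (ι → ℝ) →L[ℝ] ℝ := ∑ i, c i • ContinuousLinearMap.proj (R := ℝ) (φ := fun _ : ι => ℝ) i
    have h1 : fderiv ℝ h x = c'.comp (DG x) := by
      rw [← hc]; ext ξ; simp [c', hDG]
    have h2 : C x = c' := by
      have : (fderiv ℝ h x).comp s = c'.comp (A x) := by rw [h1]; rfl
      simp only [C]
      rw [this, ContinuousLinearMap.comp_assoc]
      have h3 : (A x).comp (Ring.inverse (A x)) = ContinuousLinearMap.id ℝ _ :=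
        Ring.mul_inverse_cancel _ hu
      rw [h3]; rfl
    rw [h2, h1]
  have hsecond : fderiv ℝ (fderiv ℝ h) q = fderiv ℝ (fun x => (C x).comp (DG x)) q :=
    Filter.EventuallyEq.fderiv_eq heq
  have hsecond' := (hCd.hasFDerivAt.clm_comp hDGd).fderiv
  refine ⟨fun i => C q (Pi.single i 1), ?_, ?_⟩
  · have h1 := heq.self_of_nhds
    rw [h1]
    ext ξ
    simp only [ContinuousLinearMap.comp_apply, sum_apply,
      smul_apply, smul_eq_mul]
    exact apply_eq_sum_single (C q).toLinearMap (DG q ξ)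
  · apply mem_span_of_common_kernel
    intro ξ hξ
    have hcomb : ∀ y : ι → ℝ, C q y = ∑ i, C q (Pi.single i 1) * y i :=
      apply_eq_sum_single (C q).toLinearMap
    have h0 : DG q ξ = 0 := by funext i; exact hξ i
    have h2 : fderiv ℝ (fderiv ℝ h) q (V q) ξ =
        ∑ i, C q (Pi.single i 1) * fderiv ℝ (fderiv ℝ (g i)) q (V q) ξ := by
      rw [hsecond, hsecond']
      simp only [add_apply, ContinuousLinearMap.comp_apply,
        ContinuousLinearMap.compL_apply, ContinuousLinearMap.flip_apply, h0, map_zero, add_zero,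
        sum_apply]
      rw [hcomb]
      simp [Finset.sum_apply, Pi.single_apply]
    have h3 : ∀ w, fderiv ℝ h q w = ∑ i, C q (Pi.single i 1) * fderiv ℝ (g i) q w := by
      intro w
      rw [heq.self_of_nhds]
      exact hcomb _
    simp only [sub_apply, sum_apply,
      smul_apply, smul_eq_mul]
    rw [fderiv_lieDeriv hh hV, h2, h3, sub_eq_zero, ← Finset.sum_add_distrib]
    refine Finset.sum_congr rfl fun i _ => ?_
    rw [fderiv_lieDeriv (hg i) hV, mul_add]

theorem fderiv_lieDeriv_mem {ι : Type*} [Finite ι] {g : ι → E → ℝ} {h : E → ℝ}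
    {V : E → E} {q : E} (hg : ∀ i, ContDiffAt ℝ ∞ (g i) q) (hh : ContDiffAt ℝ ∞ h q)
    (hV : DifferentiableAt ℝ V q) (hli : LinearIndependent ℝ fun i => fderiv ℝ (g i) q)
    (hmem : ∀ᶠ x in 𝓝 q, fderiv ℝ h x ∈ Submodule.span ℝ (range fun i => fderiv ℝ (g i) x))
    {B : Submodule ℝ (E →L[ℝ] ℝ)} (hB : ∀ i, fderiv ℝ (g i) q ∈ B)
    (hB' : ∀ i, fderiv ℝ (fun x => fderiv ℝ (g i) x (V x)) q ∈ B) :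
    fderiv ℝ (fun x => fderiv ℝ h x (V x)) q ∈ B := by
  have := Fintype.ofFinite ι
  obtain ⟨c, -, hc⟩ := fderiv_lieDeriv_sub_sum_mem_span hg hh hV hli hmem
  have h1 : Submodule.span ℝ (range fun i => fderiv ℝ (g i) q) ≤ B :=
    Submodule.span_le.2 (by rintro _ ⟨i, rfl⟩; exact hB i)
  have h2 : ∑ i, c i • fderiv ℝ (fun x => fderiv ℝ (g i) x (V x)) q ∈ B :=
    B.sum_mem fun i _ => B.smul_mem _ (hB' i)
  simpa using B.add_mem (h1 hc) h2

/-- The leading coefficient is inherited by the Lie derivative: if every `d(L_V gᵢ)` except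
for `i = i₀` lies in `B`, then `dh` and `d(L_V h)` have the same coefficient along `dg` and
`d(L_V g)` of index `i₀`. -/
theorem exists_leading_coeff {ι : Type*} [Finite ι] {g : ι → E → ℝ} {h : E → ℝ}
    {V : E → E} {q : E} (hg : ∀ i, ContDiffAt ℝ ∞ (g i) q) (hh : ContDiffAt ℝ ∞ h q)
    (hV : DifferentiableAt ℝ V q) (hli : LinearIndependent ℝ fun i => fderiv ℝ (g i) q)
    (hmem : ∀ᶠ x in 𝓝 q, fderiv ℝ h x ∈ Submodule.span ℝ (range fun i => fderiv ℝ (g i) x))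
    (i₀ : ι) {A B : Submodule ℝ (E →L[ℝ] ℝ)} (hA : ∀ i, i ≠ i₀ → fderiv ℝ (g i) q ∈ A)
    (hB : ∀ i, fderiv ℝ (g i) q ∈ B)
    (hB' : ∀ i, i ≠ i₀ → fderiv ℝ (fun x => fderiv ℝ (g i) x (V x)) q ∈ B) :
    ∃ c : ℝ, fderiv ℝ h q - c • fderiv ℝ (g i₀) q ∈ A ∧
      fderiv ℝ (fun x => fderiv ℝ h x (V x)) q
        - c • fderiv ℝ (fun x => fderiv ℝ (g i₀) x (V x)) q ∈ B := by
  classical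
  have := Fintype.ofFinite ι
  obtain ⟨c, hc0, hc⟩ := fderiv_lieDeriv_sub_sum_mem_span hg hh hV hli hmem
  have h1 : Submodule.span ℝ (range fun i => fderiv ℝ (g i) q) ≤ B :=
    Submodule.span_le.2 (by rintro _ ⟨i, rfl⟩; exact hB i)
  refine ⟨c i₀, ?_, ?_⟩
  · rw [hc0, ← Finset.add_sum_erase _ _ (Finset.mem_univ i₀), add_sub_cancel_left]
    exact A.sum_mem fun i hi => A.smul_mem _ (hA i (Finset.ne_of_mem_erase hi))
  · have h2 : ∑ i ∈ Finset.univ.erase i₀, c i • fderiv ℝ (fun x => fderiv ℝ (g i) x (V x)) q ∈ B :=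
      B.sum_mem fun i hi => B.smul_mem _ (hB' i (Finset.ne_of_mem_erase hi))
    have h3 := B.add_mem (h1 hc) h2
    rw [← Finset.add_sum_erase _ _ (Finset.mem_univ i₀)] at h3
    convert h3 using 1
    abel

theorem eventually_linearIndependent {ι : Type*} [Finite ι] {w : ι → E → E →L[ℝ] ℝ} {q : E}
    (hw : ∀ i, ContinuousAt (w i) q) (hli : LinearIndependent ℝ fun i => w i q) :
    ∀ᶠ x in 𝓝 q, LinearIndependent ℝ fun i => w i x :=
  (continuousAt_pi.2 hw : ContinuousAt (fun x i => w i x) q).eventually hli.eventually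

theorem eventually_finrank_le {ι : Type*} [Finite ι] {w : ι → E → E →L[ℝ] ℝ} {q : E}
    (hw : ∀ i, ContinuousAt (w i) q) :
    ∀ᶠ x in 𝓝 q, Module.finrank ℝ (Submodule.span ℝ (range fun i => w i q)) ≤
      Module.finrank ℝ (Submodule.span ℝ (range fun i => w i x)) := by
  obtain ⟨κ, a, ha, hsp, hli⟩ := exists_linearIndependent' ℝ fun i => w i q
  have := Finite.of_injective a ha
  have := Fintype.ofFinite κ
  filter_upwards [eventually_linearIndependent (fun i => hw (a i)) hli] with x hx
  rw [← hsp, finrank_span_eq_card hli, ← finrank_span_eq_card hx]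
  have : FiniteDimensional ℝ (Submodule.span ℝ (range fun i => w i x)) :=
    FiniteDimensional.span_of_finite ℝ (finite_range _)
  exact Submodule.finrank_mono (Submodule.span_mono (by rintro _ ⟨i, rfl⟩; exact ⟨a i, rfl⟩))

/-- The Lie derivative of a relation `dh ∈ span{dgᵢ}`, with the independence of the `dgᵢ` weakened
to constant rank: a maximal independent subfamily at `q` spans the same codistribution near `q`. -/
theorem fderiv_lieDeriv_mem_of_finrank {ι : Type*} [Finite ι] {g : ι → E → ℝ} {h : E → ℝ}
    {V : E → E} {q : E} (hg : ∀ i, ContDiffAt ℝ ∞ (g i) q) (hh : ContDiffAt ℝ ∞ h q)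
    (hV : DifferentiableAt ℝ V q)
    (hrank : ∀ᶠ x in 𝓝 q, Module.finrank ℝ (Submodule.span ℝ (range fun i => fderiv ℝ (g i) x)) =
      Module.finrank ℝ (Submodule.span ℝ (range fun i => fderiv ℝ (g i) q)))
    (hmem : ∀ᶠ x in 𝓝 q, fderiv ℝ h x ∈ Submodule.span ℝ (range fun i => fderiv ℝ (g i) x))
    {B : Submodule ℝ (E →L[ℝ] ℝ)} (hB : ∀ i, fderiv ℝ (g i) q ∈ B)
    (hB' : ∀ i, fderiv ℝ (fun x => fderiv ℝ (g i) x (V x)) q ∈ B) :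
    fderiv ℝ (fun x => fderiv ℝ h x (V x)) q ∈ B := by
  obtain ⟨κ, a, ha, hsp, hli⟩ := exists_linearIndependent' ℝ fun i => fderiv ℝ (g i) q
  have := Finite.of_injective a ha
  have := Fintype.ofFinite κ
  have hcont : ∀ i, ContinuousAt (fderiv ℝ (g (a i))) q := fun i =>
    ((hg (a i)).fderiv_right (m := 0) (by norm_cast)).continuousAt
  refine fderiv_lieDeriv_mem (g := fun i => g (a i)) (fun i => hg (a i)) hh hV hli ?_
    (fun i => hB (a i)) (fun i => hB' (a i))
  filter_upwards [hrank, hmem, eventually_linearIndependent hcont hli] with x hx hm hxli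
  have : FiniteDimensional ℝ (Submodule.span ℝ (range fun i => fderiv ℝ (g i) x)) :=
    FiniteDimensional.span_of_finite ℝ (finite_range _)
  have hle : Submodule.span ℝ (range fun i => fderiv ℝ (g (a i)) x) ≤
      Submodule.span ℝ (range fun i => fderiv ℝ (g i) x) :=
    Submodule.span_mono (by rintro _ ⟨i, rfl⟩; exact ⟨a i, rfl⟩)
  rw [Submodule.eq_of_le_of_finrank_eq hle]
  · exact hm
  · rw [hx, ← hsp, finrank_span_eq_card hxli, finrank_span_eq_card hli]

/-- A function whose differential vanishes in the direction `y - x` takes the same value at `x` and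
`y`, by the mean value theorem on the segment. -/
theorem eq_of_fderiv_sub_eq_zero {B : Set E} (hB : IsOpen B) (hc : Convex ℝ B) {h : E → ℝ}
    (hh : DifferentiableOn ℝ h B) {x y : E} (hx : x ∈ B) (hy : y ∈ B)
    (h0 : ∀ q ∈ B, fderiv ℝ h q (y - x) = 0) : h x = h y := by
  obtain ⟨z, hz, hzeq⟩ := domain_mvt (f' := fderiv ℝ h)
    (fun q hq => ((hh q hq).differentiableAt (hB.mem_nhds hq)).hasFDerivAt.hasFDerivWithinAt)
    hc hx hy
  rw [h0 z (hc.segment_subset hx hy hz)] at hzeq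
  linarith

/-- The inverse function theorem, with a ball as target. -/
theorem exists_localDiffeo {E' : Type*} [NormedAddCommGroup E'] [NormedSpace ℝ E']
    [FiniteDimensional ℝ E] [FiniteDimensional ℝ E'] {Z : E → E'} {U : Set E} (hU : IsOpen U)
    {x₀ : E} (hx₀ : x₀ ∈ U) (hZ : ContDiffOn ℝ ∞ Z U)
    (hbij : Function.Bijective (fderiv ℝ Z x₀)) :
    ∃ e : OpenPartialHomeomorph E E', ⇑e = Z ∧ x₀ ∈ e.source ∧ e.source ⊆ U ∧
      (∃ r > 0, e.target = Metric.ball (Z x₀) r) ∧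
      ContDiffOn ℝ ∞ e e.source ∧ ContDiffOn ℝ ∞ e.symm e.target := by
  have := FiniteDimensional.complete ℝ E
  have := FiniteDimensional.complete ℝ E'
  have hZa : ∀ x ∈ U, ContDiffAt ℝ ∞ Z x := fun x hx => hZ.contDiffAt (hU.mem_nhds hx)
  set A : E ≃L[ℝ] E' := ContinuousLinearEquiv.ofBijective (fderiv ℝ Z x₀)
    (LinearMap.ker_eq_bot.2 hbij.1) (LinearMap.range_eq_top.2 hbij.2) with hA
  have hAcoe : (A : E →L[ℝ] E') = fderiv ℝ Z x₀ :=
    ContinuousLinearEquiv.coe_ofBijective _ _ _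
  have hder : HasFDerivAt Z (A : E →L[ℝ] E') x₀ := by
    rw [hAcoe]; exact ((hZa x₀ hx₀).differentiableAt (by simp)).hasFDerivAt
  set e₀ := (hZa x₀ hx₀).toOpenPartialHomeomorph Z hder (by simp) with he₀
  have he₀coe : ⇑e₀ = Z := rfl
  have hx₀e : x₀ ∈ e₀.source := (hZa x₀ hx₀).mem_toOpenPartialHomeomorph_source hder (by simp)
  have hZx₀ : Z x₀ ∈ e₀.target :=
    (hZa x₀ hx₀).image_mem_toOpenPartialHomeomorph_target hder (by simp)
  have hinv : ∀ᶠ x in 𝓝 x₀, fderiv ℝ Z x ∈ range ((↑) : (E ≃L[ℝ] E') → E →L[ℝ] E') := by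
    have hc : ContinuousAt (fderiv ℝ Z) x₀ :=
      ((hZa x₀ hx₀).fderiv_right (m := 0) (by norm_cast)).continuousAt
    exact hc (ContinuousLinearEquiv.isOpen.mem_nhds ⟨A, hAcoe⟩)
  have hgood : ∀ᶠ x in 𝓝 x₀, x ∈ U ∧ fderiv ℝ Z x ∈ range ((↑) : (E ≃L[ℝ] E') → E →L[ℝ] E') :=
    (hU.eventually_mem hx₀).and hinv
  have hsymm : e₀.symm (Z x₀) = x₀ := e₀.left_inv hx₀e
  have hgood' : ∀ᶠ y in 𝓝 (Z x₀), y ∈ e₀.target ∧ (e₀.symm y ∈ U ∧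
      fderiv ℝ Z (e₀.symm y) ∈ range ((↑) : (E ≃L[ℝ] E') → E →L[ℝ] E')) := by
    refine (e₀.open_target.eventually_mem hZx₀).and ?_
    have hc := e₀.continuousAt_symm hZx₀
    have : Tendsto e₀.symm (𝓝 (Z x₀)) (𝓝 x₀) := by
      have h1 := hc.tendsto
      rwa [hsymm] at h1
    exact this.eventually hgood
  obtain ⟨r, hr, hball⟩ := Metric.eventually_nhds_iff_ball.1 hgood'
  set e := (e₀.symm.restrOpen (Metric.ball (Z x₀) r) Metric.isOpen_ball).symm with he
  have htarget : e.target = Metric.ball (Z x₀) r := by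
    have : e.target = e₀.target ∩ Metric.ball (Z x₀) r := rfl
    rw [this]
    exact inter_eq_right.2 fun y hy => (hball y hy).1
  have hcoe : ⇑e = Z := rfl
  have hcoes : ⇑e.symm = e₀.symm := rfl
  have hsrc : ∀ x ∈ e.source, x ∈ U ∧
      fderiv ℝ Z x ∈ range ((↑) : (E ≃L[ℝ] E') → E →L[ℝ] E') := by
    intro x hx
    have h1 : e x ∈ Metric.ball (Z x₀) r := htarget ▸ e.map_source hx
    have h2 := (hball _ h1).2
    rw [← hcoes, e.left_inv hx] at h2
    exact h2
  refine ⟨e, hcoe, ?_, fun x hx => (hsrc x hx).1, ⟨r, hr, htarget⟩, ?_, ?_⟩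
  · have h1 : Z x₀ ∈ e.target := by rw [htarget]; exact Metric.mem_ball_self hr
    have h2 := e.map_target h1
    rwa [hcoes, hsymm] at h2
  · rw [hcoe]; exact hZ.mono fun x hx => (hsrc x hx).1
  · intro y hy
    obtain ⟨hyU, B, hB⟩ := hsrc _ (e.map_target hy)
    refine (e.contDiffAt_symm (f₀' := B) hy ?_ (hZa _ hyU)).contDiffWithinAt
    rw [hB]
    exact ((hZa _ hyU).differentiableAt (by simp)).hasFDerivAt

end Calculus

section Diffeo

variable {E E' : Type*} [NormedAddCommGroup E] [NormedSpace ℝ E] [NormedAddCommGroup E']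
  [NormedSpace ℝ E']

theorem fderiv_symm_fderiv {e : OpenPartialHomeomorph E E'} (h1 : ContDiffOn ℝ ∞ e e.source)
    (h2 : ContDiffOn ℝ ∞ e.symm e.target) {x : E} (hx : x ∈ e.source) (ξ : E) :
    fderiv ℝ e.symm (e x) (fderiv ℝ e x ξ) = ξ := by
  have h1' : DifferentiableAt ℝ e x :=
    (h1.contDiffAt (e.open_source.mem_nhds hx)).differentiableAt (by simp)
  have h2' : DifferentiableAt ℝ e.symm (e x) :=
    (h2.contDiffAt (e.open_target.mem_nhds (e.map_source hx))).differentiableAt (by simp)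
  have h3 : (e.symm ∘ e) =ᶠ[𝓝 x] id := e.eventually_left_inverse hx
  have h4 := h3.fderiv_eq (𝕜 := ℝ)
  rw [fderiv_comp _ h2' h1', fderiv_id] at h4
  exact congrArg (fun L : E →L[ℝ] E => L ξ) h4

theorem fderiv_fderiv_symm {e : OpenPartialHomeomorph E E'} (h1 : ContDiffOn ℝ ∞ e e.source)
    (h2 : ContDiffOn ℝ ∞ e.symm e.target) {y : E'} (hy : y ∈ e.target) (η : E') :
    fderiv ℝ e (e.symm y) (fderiv ℝ e.symm y η) = η :=
  fderiv_symm_fderiv (e := e.symm) h2 h1 hy η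

end Diffeo

/-! ### Linear algebra of spans -/

section LinearAlgebra

variable {V : Type*} [AddCommGroup V] [Module ℝ V]

theorem span_image_inf_le {ι : Type*} {v : ι → V} (hv : LinearIndependent ℝ v) (s t : Set ι) :
    Submodule.span ℝ (v '' s) ⊓ Submodule.span ℝ (v '' t) ≤ Submodule.span ℝ (v '' (s ∩ t)) := by
  rintro x ⟨hs, ht⟩
  obtain ⟨l, hl, rfl⟩ := (Finsupp.mem_span_image_iff_linearCombination ℝ).1 hs
  obtain ⟨l', hl', h⟩ := (Finsupp.mem_span_image_iff_linearCombination ℝ).1 ht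
  obtain rfl := hv.finsuppLinearCombination_injective h
  refine (Finsupp.mem_span_image_iff_linearCombination ℝ).2 ⟨l', ?_, rfl⟩
  rw [Finsupp.supported_inter]
  exact ⟨hl, hl'⟩

theorem finrank_lt_of_mem_of_notMem [FiniteDimensional ℝ V] {S T : Submodule ℝ V} (hST : S ≤ T)
    {x : V} (hx : x ∈ T) (hxS : x ∉ S) : Module.finrank ℝ S < Module.finrank ℝ T :=
  Submodule.finrank_lt_finrank_of_lt (lt_of_le_of_ne hST fun h => hxS (h ▸ hx))

end LinearAlgebra

/-! ### Time derivatives on the jet space -/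

section Jets

variable {n N : ℕ}

/-- The linear part `u_[α] ↦ u_[α+1]` of the vector field `f_u`. -/
noncomputable def jetShift (N : ℕ) : (Fin (N + 1) → Fin 2 → ℝ) →L[ℝ] (Fin (N + 1) → Fin 2 → ℝ) :=
  ContinuousLinearMap.pi fun α =>
    if h : (α : ℕ) + 1 < N + 1 then ContinuousLinearMap.proj ⟨(α : ℕ) + 1, h⟩ else 0

theorem jetShift_apply (ζ : Fin (N + 1) → Fin 2 → ℝ) (α : Fin (N + 1)) :
    jetShift N ζ α = if h : (α : ℕ) + 1 < N + 1 then ζ ⟨(α : ℕ) + 1, h⟩ else 0 := by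
  simp only [jetShift, ContinuousLinearMap.pi_apply]
  split_ifs <;> rfl

theorem totalField_eq (F : System n) (q : Jet n N) :
    totalField F N q = (F q.1 (q.2 0), jetShift N q.2) := by
  refine Prod.ext rfl ?_
  funext α
  exact (jetShift_apply q.2 α).symm

/-- The standing regularity assumptions, on an open set `O` of jets over the open set `X`: the
system and the outputs are smooth, `φʲ` has relative degree `kⱼ`, and the derivative of `φʲ_[kⱼ]`
with respect to the component `sⱼ` of the input does not vanish. -/
structure RegularOn (F : System n) (φ : Fin 2 → (Fin n → ℝ) → ℝ) (k : Fin 2 → ℕ)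
    (s : Fin 2 → Fin 2) (X : Set (Fin n → ℝ)) (O : Set (Jet n N)) : Prop where
  isOpen_base : IsOpen X
  isOpen : IsOpen O
  base_mem : ∀ q ∈ O, q.1 ∈ X
  smooth_system : ContDiffOn ℝ ∞ (fun y : (Fin n → ℝ) × (Fin 2 → ℝ) => F y.1 y.2) (X ×ˢ univ)
  smooth_output : ∀ j, ContDiffOn ℝ ∞ (φ j) X
  one_le : ∀ j, 1 ≤ k j
  horizontal : ∀ j, ∀ a < k j, ∀ q ∈ O, fderiv ℝ (outDeriv F N φ j a) q ∈ spanDx n N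
  vertical : ∀ j, ∀ q ∈ O,
    fderiv ℝ (outDeriv F N φ j (k j)) q (0, Pi.single 0 (Pi.single (s j) 1)) ≠ 0

theorem contDiffAt_totalField {F : System n} {X : Set (Fin n → ℝ)} (hX : IsOpen X)
    (hF : ContDiffOn ℝ ∞ (fun y : (Fin n → ℝ) × (Fin 2 → ℝ) => F y.1 y.2) (X ×ˢ univ))
    {q : Jet n N} (hq : q.1 ∈ X) : ContDiffAt ℝ ∞ (totalField F N) q := by
  have h0 : totalField F N = fun q : Jet n N => (F q.1 (q.2 0), jetShift N q.2) :=
    funext fun q => totalField_eq F q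
  rw [h0]
  have h1 : ContDiffAt ℝ ∞ (fun q : Jet n N => (q.1, q.2 0)) q := by fun_prop
  have h2 : ContDiffAt ℝ ∞ (fun y : (Fin n → ℝ) × (Fin 2 → ℝ) => F y.1 y.2) (q.1, q.2 0) :=
    hF.contDiffAt ((hX.prod isOpen_univ).mem_nhds ⟨hq, mem_univ _⟩)
  have h3 : ContDiffAt ℝ ∞ (fun q : Jet n N => F q.1 (q.2 0)) q :=
    ContDiffAt.comp (g := fun y : (Fin n → ℝ) × (Fin 2 → ℝ) => F y.1 y.2) q h2 h1
  exact h3.prodMk ((jetShift N).contDiff.contDiffAt.comp q contDiffAt_snd)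

theorem fderiv_totalField {F : System n} {X : Set (Fin n → ℝ)} (hX : IsOpen X)
    (hF : ContDiffOn ℝ ∞ (fun y : (Fin n → ℝ) × (Fin 2 → ℝ) => F y.1 y.2) (X ×ˢ univ))
    {q : Jet n N} (hq : q.1 ∈ X) (ξ : Jet n N) :
    fderiv ℝ (totalField F N) q ξ =
      (fderiv ℝ (fun y : (Fin n → ℝ) × (Fin 2 → ℝ) => F y.1 y.2) (q.1, q.2 0) (ξ.1, ξ.2 0),
        jetShift N ξ.2) := by
  have h0 : totalField F N = fun q : Jet n N => (F q.1 (q.2 0), jetShift N q.2) :=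
    funext fun q => totalField_eq F q
  rw [h0]
  have h2 : DifferentiableAt ℝ (fun y : (Fin n → ℝ) × (Fin 2 → ℝ) => F y.1 y.2) (q.1, q.2 0) :=
    (hF.contDiffAt ((hX.prod isOpen_univ).mem_nhds ⟨hq, mem_univ _⟩)).differentiableAt (by simp)
  set P : Jet n N →L[ℝ] (Fin n → ℝ) × (Fin 2 → ℝ) :=
    (ContinuousLinearMap.fst ℝ _ _).prod
      ((ContinuousLinearMap.proj 0).comp (ContinuousLinearMap.snd ℝ _ _)) with hP
  have h3 : HasFDerivAt (fun q : Jet n N => F q.1 (q.2 0))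
      ((fderiv ℝ (fun y : (Fin n → ℝ) × (Fin 2 → ℝ) => F y.1 y.2) (q.1, q.2 0)).comp P) q :=
    HasFDerivAt.comp (g := fun y : (Fin n → ℝ) × (Fin 2 → ℝ) => F y.1 y.2) q
      h2.hasFDerivAt P.hasFDerivAt
  have h4 : HasFDerivAt (fun q : Jet n N => jetShift N q.2)
      ((jetShift N).comp (ContinuousLinearMap.snd ℝ _ _)) q :=
    ((jetShift N).comp (ContinuousLinearMap.snd ℝ (Fin n → ℝ) _)).hasFDerivAt (x := q)
  rw [(h3.prodMk h4).fderiv]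
  rfl

theorem outDeriv_succ (F : System n) (φ : Fin 2 → (Fin n → ℝ) → ℝ) (j : Fin 2) (a : ℕ) :
    outDeriv F N φ j (a + 1) = timeDeriv F N (outDeriv F N φ j a) :=
  Function.iterate_succ_apply' _ _ _

theorem contDiffAt_timeDeriv {F : System n} {X : Set (Fin n → ℝ)} (hX : IsOpen X)
    (hF : ContDiffOn ℝ ∞ (fun y : (Fin n → ℝ) × (Fin 2 → ℝ) => F y.1 y.2) (X ×ˢ univ))
    {q : Jet n N} (hq : q.1 ∈ X) {h : Jet n N → ℝ} (hh : ContDiffAt ℝ ∞ h q) :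
    ContDiffAt ℝ ∞ (timeDeriv F N h) q :=
  (hh.fderiv_right (m := ∞) (by simp)).clm_apply (contDiffAt_totalField hX hF hq)

theorem contDiffAt_outDeriv {F : System n} {X : Set (Fin n → ℝ)} (hX : IsOpen X)
    (hF : ContDiffOn ℝ ∞ (fun y : (Fin n → ℝ) × (Fin 2 → ℝ) => F y.1 y.2) (X ×ˢ univ))
    {φ : Fin 2 → (Fin n → ℝ) → ℝ} (hφ : ∀ j, ContDiffOn ℝ ∞ (φ j) X)
    {q : Jet n N} (hq : q.1 ∈ X) (j : Fin 2) (a : ℕ) :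
    ContDiffAt ℝ ∞ (outDeriv F N φ j a) q := by
  induction a with
  | zero =>
    have h1 : ContDiffAt ℝ ∞ (φ j) q.1 := (hφ j).contDiffAt (hX.mem_nhds hq)
    exact h1.comp q contDiffAt_fst
  | succ a ih =>
    rw [outDeriv_succ]
    exact contDiffAt_timeDeriv hX hF hq ih

/-- The covectors in the span of `dx, du, …, du_[i-1]`, described as an annihilator. -/
def spanDxDu (n N i : ℕ) : Submodule ℝ (Jet n N →L[ℝ] ℝ) where
  carrier := {η | ∀ ζ : Fin (N + 1) → Fin 2 → ℝ,
    (∀ α : Fin (N + 1), (α : ℕ) < i → ζ α = 0) → η (0, ζ) = 0}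
  zero_mem' _ _ := rfl
  add_mem' ha hb ζ hζ := by simp [ha ζ hζ, hb ζ hζ]
  smul_mem' c _ ha ζ hζ := by simp [ha ζ hζ]

theorem mem_spanDx_iff {η : Jet n N →L[ℝ] ℝ} :
    η ∈ spanDx n N ↔ ∀ ζ : Fin (N + 1) → Fin 2 → ℝ, η (0, ζ) = 0 := by
  constructor
  · intro h ζ
    induction h using Submodule.span_induction with
    | mem x hx => obtain ⟨i, rfl⟩ := hx; simp
    | zero => simp
    | add x y _ _ hx hy => simp [hx, hy]
    | smul a x _ hx => simp [hx]
  · intro h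
    apply mem_span_of_common_kernel
    rintro ⟨x, ζ⟩ hξ
    have : x = 0 := by funext i; exact hξ i
    rw [this]; exact h ζ

theorem spanDxDu_zero : spanDxDu n N 0 = spanDx n N := by
  ext η
  rw [mem_spanDx_iff]
  exact ⟨fun h ζ => h ζ (by simp), fun h ζ _ => h ζ⟩

theorem spanDxDu_mono {i i' : ℕ} (h : i ≤ i') : spanDxDu n N i ≤ spanDxDu n N i' :=
  fun _ hη ζ hζ => hη ζ fun α hα => hζ α (hα.trans_le h)

/-- In a vertical direction, the Lie derivative along `f_u` shifts the index of `u_[α]`. -/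
theorem fderiv_timeDeriv_vertical {F : System n} {X : Set (Fin n → ℝ)} (hX : IsOpen X)
    (hF : ContDiffOn ℝ ∞ (fun y : (Fin n → ℝ) × (Fin 2 → ℝ) => F y.1 y.2) (X ×ˢ univ))
    {q : Jet n N} (hq : q.1 ∈ X) {h : Jet n N → ℝ} (hh : ContDiffAt ℝ ∞ h q) {i : ℕ}
    (hmem : ∀ᶠ x in 𝓝 q, fderiv ℝ h x ∈ spanDxDu n N i)
    {ζ : Fin (N + 1) → Fin 2 → ℝ} (hζ : ∀ α : Fin (N + 1), (α : ℕ) < i → ζ α = 0) :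
    fderiv ℝ (timeDeriv F N h) q (0, ζ) = fderiv ℝ h q
      (fderiv ℝ (fun y : (Fin n → ℝ) × (Fin 2 → ℝ) => F y.1 y.2) (q.1, q.2 0) (0, ζ 0),
        jetShift N ζ) := by
  have h1 : DifferentiableAt ℝ (fderiv ℝ h) q :=
    (hh.fderiv_right (m := 1) (by norm_cast)).differentiableAt (by simp)
  have h2 := fderiv_lieDeriv hh ((contDiffAt_totalField hX hF hq).differentiableAt (by simp))
    ((0, ζ) : Jet n N)
  have h3 : (fun x => fderiv ℝ h x (0, ζ)) =ᶠ[𝓝 q] fun _ => 0 :=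
    hmem.mono fun x hx => hx ζ hζ
  have h4 := (h1.hasFDerivAt.clm_apply (hasFDerivAt_const ((0, ζ) : Jet n N) q)).fderiv
  rw [h3.fderiv_eq] at h4
  have h5 := congrArg (fun l : Jet n N →L[ℝ] ℝ => l (totalField F N q)) h4
  simp at h5
  change fderiv ℝ (fun x => fderiv ℝ h x (totalField F N x)) q (0, ζ) = _
  rw [h2, ← h5, zero_add, fderiv_totalField hX hF hq]

namespace RegularOn

variable {F : System n} {φ : Fin 2 → (Fin n → ℝ) → ℝ} {k : Fin 2 → ℕ} {s : Fin 2 → Fin 2}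
  {X : Set (Fin n → ℝ)} {O : Set (Jet n N)}

theorem mono (hR : RegularOn F φ k s X O) {O' : Set (Jet n N)} (hO' : IsOpen O') (h : O' ⊆ O) :
    RegularOn F φ k s X O' :=
  ⟨hR.isOpen_base, hO', fun q hq => hR.base_mem q (h hq), hR.smooth_system, hR.smooth_output,
    hR.one_le, fun j a ha q hq => hR.horizontal j a ha q (h hq),
    fun j q hq => hR.vertical j q (h hq)⟩

theorem contDiffAt_out (hR : RegularOn F φ k s X O) {q : Jet n N} (hq : q ∈ O) (j : Fin 2)
    (a : ℕ) : ContDiffAt ℝ ∞ (outDeriv F N φ j a) q :=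
  contDiffAt_outDeriv hR.isOpen_base hR.smooth_system hR.smooth_output (hR.base_mem q hq) j a

theorem differentiableAt_totalField (hR : RegularOn F φ k s X O) {q : Jet n N} (hq : q ∈ O) :
    DifferentiableAt ℝ (totalField F N) q :=
  (contDiffAt_totalField hR.isOpen_base hR.smooth_system (hR.base_mem q hq)).differentiableAt
    (by simp)

theorem fderiv_timeDeriv_mem_spanDxDu (hR : RegularOn F φ k s X O) {q : Jet n N} (hq : q ∈ O)
    {h : Jet n N → ℝ} (hh : ContDiffAt ℝ ∞ h q) {i : ℕ}
    (hmem : ∀ᶠ x in 𝓝 q, fderiv ℝ h x ∈ spanDxDu n N i) :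
    fderiv ℝ (timeDeriv F N h) q ∈ spanDxDu n N (i + 1) := by
  intro ζ hζ
  rw [fderiv_timeDeriv_vertical hR.isOpen_base hR.smooth_system (hR.base_mem q hq) hh hmem
    fun α hα => hζ α (hα.trans (Nat.lt_succ_self i))]
  have h0 : ζ 0 = 0 := hζ 0 (by simp)
  rw [h0]
  have h1 : ((0 : Fin n → ℝ), (0 : Fin 2 → ℝ)) = 0 := rfl
  rw [h1, map_zero]
  refine hmem.self_of_nhds _ fun α hα => ?_
  rw [jetShift_apply]
  split_ifs with h
  · exact hζ _ (Nat.succ_lt_succ hα)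
  · rfl

theorem fderiv_outDeriv_add_mem (hR : RegularOn F φ k s X O) (j : Fin 2) (i : ℕ) :
    ∀ q ∈ O, fderiv ℝ (outDeriv F N φ j (k j + i)) q ∈ spanDxDu n N (i + 1) := by
  induction i with
  | zero =>
    intro q hq
    obtain ⟨a, ha⟩ : ∃ a, k j = a + 1 := ⟨k j - 1, by have := hR.one_le j; omega⟩
    rw [add_zero, ha, outDeriv_succ]
    refine hR.fderiv_timeDeriv_mem_spanDxDu hq (hR.contDiffAt_out hq j a) ?_
    filter_upwards [hR.isOpen.mem_nhds hq] with x hx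
    rw [spanDxDu_zero]
    exact hR.horizontal j a (by omega) x hx
  | succ i ih =>
    intro q hq
    rw [← add_assoc, outDeriv_succ]
    exact hR.fderiv_timeDeriv_mem_spanDxDu hq (hR.contDiffAt_out hq j _)
      (by filter_upwards [hR.isOpen.mem_nhds hq] with x hx using ih x hx)

/-- `φʲ_[kⱼ+i]` depends on `u_[i]` as `φʲ_[kⱼ]` depends on `u`. -/
theorem fderiv_outDeriv_leading (hR : RegularOn F φ k s X O) (j : Fin 2) (i : ℕ) (hi : i < N + 1) :
    ∀ q ∈ O, ∀ ζ : Fin (N + 1) → Fin 2 → ℝ, (∀ α : Fin (N + 1), (α : ℕ) < i → ζ α = 0) →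
      fderiv ℝ (outDeriv F N φ j (k j + i)) q (0, ζ) =
        fderiv ℝ (outDeriv F N φ j (k j)) q (0, Pi.single 0 (ζ ⟨i, hi⟩)) := by
  induction i with
  | zero =>
    intro q hq ζ _
    have h1 := hR.fderiv_outDeriv_add_mem j 0 q hq (ζ - Pi.single 0 (ζ ⟨0, hi⟩)) (by
      intro α hα
      obtain rfl : α = 0 := Fin.ext (Nat.lt_one_iff.1 hα)
      simp)
    have h2 : ((0, ζ - Pi.single 0 (ζ ⟨0, hi⟩)) : Jet n N) =
        (0, ζ) - (0, Pi.single 0 (ζ ⟨0, hi⟩)) := by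
      simp
    rw [h2, map_sub, sub_eq_zero] at h1
    exact h1
  | succ i ih =>
    intro q hq ζ hζ
    rw [← add_assoc, outDeriv_succ, fderiv_timeDeriv_vertical hR.isOpen_base hR.smooth_system
      (hR.base_mem q hq) (hR.contDiffAt_out hq j _) (i := i + 1)
      (by
        filter_upwards [hR.isOpen.mem_nhds hq] with x hx using hR.fderiv_outDeriv_add_mem j i x hx)
      hζ]
    have h0 : ζ 0 = 0 := hζ 0 (by simp)
    have h1 : ((0 : Fin n → ℝ), (0 : Fin 2 → ℝ)) = 0 := rfl
    rw [h0, h1, map_zero, ih (by omega) q hq]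
    · congr 3
      rw [jetShift_apply]; exact dif_pos hi
    · intro α hα
      have : (α : ℕ) + 1 < N + 1 := by omega
      rw [jetShift_apply, dif_pos this]
      exact hζ _ (Nat.succ_lt_succ hα)

end RegularOn


/-! ### Adapted coframes -/

/-- The coframe functions attached to coordinates `z` of the state and to the output `φʲ`: the
`zⁱ`, the derivatives `φʲ_[kⱼ], …, φʲ_[kⱼ+N]` and, to complete them, the jets `u_[0], …, u_[N]` of
the input component other than `sⱼ`, which is `sⱼ + 1` in `Fin 2`. -/
noncomputable def frameFun (F : System n) (N : ℕ) (φ : Fin 2 → (Fin n → ℝ) → ℝ) (k : Fin 2 → ℕ)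
    (s : Fin 2 → Fin 2) (z : Fin n → (Fin n → ℝ) → ℝ) (j : Fin 2) :
    Fin n ⊕ (Fin (N + 1) ⊕ Fin (N + 1)) → Jet n N → ℝ :=
  Sum.elim (fun i q => z i q.1)
    (Sum.elim (fun i => outDeriv F N φ j (k j + i)) fun i q => q.2 i (s j + 1))

/-- The first `c`, `d` and `e` indices of the three blocks of a coframe. -/
def frameIndex (n N c d e : ℕ) : Finset (Fin n ⊕ (Fin (N + 1) ⊕ Fin (N + 1))) :=
  (Finset.univ.filter fun i : Fin n => (i : ℕ) < c).disjSum
    ((Finset.univ.filter fun i : Fin (N + 1) => (i : ℕ) < d).disjSum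
      (Finset.univ.filter fun i : Fin (N + 1) => (i : ℕ) < e))

/-- The codistribution spanned by the first `c`, `d` and `e` members of the three blocks of a
coframe. -/
noncomputable def frameSpan (F : System n) (N : ℕ) (φ : Fin 2 → (Fin n → ℝ) → ℝ) (k : Fin 2 → ℕ)
    (s : Fin 2 → Fin 2) (z : Fin n → (Fin n → ℝ) → ℝ) (j : Fin 2) (c d e : ℕ) :
    Codistribution (Jet n N) :=
  fun q => Submodule.span ℝ
    ((fun i => fderiv ℝ (frameFun F N φ k s z j i) q) '' (frameIndex n N c d e : Set _))

/-- The functions `z¹, …, zⁿ` are smooth coordinates of the state over the set `O` of jets. -/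
structure CoordsOn (z : Fin n → (Fin n → ℝ) → ℝ) (O : Set (Jet n N)) : Prop where
  smooth : ∀ q ∈ O, ∀ i, ContDiffAt ℝ ∞ (z i) q.1
  kernel : ∀ q ∈ O, ∀ ξ, (∀ i, fderiv ℝ (z i) q.1 ξ = 0) → ξ = 0

theorem CoordsOn.mono {z : Fin n → (Fin n → ℝ) → ℝ} {O O' : Set (Jet n N)} (hz : CoordsOn z O)
    (h : O' ⊆ O) : CoordsOn z O' :=
  ⟨fun q hq => hz.smooth q (h hq), fun q hq => hz.kernel q (h hq)⟩

theorem coordsOn_proj (O : Set (Jet n N)) : CoordsOn (fun (i : Fin n) x => x i) O := by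
  refine ⟨fun q _ i => by fun_prop, fun q _ ξ h => ?_⟩
  funext i
  have h1 : HasFDerivAt (fun x : Fin n → ℝ => x i)
      (ContinuousLinearMap.proj (R := ℝ) (φ := fun _ : Fin n => ℝ) i) q.1 :=
    (ContinuousLinearMap.proj (R := ℝ) (φ := fun _ : Fin n => ℝ) i).hasFDerivAt
  have h2 := h i
  rw [h1.fderiv] at h2
  exact h2

section FrameSpan

variable {F : System n} {φ : Fin 2 → (Fin n → ℝ) → ℝ} {k : Fin 2 → ℕ} {s : Fin 2 → Fin 2}
  {z : Fin n → (Fin n → ℝ) → ℝ} {j : Fin 2} {X : Set (Fin n → ℝ)} {O : Set (Jet n N)}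

theorem fderiv_comp_fst {h : (Fin n → ℝ) → ℝ} {q : Jet n N} (hh : DifferentiableAt ℝ h q.1) :
    fderiv ℝ (fun q : Jet n N => h q.1) q =
      (fderiv ℝ h q.1).comp (ContinuousLinearMap.fst ℝ _ _) :=
  (hh.hasFDerivAt.comp q hasFDerivAt_fst).fderiv

theorem fderiv_comp_fst_mem_spanDx {h : (Fin n → ℝ) → ℝ} {q : Jet n N}
    (hh : DifferentiableAt ℝ h q.1) :
    fderiv ℝ (fun q : Jet n N => h q.1) q ∈ spanDx n N := by
  rw [fderiv_comp_fst hh, mem_spanDx_iff]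
  intro ζ
  simp

theorem fderiv_input (i : Fin (N + 1)) (t : Fin 2) (q : Jet n N) :
    fderiv ℝ (fun q : Jet n N => q.2 i t) q =
      ((ContinuousLinearMap.proj (R := ℝ) (φ := fun _ : Fin 2 => ℝ) t).comp
        (ContinuousLinearMap.proj i)).comp (ContinuousLinearMap.snd ℝ (Fin n → ℝ) _) := by
  let L : Jet n N →L[ℝ] ℝ := ((ContinuousLinearMap.proj (R := ℝ) (φ := fun _ : Fin 2 => ℝ) t).comp
    (ContinuousLinearMap.proj i)).comp (ContinuousLinearMap.snd ℝ (Fin n → ℝ) _)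
  exact L.hasFDerivAt.fderiv

theorem contDiffAt_frameFun (hR : RegularOn F φ k s X O) (hz : CoordsOn z O) {q : Jet n N}
    (hq : q ∈ O) (i) : ContDiffAt ℝ ∞ (frameFun F N φ k s z j i) q := by
  rcases i with i | i | i
  · exact (hz.smooth q hq i).comp q contDiffAt_fst
  · exact hR.contDiffAt_out hq j _
  · change ContDiffAt ℝ ∞ (fun q : Jet n N => q.2 i (s j + 1)) q
    fun_prop

theorem coord_mem_frameSpan {c d e : ℕ} {q : Jet n N} (i : Fin n) (hi : (i : ℕ) < c) :
    fderiv ℝ (fun q : Jet n N => z i q.1) q ∈ frameSpan F N φ k s z j c d e q :=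
  Submodule.subset_span ⟨Sum.inl i, by simp [frameIndex, hi], rfl⟩

theorem out_mem_frameSpan {c d e : ℕ} {q : Jet n N} {i : ℕ} (hi : i < d) (hiN : i ≤ N) :
    fderiv ℝ (outDeriv F N φ j (k j + i)) q ∈ frameSpan F N φ k s z j c d e q :=
  Submodule.subset_span ⟨Sum.inr (Sum.inl ⟨i, by omega⟩), by simp [frameIndex, hi], rfl⟩

theorem input_mem_frameSpan {c d e : ℕ} {q : Jet n N} (i : Fin (N + 1)) (hi : (i : ℕ) < e) :
    fderiv ℝ (fun q : Jet n N => q.2 i (s j + 1)) q ∈ frameSpan F N φ k s z j c d e q :=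
  Submodule.subset_span ⟨Sum.inr (Sum.inr i), by simp [frameIndex, hi], rfl⟩

theorem frameSpan_le {c d e : ℕ} {q : Jet n N} {B : Submodule ℝ (Jet n N →L[ℝ] ℝ)}
    (h1 : ∀ i : Fin n, (i : ℕ) < c → fderiv ℝ (fun q : Jet n N => z i q.1) q ∈ B)
    (h2 : ∀ i, i < d → i ≤ N → fderiv ℝ (outDeriv F N φ j (k j + i)) q ∈ B)
    (h3 : ∀ i : Fin (N + 1), (i : ℕ) < e →
      fderiv ℝ (fun q : Jet n N => q.2 i (s j + 1)) q ∈ B) :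
    frameSpan F N φ k s z j c d e q ≤ B := by
  refine Submodule.span_le.2 ?_
  rintro _ ⟨i | i | i, hi, rfl⟩ <;> simp [frameIndex] at hi
  · exact h1 i hi
  · exact h2 i hi (by omega)
  · exact h3 i hi

theorem frameSpan_mono {c d e c' d' e' : ℕ} (hc : c ≤ c') (hd : d ≤ d') (he : e ≤ e')
    (q : Jet n N) : frameSpan F N φ k s z j c d e q ≤ frameSpan F N φ k s z j c' d' e' q :=
  frameSpan_le (fun i hi => coord_mem_frameSpan i (hi.trans_le hc))
    (fun _ hi hiN => out_mem_frameSpan (hi.trans_le hd) hiN)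
    (fun i hi => input_mem_frameSpan i (hi.trans_le he))

theorem frameSpan_zero_le_spanDx (hz : CoordsOn z O) {q : Jet n N} (hq : q ∈ O) {c : ℕ} :
    frameSpan F N φ k s z j c 0 0 q ≤ spanDx n N :=
  frameSpan_le (fun i _ => fderiv_comp_fst_mem_spanDx ((hz.smooth q hq i).differentiableAt
    (by simp))) (by simp) (by simp)

/-- The coframe separates the coordinates level by level: if a vector is killed by `dz` and by the
first `i` members of the other two blocks, then its components along `x, u, …, u_[i-1]` vanish.
Indeed `φʲ_[kⱼ+l]` depends on `u_[l]` through its component `sⱼ`, the other component being part of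
the coframe. -/
theorem frame_kernel (hR : RegularOn F φ k s X O) (hz : CoordsOn z O) {q : Jet n N} (hq : q ∈ O)
    {i : ℕ} (ξ : Jet n N)
    (h1 : ∀ l : Fin n, fderiv ℝ (fun q : Jet n N => z l q.1) q ξ = 0)
    (h2 : ∀ l, l < i → l ≤ N → fderiv ℝ (outDeriv F N φ j (k j + l)) q ξ = 0)
    (h3 : ∀ l : Fin (N + 1), (l : ℕ) < i →
      fderiv ℝ (fun q : Jet n N => q.2 l (s j + 1)) q ξ = 0) :
    ξ.1 = 0 ∧ ∀ α : Fin (N + 1), (α : ℕ) < i → ξ.2 α = 0 := by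
  obtain ⟨x, ζ⟩ := ξ
  have hx : x = 0 := by
    apply hz.kernel q hq
    intro l
    have := h1 l
    rw [fderiv_comp_fst ((hz.smooth q hq l).differentiableAt (by simp))] at this
    simpa using this
  subst hx
  refine ⟨rfl, ?_⟩
  have key : ∀ a : ℕ, ∀ ha : a < N + 1, a < i → ζ ⟨a, ha⟩ = 0 := by
    intro a
    induction a using Nat.strong_induction_on with
    | _ a ih =>
      intro ha hai
      have hlow : ∀ α : Fin (N + 1), (α : ℕ) < a → ζ α = 0 := fun α hα =>
        ih α hα α.2 (by omega)
      have e1 := h2 a hai (by omega)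
      rw [hR.fderiv_outDeriv_leading j a ha q hq ζ hlow] at e1
      have e2 : ζ ⟨a, ha⟩ (s j + 1) = 0 := by
        have := h3 ⟨a, ha⟩ hai
        rw [fderiv_input] at this
        simpa using this
      have e3 : ζ ⟨a, ha⟩ = ζ ⟨a, ha⟩ (s j) • Pi.single (s j) 1 := by
        funext t
        have ht : t = s j ∨ t = s j + 1 := by generalize s j = r; revert t r; decide
        rcases ht with rfl | rfl
        · simp
        · have : s j + 1 ≠ s j := by generalize s j = r; revert r; decide
          simp [e2, this]
      have e4 : ((0 : Fin n → ℝ), (Pi.single 0 (ζ ⟨a, ha⟩) : Fin (N + 1) → Fin 2 → ℝ)) =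
          ζ ⟨a, ha⟩ (s j) • (0, Pi.single 0 (Pi.single (s j) 1)) := by
        conv_lhs => rw [e3]
        conv_rhs => rw [Prod.smul_mk, smul_zero, ← Pi.single_smul]
      rw [e4, map_smul, smul_eq_mul] at e1
      have e5 := (mul_eq_zero.1 e1).resolve_right (hR.vertical j q hq)
      rw [e3, e5, zero_smul]
  exact fun α hα => key α α.2 hα

theorem spanDxDu_le_frameSpan (hR : RegularOn F φ k s X O) (hz : CoordsOn z O) {q : Jet n N}
    (hq : q ∈ O) (i : ℕ) : spanDxDu n N i ≤ frameSpan F N φ k s z j n i i q := by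
  intro η hη
  unfold frameSpan
  rw [Set.image_eq_range]
  apply mem_span_of_common_kernel
  intro ξ hξ
  have hk := frame_kernel (j := j) hR hz hq (i := i) ξ
    (fun l => hξ ⟨Sum.inl l, by simp [frameIndex]⟩)
    (fun l hl hlN => hξ ⟨Sum.inr (Sum.inl ⟨l, by omega⟩), by simp [frameIndex, hl]⟩)
    (fun l hl => hξ ⟨Sum.inr (Sum.inr l), by simp [frameIndex, hl]⟩)
  have : ξ = (0, ξ.2) := Prod.ext hk.1 rfl
  rw [this]
  exact hη _ hk.2

theorem spanDx_le_frameSpan (hR : RegularOn F φ k s X O) (hz : CoordsOn z O) {q : Jet n N}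
    (hq : q ∈ O) : spanDx n N ≤ frameSpan F N φ k s z j n 0 0 q := by
  rw [← spanDxDu_zero]
  exact spanDxDu_le_frameSpan hR hz hq 0

/-- The `dz`, the `dφʲ_[kⱼ+i]` and the differentials of the other input form a basis of the
cotangent space: they have no common kernel, and there are as many of them as coordinates. -/
theorem linearIndependent_frame (hR : RegularOn F φ k s X O) (hz : CoordsOn z O) {q : Jet n N}
    (hq : q ∈ O) : LinearIndependent ℝ fun i => fderiv ℝ (frameFun F N φ k s z j i) q := by
  apply linearIndependent_of_top_le_span_of_card_eq_finrank
  · intro η _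
    have h1 : η ∈ spanDxDu n N (N + 1) := by
      intro ζ hζ
      have : ζ = 0 := funext fun α => hζ α α.2
      rw [this]
      exact map_zero η
    exact Submodule.span_mono (image_subset_range _ _) (spanDxDu_le_frameSpan hR hz hq (N + 1) h1)
  · have : Module.finrank ℝ (Jet n N →L[ℝ] ℝ) = Module.finrank ℝ (Jet n N) := by
      rw [← (LinearMap.toContinuousLinearMap : (Jet n N →ₗ[ℝ] ℝ) ≃ₗ[ℝ] _).finrank_eq]
      exact Subspace.dual_finrank_eq
    rw [this]
    simp [Module.finrank_pi_fintype]
    omega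

theorem finrank_frameSpan (hR : RegularOn F φ k s X O) (hz : CoordsOn z O) {q : Jet n N}
    (hq : q ∈ O) {c d e : ℕ} (hc : c ≤ n) (hd : d ≤ N + 1) (he : e ≤ N + 1) :
    Module.finrank ℝ (frameSpan F N φ k s z j c d e q) = c + d + e := by
  have hli := (linearIndependent_frame (j := j) hR hz hq).comp
    (fun i : {i // i ∈ (frameIndex n N c d e : Set _)} => i.1) Subtype.val_injective
  unfold frameSpan
  rw [Set.image_eq_range]
  have := finrank_span_eq_card hli
  refine this.trans ?_
  have h1 : ∀ M c : ℕ, c ≤ M → (Finset.univ.filter fun i : Fin M => (i : ℕ) < c).card = c := by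
    intro M c hc
    rw [Fin.card_filter_val_lt, min_eq_right hc]
  refine (Fintype.card_coe (frameIndex n N c d e)).trans ?_
  rw [frameIndex, Finset.card_disjSum, Finset.card_disjSum, h1 n c hc, h1 _ d hd, h1 _ e he,
    add_assoc]

theorem finrank_spanDx (hR : RegularOn F φ k s X O) {p : Jet n N} (hp : p ∈ O) :
    Module.finrank ℝ (spanDx n N) = n := by
  have h1 : spanDx n N = frameSpan F N φ k s (fun (i : Fin n) x => x i) 0 n 0 0 p :=
    le_antisymm (spanDx_le_frameSpan hR (coordsOn_proj O) hp)
      (frameSpan_zero_le_spanDx (coordsOn_proj O) hp)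
  rw [h1, finrank_frameSpan hR (coordsOn_proj O) hp le_rfl (by omega) (by omega),
    add_zero, add_zero]

theorem frameSpan_inf_le (hR : RegularOn F φ k s X O) (hz : CoordsOn z O) {q : Jet n N}
    (hq : q ∈ O) (c d e c' d' e' : ℕ) :
    frameSpan F N φ k s z j c d e q ⊓ frameSpan F N φ k s z j c' d' e' q ≤
      frameSpan F N φ k s z j (min c c') (min d d') (min e e') q := by
  refine (span_image_inf_le (linearIndependent_frame hR hz hq) _ _).trans
    (Submodule.span_mono (image_mono ?_))
  rintro (i | i | i) hi <;> simp [frameIndex] at hi ⊢ <;> exact hi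

theorem input_notMem_frameSpan (hR : RegularOn F φ k s X O) (hz : CoordsOn z O) {q : Jet n N}
    (hq : q ∈ O) (i : Fin (N + 1)) (c d : ℕ) {e : ℕ} (he : e ≤ i) :
    fderiv ℝ (fun q : Jet n N => q.2 i (s j + 1)) q ∉ frameSpan F N φ k s z j c d e q := by
  intro h
  have := (linearIndependent_frame (j := j) hR hz hq).notMem_span_image
    (s := (frameIndex n N c d e : Set _)) (x := Sum.inr (Sum.inr i)) (by simp [frameIndex, he])
  exact this h

theorem out_notMem_frameSpan (hR : RegularOn F φ k s X O) (hz : CoordsOn z O) {q : Jet n N}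
    (hq : q ∈ O) {i : ℕ} (hi : i ≤ N) (c : ℕ) {d : ℕ} (e : ℕ) (hd : d ≤ i) :
    fderiv ℝ (outDeriv F N φ j (k j + i)) q ∉ frameSpan F N φ k s z j c d e q := by
  intro h
  have := (linearIndependent_frame (j := j) hR hz hq).notMem_span_image
    (s := (frameIndex n N c d e : Set _)) (x := Sum.inr (Sum.inl ⟨i, by omega⟩))
    (by simp [frameIndex, hd])
  exact this h

theorem fderiv_timeDeriv_coord_mem (hR : RegularOn F φ k s X O) (hz : CoordsOn z O)
    {q : Jet n N} (hq : q ∈ O) (i : Fin n) :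
    fderiv ℝ (timeDeriv F N fun q => z i q.1) q ∈ spanDxDu n N 1 := by
  refine hR.fderiv_timeDeriv_mem_spanDxDu hq ((hz.smooth q hq i).comp q contDiffAt_fst) ?_
  filter_upwards [hR.isOpen.mem_nhds hq] with x hx
  rw [spanDxDu_zero]
  exact fderiv_comp_fst_mem_spanDx ((hz.smooth x hx i).differentiableAt (by simp))

theorem timeDeriv_input (F : System n) {i : ℕ} (hi : i + 1 < N + 1) (t : Fin 2) :
    timeDeriv F N (fun q : Jet n N => q.2 ⟨i, by omega⟩ t) = fun q => q.2 ⟨i + 1, hi⟩ t := by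
  funext q
  simp only [timeDeriv]
  rw [fderiv_input]
  simp [totalField, Nat.lt_of_succ_lt_succ hi]

/-- Differentiating a relation between `dh` and part of a coframe. -/
theorem fderiv_timeDeriv_mem (hR : RegularOn F φ k s X O) (hz : CoordsOn z O) {q : Jet n N}
    (hq : q ∈ O) {h : Jet n N → ℝ} (hh : ContDiffAt ℝ ∞ h q) {c d e : ℕ}
    (hmem : ∀ᶠ x in 𝓝 q, fderiv ℝ h x ∈ frameSpan F N φ k s z j c d e x)
    {B : Submodule ℝ (Jet n N →L[ℝ] ℝ)} (hB : frameSpan F N φ k s z j c d e q ≤ B)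
    (h1 : ∀ i : Fin n, (i : ℕ) < c → fderiv ℝ (timeDeriv F N fun q => z i q.1) q ∈ B)
    (h2 : ∀ i, i < d → fderiv ℝ (outDeriv F N φ j (k j + i + 1)) q ∈ B)
    (h3 : ∀ i : Fin (N + 1), (i : ℕ) < e →
      fderiv ℝ (timeDeriv F N fun q => q.2 i (s j + 1)) q ∈ B) :
    fderiv ℝ (timeDeriv F N h) q ∈ B := by
  refine fderiv_lieDeriv_mem (V := totalField F N)
    (g := fun i : {i // i ∈ (frameIndex n N c d e : Set _)} => frameFun F N φ k s z j i.1)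
    (fun i => contDiffAt_frameFun hR hz hq i) hh (hR.differentiableAt_totalField hq)
    ((linearIndependent_frame hR hz hq).comp
      (fun i : {i // i ∈ (frameIndex n N c d e : Set _)} => i.1) Subtype.val_injective) ?_ ?_ ?_
  · filter_upwards [hmem] with x hx
    unfold frameSpan at hx
    rwa [Set.image_eq_range] at hx
  · exact fun i => hB (Submodule.subset_span ⟨i, i.2, rfl⟩)
  · rintro ⟨i | i | i, hi⟩ <;> simp [frameIndex] at hi
    · exact h1 i hi
    · have := h2 i hi
      rwa [outDeriv_succ] at this
    · exact h3 i hi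

end FrameSpan

end Jets

/-! ### Spans of output derivatives -/

section Outputs

variable {n N : ℕ} {F : System n} {φ : Fin 2 → (Fin n → ℝ) → ℝ} {k : Fin 2 → ℕ}
  {s : Fin 2 → Fin 2} {z : Fin n → (Fin n → ℝ) → ℝ} {j : Fin 2} {X : Set (Fin n → ℝ)}
  {O : Set (Jet n N)}

/-- `exists_leading_coeff` for part of a coframe and the field `f_u`: a relation between
differentials survives a time derivative, with the same coefficient `r` at the distinguished
member. -/
theorem exists_leading_coeff_frame (hR : RegularOn F φ k s X O) (hz : CoordsOn z O)
    {q : Jet n N} (hq : q ∈ O) {h : Jet n N → ℝ} (hh : ContDiffAt ℝ ∞ h q) {c d e : ℕ}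
    (hmem : ∀ᶠ x in 𝓝 q, fderiv ℝ h x ∈ frameSpan F N φ k s z j c d e x)
    {i₀} (hi₀ : i₀ ∈ frameIndex n N c d e)
    {A B : Submodule ℝ (Jet n N →L[ℝ] ℝ)}
    (hA : ∀ i ∈ frameIndex n N c d e, i ≠ i₀ → fderiv ℝ (frameFun F N φ k s z j i) q ∈ A)
    (hB : frameSpan F N φ k s z j c d e q ≤ B)
    (hB' : ∀ i ∈ frameIndex n N c d e, i ≠ i₀ →
      fderiv ℝ (timeDeriv F N (frameFun F N φ k s z j i)) q ∈ B) :
    ∃ r : ℝ, fderiv ℝ h q - r • fderiv ℝ (frameFun F N φ k s z j i₀) q ∈ A ∧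
      fderiv ℝ (timeDeriv F N h) q
        - r • fderiv ℝ (timeDeriv F N (frameFun F N φ k s z j i₀)) q ∈ B := by
  refine exists_leading_coeff (V := totalField F N)
    (g := fun i : {i // i ∈ (frameIndex n N c d e : Set _)} => frameFun F N φ k s z j i.1)
    (fun i => contDiffAt_frameFun hR hz hq i) hh (hR.differentiableAt_totalField hq)
    ((linearIndependent_frame hR hz hq).comp
      (fun i : {i // i ∈ (frameIndex n N c d e : Set _)} => i.1) Subtype.val_injective) ?_
      ⟨i₀, hi₀⟩ ?_ ?_ ?_
  · filter_upwards [hmem] with x hx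
    unfold frameSpan at hx
    rwa [Set.image_eq_range] at hx
  · exact fun i hi => hA i i.2 fun h => hi (Subtype.ext h)
  · exact fun i => hB (Submodule.subset_span ⟨i, i.2, rfl⟩)
  · exact fun i hi => hB' i i.2 fun h => hi (Subtype.ext h)

theorem frameSpan_succ_input_le {c d e : ℕ} (he : e < N + 1) (q : Jet n N) :
    frameSpan F N φ k s z j c d (e + 1) q ≤ frameSpan F N φ k s z j c d e q ⊔
      Submodule.span ℝ {fderiv ℝ (fun q : Jet n N => q.2 ⟨e, he⟩ (s j + 1)) q} := by
  refine frameSpan_le (fun i hi => Submodule.mem_sup_left (coord_mem_frameSpan i hi))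
    (fun i hi hiN => Submodule.mem_sup_left (out_mem_frameSpan hi hiN)) fun i hi => ?_
  rcases Nat.lt_succ_iff_lt_or_eq.1 hi with hi | hi
  · exact Submodule.mem_sup_left (input_mem_frameSpan i hi)
  · obtain rfl : i = ⟨e, he⟩ := Fin.ext hi
    exact Submodule.mem_sup_right (Submodule.mem_span_singleton_self _)

theorem eventually_notMem_frameSpan (hR : RegularOn F φ k s X O) (hz : CoordsOn z O)
    {q : Jet n N} (hq : q ∈ O) {h : Jet n N → ℝ} (hh : ContDiffAt ℝ ∞ h q) {c d e : ℕ}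
    (hmem : fderiv ℝ h q ∉ frameSpan F N φ k s z j c d e q) :
    ∀ᶠ x in 𝓝 q, fderiv ℝ h x ∉ frameSpan F N φ k s z j c d e x := by
  set w : Option {i // i ∈ (frameIndex n N c d e : Set _)} → Jet n N → Jet n N →L[ℝ] ℝ :=
    fun o x => Option.casesOn' o (fderiv ℝ h x)
      (fun i => fderiv ℝ (frameFun F N φ k s z j i.1) x) with hw
  have hspan : ∀ x, frameSpan F N φ k s z j c d e x = Submodule.span ℝ
      (range fun i : {i // i ∈ (frameIndex n N c d e : Set _)} =>
        fderiv ℝ (frameFun F N φ k s z j i.1) x) := by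
    intro x; unfold frameSpan; rw [Set.image_eq_range]
  have hcont : ∀ o, ContinuousAt (w o) q := by
    rintro (_ | i)
    · exact (hh.fderiv_right (m := 0) (by norm_cast)).continuousAt
    · exact ((contDiffAt_frameFun hR hz hq i.1).fderiv_right (m := 0) (by norm_cast)).continuousAt
  have hli : LinearIndependent ℝ fun o => w o q := by
    refine linearIndependent_option'.2 ⟨(linearIndependent_frame hR hz hq).comp
      (fun i : {i // i ∈ (frameIndex n N c d e : Set _)} => i.1) Subtype.val_injective, ?_⟩
    rwa [← hspan]
  filter_upwards [eventually_linearIndependent hcont hli] with x hx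
  rw [hspan]
  exact (linearIndependent_option'.1 hx).2

/-- The outputs and their derivatives `φ¹_[0], …, φ¹_[a-1], φ²_[0], …, φ²_[b-1]`. -/
noncomputable def outFun (F : System n) (N : ℕ) (φ : Fin 2 → (Fin n → ℝ) → ℝ) (a b : ℕ) :
    Fin a ⊕ Fin b → Jet n N → ℝ :=
  Sum.elim (fun i => outDeriv F N φ 0 i) fun i => outDeriv F N φ 1 i

/-- The span of the differentials of `φ¹_[0], …, φ¹_[a-1], φ²_[0], …, φ²_[b-1]`. -/
noncomputable def outSpan (F : System n) (N : ℕ) (φ : Fin 2 → (Fin n → ℝ) → ℝ) (a b : ℕ) :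
    Codistribution (Jet n N) :=
  fun q => Submodule.span ℝ (range fun i => fderiv ℝ (outFun F N φ a b i) q)

theorem mem_outSpan_zero {a b i : ℕ} (hi : i < a) (q : Jet n N) :
    fderiv ℝ (outDeriv F N φ 0 i) q ∈ outSpan F N φ a b q :=
  Submodule.subset_span ⟨Sum.inl ⟨i, hi⟩, rfl⟩

theorem mem_outSpan_one {a b i : ℕ} (hi : i < b) (q : Jet n N) :
    fderiv ℝ (outDeriv F N φ 1 i) q ∈ outSpan F N φ a b q :=
  Submodule.subset_span ⟨Sum.inr ⟨i, hi⟩, rfl⟩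

theorem outSpan_le {a b : ℕ} {q : Jet n N} {B : Submodule ℝ (Jet n N →L[ℝ] ℝ)}
    (h0 : ∀ i < a, fderiv ℝ (outDeriv F N φ 0 i) q ∈ B)
    (h1 : ∀ i < b, fderiv ℝ (outDeriv F N φ 1 i) q ∈ B) : outSpan F N φ a b q ≤ B := by
  refine Submodule.span_le.2 ?_
  rintro _ ⟨i | i, rfl⟩
  · exact h0 i i.2
  · exact h1 i i.2

theorem outSpan_mono {a b a' b' : ℕ} (ha : a ≤ a') (hb : b ≤ b') (q : Jet n N) :
    outSpan F N φ a b q ≤ outSpan F N φ a' b' q :=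
  outSpan_le (fun _ hi => mem_outSpan_zero (hi.trans_le ha) q)
    fun _ hi => mem_outSpan_one (hi.trans_le hb) q

theorem codistP_eq_outSpan (A : Fin 2 → ℕ) :
    codistP F N φ A = outSpan F N φ (A 0 + 1) (A 1 + 1) := by
  funext q
  refine le_antisymm (Submodule.span_le.2 ?_) (outSpan_le ?_ ?_)
  · rintro _ ⟨j, a, ha, rfl⟩
    fin_cases j
    · exact mem_outSpan_zero (Nat.lt_succ_of_le ha) q
    · exact mem_outSpan_one (Nat.lt_succ_of_le ha) q
  · exact fun i hi => Submodule.subset_span ⟨0, i, Nat.le_of_lt_succ hi, rfl⟩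
  · exact fun i hi => Submodule.subset_span ⟨1, i, Nat.le_of_lt_succ hi, rfl⟩

theorem outSpan_succ_zero (a b : ℕ) (q : Jet n N) :
    outSpan F N φ (a + 1) b q =
      outSpan F N φ a b q ⊔ Submodule.span ℝ {fderiv ℝ (outDeriv F N φ 0 a) q} := by
  refine le_antisymm (outSpan_le (fun i hi => ?_) fun i hi =>
    Submodule.mem_sup_left (mem_outSpan_one hi q)) (sup_le (outSpan_mono (by omega) le_rfl q)
    ((Submodule.span_singleton_le_iff_mem _ _).2 (mem_outSpan_zero (by omega) q)))
  rcases Nat.lt_succ_iff_lt_or_eq.1 hi with hi | rfl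
  · exact Submodule.mem_sup_left (mem_outSpan_zero hi q)
  · exact Submodule.mem_sup_right (Submodule.mem_span_singleton_self _)

theorem outSpan_succ_one (a b : ℕ) (q : Jet n N) :
    outSpan F N φ a (b + 1) q =
      outSpan F N φ a b q ⊔ Submodule.span ℝ {fderiv ℝ (outDeriv F N φ 1 b) q} := by
  refine le_antisymm (outSpan_le (fun i hi => Submodule.mem_sup_left (mem_outSpan_zero hi q))
    fun i hi => ?_) (sup_le (outSpan_mono le_rfl (by omega) q)
    ((Submodule.span_singleton_le_iff_mem _ _).2 (mem_outSpan_one (by omega) q)))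
  rcases Nat.lt_succ_iff_lt_or_eq.1 hi with hi | rfl
  · exact Submodule.mem_sup_left (mem_outSpan_one hi q)
  · exact Submodule.mem_sup_right (Submodule.mem_span_singleton_self _)

theorem finrank_outSpan_le (a b : ℕ) (q : Jet n N) :
    Module.finrank ℝ (outSpan F N φ a b q) ≤ a + b := by
  have := finrank_range_le_card (R := ℝ) (fun i => fderiv ℝ (outFun F N φ a b i) q)
  exact this.trans (by simp)

theorem finrank_outSpan_of_le {a b a' b' : ℕ} {q : Jet n N}
    (h : Module.finrank ℝ (outSpan F N φ a b q) = a + b) (ha : a' ≤ a) (hb : b' ≤ b) :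
    Module.finrank ℝ (outSpan F N φ a' b' q) = a' + b' := by
  have hli : LinearIndependent ℝ fun i => fderiv ℝ (outFun F N φ a b i) q := by
    rw [linearIndependent_iff_card_eq_finrank_span]
    exact (by simp : _ = a + b).trans h.symm
  have hinj : Function.Injective (Sum.map (Fin.castLE ha) (Fin.castLE hb)) :=
    (Fin.castLE_injective ha).sumMap (Fin.castLE_injective hb)
  have h2 := finrank_span_eq_card (hli.comp _ hinj)
  have h3 : (fun i => fderiv ℝ (outFun F N φ a' b' i) q) =
      (fun i => fderiv ℝ (outFun F N φ a b i) q) ∘ Sum.map (Fin.castLE ha) (Fin.castLE hb) := by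
    funext i
    rcases i with i | i <;> rfl
  unfold outSpan
  rw [h3]
  exact h2.trans (by simp)

theorem contDiffAt_outFun (hR : RegularOn F φ k s X O) {q : Jet n N} (hq : q ∈ O) {a b : ℕ} (i) :
    ContDiffAt ℝ ∞ (outFun F N φ a b i) q := by
  rcases i with i | i <;> exact hR.contDiffAt_out hq _ _

/-- A relation between output differentials survives a time derivative as long as the span of the
outputs involved has constant rank. -/
theorem fderiv_timeDeriv_mem_of_outSpan (hR : RegularOn F φ k s X O) {q : Jet n N} (hq : q ∈ O)
    {h : Jet n N → ℝ} (hh : ContDiffAt ℝ ∞ h q) {a b : ℕ}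
    (hrank : ∀ᶠ x in 𝓝 q, Module.finrank ℝ (outSpan F N φ a b x) =
      Module.finrank ℝ (outSpan F N φ a b q))
    (hmem : ∀ᶠ x in 𝓝 q, fderiv ℝ h x ∈ outSpan F N φ a b x)
    {B : Submodule ℝ (Jet n N →L[ℝ] ℝ)} (hB : outSpan F N φ a b q ≤ B)
    (h0 : ∀ i < a, fderiv ℝ (outDeriv F N φ 0 (i + 1)) q ∈ B)
    (h1 : ∀ i < b, fderiv ℝ (outDeriv F N φ 1 (i + 1)) q ∈ B) :
    fderiv ℝ (timeDeriv F N h) q ∈ B := by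
  refine fderiv_lieDeriv_mem_of_finrank (V := totalField F N) (g := outFun F N φ a b)
    (fun i => contDiffAt_outFun hR hq i) hh (hR.differentiableAt_totalField hq) hrank hmem
    (fun i => hB (Submodule.subset_span ⟨i, rfl⟩)) ?_
  rintro (i | i)
  · have := h0 i i.2
    rwa [outDeriv_succ] at this
  · have := h1 i i.2
    rwa [outDeriv_succ] at this

/-- Some point of an open set maximizes the sum of the ranks of the spans of outputs; as ranks
are lower semicontinuous, all of them are constant near such a point. -/
theorem exists_locally_constant_rank (hR : RegularOn F φ k s X O) {U : Set (Jet n N)}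
    (hU : IsOpen U) (hUO : U ⊆ O) (hne : U.Nonempty) (A B : ℕ) :
    ∃ q₀ ∈ U, ∃ W ⊆ U, IsOpen W ∧ q₀ ∈ W ∧ ∀ a ≤ A, ∀ b ≤ B, ∀ x ∈ W,
      Module.finrank ℝ (outSpan F N φ a b x) = Module.finrank ℝ (outSpan F N φ a b q₀) := by
  set I : Finset (ℕ × ℕ) := Finset.range (A + 1) ×ˢ Finset.range (B + 1) with hI
  set f : Jet n N → ℕ := fun q => ∑ i ∈ I, Module.finrank ℝ (outSpan F N φ i.1 i.2 q) with hf
  have hbdd : BddAbove (f '' U) := by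
    refine ⟨∑ i ∈ I, (i.1 + i.2), ?_⟩
    rintro _ ⟨q, _, rfl⟩
    exact Finset.sum_le_sum fun i _ => finrank_outSpan_le _ _ q
  obtain ⟨q₀, hq₀, hmax⟩ := Nat.sSup_mem (hne.image f) hbdd
  have hle : ∀ q ∈ U, f q ≤ f q₀ := fun q hq => by
    rw [hmax]; exact le_csSup hbdd ⟨q, hq, rfl⟩
  have hev : ∀ᶠ x in 𝓝 q₀, x ∈ U ∧ ∀ i ∈ I, Module.finrank ℝ (outSpan F N φ i.1 i.2 q₀) ≤
      Module.finrank ℝ (outSpan F N φ i.1 i.2 x) := by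
    refine (hU.eventually_mem hq₀).and ((Finset.eventually_all I).2 fun i _ => ?_)
    exact eventually_finrank_le (w := fun l => fderiv ℝ (outFun F N φ i.1 i.2 l)) fun l =>
      ((contDiffAt_outFun hR (hUO hq₀) l).fderiv_right (m := 0) (by norm_cast)).continuousAt
  obtain ⟨W, hW, hWo, hqW⟩ := mem_nhds_iff.1 hev
  refine ⟨q₀, hq₀, W, fun x hx => (hW hx).1, hWo, hqW, fun a ha b hb x hx => ?_⟩
  have h1 := (hW hx).2
  have h2 := (Finset.sum_eq_sum_iff_of_le h1).1 (le_antisymm (Finset.sum_le_sum h1)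
    (hle x (hW hx).1))
  exact (h2 (a, b) (by simp [hI]; omega)).symm

theorem outDeriv_mem_frameSpan_of_lt (hR : RegularOn F φ k s X O) (hz : CoordsOn z O)
    {q : Jet n N} (hq : q ∈ O) (j' : Fin 2) {i : ℕ} (hi : i < k j') (d e : ℕ) :
    fderiv ℝ (outDeriv F N φ j' i) q ∈ frameSpan F N φ k s z j n d e q :=
  frameSpan_mono le_rfl (Nat.zero_le d) (Nat.zero_le e) q
    (spanDx_le_frameSpan hR hz hq (hR.horizontal j' i hi q hq))

theorem outSpan_le_frameSpan_input (hR : RegularOn F φ k s X O) (hz : CoordsOn z O)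
    {q : Jet n N} (hq : q ∈ O) {b d : ℕ} (hd : b ≤ k 1 + d) :
    outSpan F N φ (k 0 + d) b q ≤ frameSpan F N φ k s z j n d d q := by
  have key : ∀ j' : Fin 2, ∀ i < k j' + d,
      fderiv ℝ (outDeriv F N φ j' i) q ∈ frameSpan F N φ k s z j n d d q := by
    intro j' i hi
    rcases lt_or_ge i (k j') with h | h
    · exact outDeriv_mem_frameSpan_of_lt hR hz hq j' h _ _
    · obtain ⟨i', rfl⟩ := Nat.exists_eq_add_of_le h
      refine spanDxDu_le_frameSpan hR hz hq _ (spanDxDu_mono ?_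
        (hR.fderiv_outDeriv_add_mem j' i' q hq))
      omega
  exact outSpan_le (fun i hi => key 0 i (by omega)) fun i hi => key 1 i (by omega)

/-- As long as `φ²_[k₂+i]`, `i < ρ`, depends on the derivatives of the first output only, modulo
`dx`, and `φ²_[k₂+ρ]` does not, the derivatives of the outputs of lower order are independent at
some point: a relation near a point would persist under differentiation. -/
theorem exists_finrank_outSpan_eq (hR : RegularOn F φ k s X O) (hz : CoordsOn z O)
    {U : Set (Jet n N)} (hU : IsOpen U) (hUO : U ⊆ O) (hne : U.Nonempty) {ρ : ℕ}
    (hN : k 1 + ρ ≤ N)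
    (h1 : ∀ q ∈ U, ∀ i < ρ, fderiv ℝ (outDeriv F N φ 1 (k 1 + i)) q ∈
      frameSpan F N φ k s z 0 n (i + 1) 0 q)
    (h2 : ∀ q ∈ U, fderiv ℝ (outDeriv F N φ 1 (k 1 + ρ)) q ∉
      frameSpan F N φ k s z 0 n (N + 1) 0 q) :
    ∃ q₀ ∈ U, Module.finrank ℝ (outSpan F N φ (k 0 + (k 1 + ρ)) (k 1 + ρ) q₀) =
      k 0 + (k 1 + ρ) + (k 1 + ρ) := by
  obtain ⟨q₀, hq₀, W, hWU, hWo, hqW, hrank⟩ := exists_locally_constant_rank hR hU hUO hne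
    (k 0 + (k 1 + ρ)) (k 1 + ρ)
  have hWO : W ⊆ O := hWU.trans hUO
  have hrank' : ∀ a ≤ k 0 + (k 1 + ρ), ∀ b ≤ k 1 + ρ, ∀ x ∈ W, ∀ᶠ y in 𝓝 x,
      Module.finrank ℝ (outSpan F N φ a b y) = Module.finrank ℝ (outSpan F N φ a b x) := by
    intro a ha b hb x hx
    filter_upwards [hWo.mem_nhds hx] with y hy
    rw [hrank a ha b hb y hy, hrank a ha b hb x hx]
  -- a dependent `φ¹_[i]` would make all its derivatives dependent, and hence functions of `x`, but
  -- `φ¹_[k₁]` is not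
  have hzero : ∀ i < k 0, fderiv ℝ (outDeriv F N φ 0 i) q₀ ∉ outSpan F N φ i 0 q₀ := by
    intro i hi hmem
    have hW0 : ∀ x ∈ W, fderiv ℝ (outDeriv F N φ 0 i) x ∈ outSpan F N φ i 0 x := by
      intro x hx
      by_contra hx'
      have e1 := finrank_lt_of_mem_of_notMem (outSpan_mono (Nat.le_succ i) le_rfl x)
        (mem_outSpan_zero (b := 0) (Nat.lt_succ_self i) x) hx'
      rw [hrank _ (by omega) _ (by omega) x hx, hrank (i + 1) (by omega) _ (by omega) x hx,
        outSpan_succ_zero, sup_eq_left.2 ((Submodule.span_singleton_le_iff_mem _ _).2 hmem)] at e1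
      exact lt_irrefl _ e1
    have hall : ∀ l, ∀ x ∈ W, fderiv ℝ (outDeriv F N φ 0 (i + l)) x ∈ outSpan F N φ i 0 x := by
      intro l
      induction l with
      | zero => exact hW0
      | succ l ih =>
        intro x hx
        rw [← add_assoc, outDeriv_succ]
        refine fderiv_timeDeriv_mem_of_outSpan hR (hWO hx) (hR.contDiffAt_out (hWO hx) _ _)
          (hrank' i (by omega) 0 (by omega) x hx)
          (by filter_upwards [hWo.mem_nhds hx] with y hy using ih y hy) le_rfl ?_ (by simp)
        intro r hr
        rcases Nat.lt_or_ge (r + 1) i with h | h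
        · exact mem_outSpan_zero h x
        · obtain rfl : r + 1 = i := by omega
          exact hW0 x hx
    have e2 := hall (k 0 - i) q₀ hqW
    rw [show i + (k 0 - i) = k 0 by omega] at e2
    have e3 : outSpan F N φ i 0 q₀ ≤ spanDx n N :=
      outSpan_le (fun r hr => hR.horizontal 0 r (by omega) q₀ (hWO hqW)) (by simp)
    exact hR.vertical 0 q₀ (hWO hqW) (mem_spanDx_iff.1 (e3 e2) _)
  -- likewise `φ²_[b]`, if dependent, would remain so up to the order `k₂ + ρ`, against `h2`
  have hone : ∀ b < k 1 + ρ, fderiv ℝ (outDeriv F N φ 1 b) q₀ ∉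
      outSpan F N φ (k 0 + b + 1) b q₀ := by
    intro b hb hmem
    have hW0 : ∀ x ∈ W, fderiv ℝ (outDeriv F N φ 1 b) x ∈ outSpan F N φ (k 0 + b + 1) b x := by
      intro x hx
      by_contra hx'
      have e1 := finrank_lt_of_mem_of_notMem (outSpan_mono le_rfl (Nat.le_succ b) x)
        (mem_outSpan_one (a := k 0 + b + 1) (Nat.lt_succ_self b) x) hx'
      rw [hrank _ (by omega) _ (by omega) x hx, hrank _ (by omega) (b + 1) (by omega) x hx,
        outSpan_succ_one, sup_eq_left.2 ((Submodule.span_singleton_le_iff_mem _ _).2 hmem)] at e1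
      exact lt_irrefl _ e1
    have hall : ∀ l, b + l ≤ k 1 + ρ → ∀ x ∈ W, fderiv ℝ (outDeriv F N φ 1 (b + l)) x ∈
        outSpan F N φ (k 0 + b + 1 + l) b x := by
      intro l
      induction l with
      | zero => exact fun _ => hW0
      | succ l ih =>
        intro hl x hx
        rw [← add_assoc b l 1, outDeriv_succ]
        refine fderiv_timeDeriv_mem_of_outSpan hR (hWO hx) (hR.contDiffAt_out (hWO hx) _ _)
          (hrank' (k 0 + b + 1 + l) (by omega) b (by omega) x hx)
          (by filter_upwards [hWo.mem_nhds hx] with y hy using ih (by omega) y hy)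
          (outSpan_mono (by omega) le_rfl x) ?_ ?_
        · exact fun r hr => mem_outSpan_zero (by omega) x
        · intro r hr
          rcases Nat.lt_or_ge (r + 1) b with h | h
          · exact mem_outSpan_one h x
          · obtain rfl : r + 1 = b := by omega
            exact outSpan_mono (by omega) le_rfl x (hW0 x hx)
    have e2 := hall (k 1 + ρ - b) (by omega) q₀ hqW
    rw [show b + (k 1 + ρ - b) = k 1 + ρ by omega] at e2
    refine h2 q₀ hq₀ ((outSpan_le ?_ ?_ : outSpan F N φ _ b q₀ ≤ _) e2)
    · intro r hr
      rcases lt_or_ge r (k 0) with h | h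
      · exact outDeriv_mem_frameSpan_of_lt hR hz (hWO hqW) 0 h _ _
      · obtain ⟨r', rfl⟩ := Nat.exists_eq_add_of_le h
        exact out_mem_frameSpan (by omega) (by omega)
    · intro r hr
      rcases lt_or_ge r (k 1) with h | h
      · exact outDeriv_mem_frameSpan_of_lt hR hz (hWO hqW) 1 h _ _
      · obtain ⟨r', rfl⟩ := Nat.exists_eq_add_of_le h
        exact frameSpan_mono le_rfl (by omega) le_rfl q₀ (h1 q₀ hq₀ r' (by omega))
  refine ⟨q₀, hq₀, ?_⟩
  have hbase : ∀ a ≤ k 0, Module.finrank ℝ (outSpan F N φ a 0 q₀) = a := by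
    intro a
    induction a with
    | zero =>
      intro _
      have := finrank_outSpan_le (F := F) (φ := φ) 0 0 q₀
      omega
    | succ a ih =>
      intro ha
      rw [outSpan_succ_zero, Submodule.finrank_sup_span_singleton (hzero a (by omega)),
        ih (by omega)]
  have hdiag : ∀ b ≤ k 1 + ρ, Module.finrank ℝ (outSpan F N φ (k 0 + b) b q₀) = k 0 + b + b := by
    intro b
    induction b with
    | zero => exact fun _ => hbase (k 0) le_rfl
    | succ b ih =>
      intro hb
      have e1 : fderiv ℝ (outDeriv F N φ 0 (k 0 + b)) q₀ ∉ outSpan F N φ (k 0 + b) b q₀ := by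
        intro h
        have e2 := outSpan_le_frameSpan_input (j := 0) hR hz (hWO hqW) (b := b) (d := b)
          (by omega) h
        exact out_notMem_frameSpan hR hz (hWO hqW) (by omega) n _ le_rfl e2
      rw [outSpan_succ_one, ← add_assoc (k 0) b 1,
        Submodule.finrank_sup_span_singleton (hone b (by omega)), outSpan_succ_zero,
        Submodule.finrank_sup_span_singleton e1, ih (by omega)]
      omega
  exact hdiag _ le_rfl

end Outputs

/-! ### The ranks of the codistributions of a flat output -/

section Ranks

variable {n N : ℕ} {F : System n} {φ : Fin 2 → (Fin n → ℝ) → ℝ} {k R : Fin 2 → ℕ}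
  {s : Fin 2 → Fin 2} {z : Fin n → (Fin n → ℝ) → ℝ} {X : Set (Fin n → ℝ)} {O : Set (Jet n N)}

/-- If the `φ²_[k₂+i]`, `i < l'`, depend on `x` and `φ¹_[k₁], …, φ¹_[k₁+l-1]` only, then so do all
the outputs of order less than `(k₁ + l, k₂ + l')`. -/
theorem outSpan_zero_le_frameSpan (hR : RegularOn F φ k s X O) (hz : CoordsOn z O) {q : Jet n N}
    (hq : q ∈ O) {l l' : ℕ} (hN : l ≤ N + 1)
    (h : ∀ i < l', fderiv ℝ (outDeriv F N φ 1 (k 1 + i)) q ∈ frameSpan F N φ k s z 0 n l 0 q) :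
    outSpan F N φ (k 0 + l) (k 1 + l') q ≤ frameSpan F N φ k s z 0 n l 0 q := by
  refine outSpan_le (fun i hi => ?_) fun i hi => ?_
  · rcases lt_or_ge i (k 0) with h | h
    · exact outDeriv_mem_frameSpan_of_lt hR hz hq 0 h _ _
    · obtain ⟨i', rfl⟩ := Nat.exists_eq_add_of_le h
      exact out_mem_frameSpan (by omega) (by omega)
  · rcases lt_or_ge i (k 1) with h' | h'
    · exact outDeriv_mem_frameSpan_of_lt hR hz hq 1 h' _ _
    · obtain ⟨i', rfl⟩ := Nat.exists_eq_add_of_le h'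
      exact h i' (by omega)

/-- Flatness puts the `n` covectors `dx` and the independent `dφʲ_[kⱼ], …, dφʲ_[Rⱼ-1]` into a
span of `R₁ + R₂` covectors. -/
theorem dim_add_order_le (hR : RegularOn F φ k s X O) (hz : CoordsOn z O) {q : Jet n N}
    (hq : q ∈ O) (hx : spanDx n N ≤ outSpan F N φ (R 0) (R 1) q) (hRN : ∀ j, R j ≤ N)
    (j : Fin 2) : n + (R j - k j) ≤ R 0 + R 1 := by
  have h1 : frameSpan F N φ k s z j n (R j - k j) 0 q ≤ outSpan F N φ (R 0) (R 1) q := by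
    refine frameSpan_le (fun i _ => hx (fderiv_comp_fst_mem_spanDx
      ((hz.smooth q hq i).differentiableAt (by simp)))) (fun i hi _ => ?_) (by simp)
    fin_cases j
    · exact mem_outSpan_zero (by simp at hi ⊢; omega) q
    · exact mem_outSpan_one (by simp at hi ⊢; omega) q
  have h2 := Submodule.finrank_mono h1
  have h3 := finrank_outSpan_le (F := F) (φ := φ) (R 0) (R 1) q
  have h4 := hRN j
  rw [finrank_frameSpan hR hz hq le_rfl (by omega) (by omega)] at h2
  omega

/-- If `φ²_[k₂+ρ]` depends on the second input, then `φ²_[k₂+ρ+i]` depends on the `i`-th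
derivative of the second input, for all `i`. -/
theorem leading_input (hR : RegularOn F φ k s X O) (hz : CoordsOn z O) {ρ : ℕ}
    (hmem : ∀ q ∈ O, fderiv ℝ (outDeriv F N φ 1 (k 1 + ρ)) q ∈
      frameSpan F N φ k s z 0 n (ρ + 1) 1 q)
    (hnot : ∀ q ∈ O, fderiv ℝ (outDeriv F N φ 1 (k 1 + ρ)) q ∉
      frameSpan F N φ k s z 0 n (ρ + 1) 0 q) (i : ℕ) (hi : ρ + i ≤ N) :
    ∀ q ∈ O, fderiv ℝ (outDeriv F N φ 1 (k 1 + ρ + i)) q ∈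
        frameSpan F N φ k s z 0 n (ρ + i + 1) (i + 1) q ∧
      fderiv ℝ (outDeriv F N φ 1 (k 1 + ρ + i)) q ∉
        frameSpan F N φ k s z 0 n (ρ + i + 1) i q := by
  induction i with
  | zero => exact fun q hq => ⟨hmem q hq, hnot q hq⟩
  | succ i ih =>
    intro q hq
    have hi0 : i < N + 1 := by omega
    have hev : ∀ᶠ x in 𝓝 q, fderiv ℝ (outDeriv F N φ 1 (k 1 + ρ + i)) x ∈
        frameSpan F N φ k s z 0 n (ρ + i + 1) (i + 1) x := by
      filter_upwards [hR.isOpen.mem_nhds hq] with x hx using (ih (by omega) x hx).1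
    have hA : ∀ l ∈ frameIndex n N n (ρ + i + 1) (i + 1), l ≠ Sum.inr (Sum.inr ⟨i, hi0⟩) →
        fderiv ℝ (frameFun F N φ k s z 0 l) q ∈ frameSpan F N φ k s z 0 n (ρ + i + 1) i q := by
      rintro (l | l | l) hl hne
      · exact coord_mem_frameSpan l l.2
      · exact out_mem_frameSpan (by simpa [frameIndex] using hl) (by omega)
      · refine input_mem_frameSpan l ?_
        have h1 : (l : ℕ) < i + 1 := by simpa [frameIndex] using hl
        have h2 : (l : ℕ) ≠ i := fun h => hne (by simp [Fin.ext_iff, h])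
        omega
    have hB : ∀ l ∈ frameIndex n N n (ρ + i + 1) (i + 1), l ≠ Sum.inr (Sum.inr ⟨i, hi0⟩) →
        fderiv ℝ (timeDeriv F N (frameFun F N φ k s z 0 l)) q ∈
          frameSpan F N φ k s z 0 n (ρ + (i + 1) + 1) (i + 1) q := by
      rintro (l | l | l) hl hne
      · exact frameSpan_mono le_rfl (by omega) (by omega) q (spanDxDu_le_frameSpan hR hz hq 1
          (fderiv_timeDeriv_coord_mem hR hz hq l))
      · have h1 : (l : ℕ) < ρ + i + 1 := by simpa [frameIndex] using hl
        have h2 : timeDeriv F N (frameFun F N φ k s z 0 (Sum.inr (Sum.inl l))) =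
          outDeriv F N φ 0 (k 0 + (l + 1)) := (outDeriv_succ F φ 0 (k 0 + l)).symm
        rw [h2]
        exact out_mem_frameSpan (by omega) (by omega)
      · have h1 : (l : ℕ) < i + 1 := by simpa [frameIndex] using hl
        have h2 : (l : ℕ) ≠ i := fun h => hne (by simp [Fin.ext_iff, h])
        have h3 : timeDeriv F N (frameFun F N φ k s z 0 (Sum.inr (Sum.inr l))) =
          fun q => q.2 ⟨l + 1, by omega⟩ (s 0 + 1) := timeDeriv_input F (by omega) _
        rw [h3]
        exact input_mem_frameSpan _ (by simp; omega)
    obtain ⟨r, hr1, hr2⟩ := exists_leading_coeff_frame hR hz hq (hR.contDiffAt_out hq _ _) hev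
      (by simp [frameIndex]) hA (frameSpan_mono le_rfl (by omega) le_rfl q) hB
    have hr0 : r ≠ 0 := by
      rintro rfl
      rw [zero_smul, sub_zero] at hr1
      exact (ih (by omega) q hq).2 hr1
    have hin : timeDeriv F N (frameFun F N φ k s z 0 (Sum.inr (Sum.inr ⟨i, hi0⟩))) =
        fun q => q.2 ⟨i + 1, by omega⟩ (s 0 + 1) := timeDeriv_input F (by omega) _
    rw [hin, ← outDeriv_succ] at hr2
    have hin1 : fderiv ℝ (fun q : Jet n N => q.2 ⟨i + 1, by omega⟩ (s 0 + 1)) q ∈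
        frameSpan F N φ k s z 0 n (ρ + (i + 1) + 1) (i + 1 + 1) q :=
      input_mem_frameSpan _ (by simp)
    constructor
    · have e1 := Submodule.add_mem _ (frameSpan_mono le_rfl le_rfl (Nat.le_succ _) q hr2)
        (Submodule.smul_mem _ r hin1)
      rwa [sub_add_cancel] at e1
    · intro h
      have e1 := Submodule.sub_mem _ h hr2
      rw [show k 1 + ρ + (i + 1) = k 1 + ρ + i + 1 from rfl, sub_sub_cancel] at e1
      exact input_notMem_frameSpan (j := 0) hR hz hq ⟨i + 1, by omega⟩ n (ρ + (i + 1) + 1)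
        le_rfl ((Submodule.smul_mem_iff _ hr0).1 e1)

/-- If the second input enters the derivatives of `φ²` from the order `k₂ + ρ` on, then
`n ≤ k₁ + k₂ + ρ`. The span `T` of `dφ_[0,R-1]` and a span `S` of `dx` and derivatives of `φ¹` meet
in `dx` and the `dφ¹_[k₁], …, dφ¹_[R₁-1]`, whereas `T + S` contains `S` and the differentials of
the second input up to the order `R₂ - k₂ - ρ - 1`; the count of dimensions gives the bound. -/
theorem dim_le_of_leading_input (hR : RegularOn F φ k s X O) (hz : CoordsOn z O)
    (hRN : ∀ j, R j ≤ N) {ρ : ℕ} (hρ : k 1 + ρ ≤ R 1)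
    (hmem : ∀ q ∈ O, fderiv ℝ (outDeriv F N φ 1 (k 1 + ρ)) q ∈
      frameSpan F N φ k s z 0 n (ρ + 1) 1 q)
    (hnot : ∀ q ∈ O, fderiv ℝ (outDeriv F N φ 1 (k 1 + ρ)) q ∉
      frameSpan F N φ k s z 0 n (ρ + 1) 0 q) {q : Jet n N} (hq : q ∈ O)
    (hx : spanDx n N ≤ outSpan F N φ (R 0) (R 1) q) : n ≤ k 0 + k 1 + ρ := by
  have hR0 := hRN 0
  have hR1 := hRN 1
  set i₁ := R 1 - k 1 - ρ with hi₁
  set M := max (R 0 - k 0) (ρ + i₁) with hM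
  set T := outSpan F N φ (R 0) (R 1) q with hT
  set S := frameSpan F N φ k s z 0 n M 0 q with hS
  have hind : ∀ e ≤ i₁, frameSpan F N φ k s z 0 n M e q ≤ T ⊔ S := by
    intro e
    induction e with
    | zero => exact fun _ => le_sup_right
    | succ e ih =>
      intro he
      have heN : e < N + 1 := by omega
      have h1 := leading_input hR hz hmem hnot e (by omega) q hq
      have hsup : ∀ d, frameSpan F N φ k s z 0 n d (e + 1) q ≤ frameSpan F N φ k s z 0 n d e q ⊔
        Submodule.span ℝ {fderiv ℝ (fun q : Jet n N => q.2 ⟨e, heN⟩ (s 0 + 1)) q} := fun d =>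
          frameSpan_succ_input_le heN q
      obtain ⟨y, hy, w, hw, hyw⟩ := Submodule.mem_sup.1 (hsup _ h1.1)
      obtain ⟨r, rfl⟩ := Submodule.mem_span_singleton.1 hw
      have hr0 : r ≠ 0 := by
        rintro rfl
        rw [zero_smul, add_zero] at hyw
        exact h1.2 (hyw ▸ hy)
      refine (hsup M).trans (sup_le (ih (by omega))
        ((Submodule.span_singleton_le_iff_mem _ _).2 ?_))
      rw [← Submodule.smul_mem_iff _ hr0, ← add_sub_cancel_left y (r • _), hyw]
      refine Submodule.sub_mem _ (Submodule.mem_sup_left (mem_outSpan_one (by omega) q)) ?_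
      exact ih (by omega) (frameSpan_mono le_rfl (by omega) le_rfl q hy)
  have h1 := Submodule.finrank_mono (hind i₁ le_rfl)
  have h2 : frameSpan F N φ k s z 0 n (R 0 - k 0) 0 q ≤ T ⊓ S := by
    refine le_inf (frameSpan_le (fun i _ => hx (fderiv_comp_fst_mem_spanDx
      ((hz.smooth q hq i).differentiableAt (by simp))))
      (fun i hi _ => mem_outSpan_zero (by omega) q) (by simp)) ?_
    exact frameSpan_mono le_rfl (le_max_left _ _) le_rfl q
  have h3 := Submodule.finrank_mono h2
  have h4 := Submodule.finrank_sup_add_finrank_inf_eq T S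
  have h5 : Module.finrank ℝ T ≤ R 0 + R 1 := finrank_outSpan_le _ _ q
  have h6 : Module.finrank ℝ S = n + M + 0 :=
    finrank_frameSpan hR hz hq le_rfl (by omega) (by omega)
  rw [finrank_frameSpan hR hz hq le_rfl (by omega) (by omega)] at h1 h3
  omega

/-- The rank structure of a flat output: with `m = n - k₁ - k₂`, the differentials of the outputs
up to the order `K + m` are independent, and, for `l ≤ m`, the codistribution
`P_{K-1+l} ∩ span{dx}` has rank `k₁ + k₂ + l`. -/
theorem exists_defect (hR : RegularOn F φ k s X O) {p : Jet n N} (hp : p ∈ O)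
    (hx : ∀ q ∈ O, spanDx n N ≤ outSpan F N φ (R 0) (R 1) q)
    (hu : ∀ q ∈ O, ∀ t, fderiv ℝ (fun q : Jet n N => q.2 0 t) q ∈
      outSpan F N φ (R 0 + 1) (R 1 + 1) q) (hRN : ∀ j, R j ≤ N)
    (hrank : ∀ l : ℕ, (∀ j, k j - 1 + l ≤ R j) →
      ConstantRankNear (codistP F N φ (fun j => k j - 1 + l)) p) :
    ∃ m, k 0 + k 1 + m = n ∧ (∀ j, k j + m ≤ R j) ∧ ∃ O' ⊆ O, IsOpen O' ∧ p ∈ O' ∧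
      (∀ q ∈ O', ∀ l ≤ m + 1,
        Module.finrank ℝ (outSpan F N φ (k 0 + l) (k 1 + l) q) = k 0 + k 1 + 2 * l) ∧
      ∀ q ∈ O', ∀ l ≤ m, Module.finrank ℝ
        (outSpan F N φ (k 0 + l) (k 1 + l) q ⊓ spanDx n N : Submodule ℝ _) = k 0 + k 1 + l := by
  classical
  set z : Fin n → (Fin n → ℝ) → ℝ := fun i x => x i with hzdef
  have hz : CoordsOn z O := coordsOn_proj O
  have hk0 := hR.one_le 0
  have hk1 := hR.one_le 1
  have hR0 := hRN 0
  have hR1 := hRN 1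
  -- `ρ` is the first order at which `φ²_[k₂+ρ]` is not, throughout a neighbourhood of `p`, a
  -- function of `x` and `φ¹_[k₁], …, φ¹_[k₁+ρ]`; without one the outputs would not determine `u`
  have hD : ∃ i, k 1 + i ≤ R 1 ∧ ¬ ∀ᶠ q in 𝓝 p, fderiv ℝ (outDeriv F N φ 1 (k 1 + i)) q ∈
      frameSpan F N φ k s z 0 n (i + 1) 0 q := by
    by_contra! hcon
    have hle : outSpan F N φ (R 0 + 1) (R 1 + 1) p ≤ frameSpan F N φ k s z 0 n (N + 1) 0 p := by
      refine (outSpan_mono (a' := k 0 + (N + 1)) (b' := k 1 + (R 1 + 1 - k 1)) (by omega)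
        (by omega) p).trans (outSpan_zero_le_frameSpan hR hz hp le_rfl fun i hi => ?_)
      exact frameSpan_mono le_rfl (by omega) le_rfl p (hcon i (by omega)).self_of_nhds
    exact input_notMem_frameSpan (j := 0) hR hz hp 0 n (N + 1) le_rfl (hle (hu p hp _))
  set ρ := Nat.find hD with hρdef
  obtain ⟨hρR, hρ⟩ := Nat.find_spec hD
  rw [← hρdef] at hρR hρ
  have hmin : ∀ i < ρ, ∀ᶠ q in 𝓝 p, fderiv ℝ (outDeriv F N φ 1 (k 1 + i)) q ∈
      frameSpan F N φ k s z 0 n (i + 1) 0 q := by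
    intro i hi
    have := Nat.find_min hD hi
    by_contra hcon
    exact this ⟨by omega, hcon⟩
  -- a neighbourhood on which the dependence below `ρ` and the constancy of the ranks hold
  have hev : ∀ᶠ q in 𝓝 p, q ∈ O ∧ (∀ i ∈ Finset.range ρ,
      fderiv ℝ (outDeriv F N φ 1 (k 1 + i)) q ∈ frameSpan F N φ k s z 0 n (i + 1) 0 q) ∧
      ∀ l ∈ Finset.range (N + 1), (∀ j, k j - 1 + l ≤ R j) →
        Module.finrank ℝ (outSpan F N φ (k 0 + l) (k 1 + l) q) =
          Module.finrank ℝ (outSpan F N φ (k 0 + l) (k 1 + l) p) := by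
    refine (hR.isOpen.eventually_mem hp).and (((Finset.eventually_all _).2 fun i hi =>
      hmin i (Finset.mem_range.1 hi)).and ((Finset.eventually_all _).2 fun l _ => ?_))
    by_cases hl : ∀ j, k j - 1 + l ≤ R j
    · have h1 : ConstantRankNear (outSpan F N φ (k 0 - 1 + l + 1) (k 1 - 1 + l + 1)) p := by
        have h2 := hrank l hl
        rwa [codistP_eq_outSpan] at h2
      rw [show k 0 - 1 + l + 1 = k 0 + l by omega, show k 1 - 1 + l + 1 = k 1 + l by omega] at h1
      exact h1.mono fun q hq _ => hq
    · exact Eventually.of_forall fun q h => absurd h hl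
  obtain ⟨O₁, hO₁, hO₁o, hpO₁⟩ := mem_nhds_iff.1 hev
  have hO₁O : O₁ ⊆ O := fun q hq => (hO₁ hq).1
  have hlow : ∀ q ∈ O₁, ∀ i < ρ, fderiv ℝ (outDeriv F N φ 1 (k 1 + i)) q ∈
      frameSpan F N φ k s z 0 n (i + 1) 0 q := fun q hq i hi =>
    (hO₁ hq).2.1 i (Finset.mem_range.2 hi)
  have hmem : ∀ q ∈ O₁, fderiv ℝ (outDeriv F N φ 1 (k 1 + ρ)) q ∈
      frameSpan F N φ k s z 0 n (ρ + 1) 1 q := by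
    intro q hq
    rcases Nat.eq_zero_or_pos ρ with h | h
    · rw [h]
      exact spanDxDu_le_frameSpan hR hz (hO₁O hq) 1 (hR.fderiv_outDeriv_add_mem 1 0 q (hO₁O hq))
    · obtain ⟨r, hr⟩ : ∃ r, ρ = r + 1 := ⟨ρ - 1, by omega⟩
      rw [hr, ← add_assoc, outDeriv_succ]
      refine fderiv_timeDeriv_mem hR hz (hO₁O hq) (hR.contDiffAt_out (hO₁O hq) _ _)
        (by filter_upwards [hO₁o.mem_nhds hq] with x hx using hlow x hx r (by omega))
        (frameSpan_mono le_rfl (by omega) (by omega) q) ?_ ?_ (by simp)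
      · exact fun i _ => frameSpan_mono le_rfl (by omega) le_rfl q
          (spanDxDu_le_frameSpan hR hz (hO₁O hq) 1 (fderiv_timeDeriv_coord_mem hR hz (hO₁O hq) i))
      · exact fun i hi => out_mem_frameSpan (i := i + 1) (by omega) (by omega)
  -- the second input need not enter `φ²_[k₂+ρ]` at `p` itself: the ranks are computed at nearby
  -- points of the open set `U`, and carried to `p` by their constancy
  obtain ⟨q₁, hq₁, hq₁n⟩ : ∃ q ∈ O₁, fderiv ℝ (outDeriv F N φ 1 (k 1 + ρ)) q ∉
      frameSpan F N φ k s z 0 n (ρ + 1) 0 q := by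
    by_contra! hcon
    exact hρ (by filter_upwards [hO₁o.mem_nhds hpO₁] with q hq using hcon q hq)
  obtain ⟨U, hU, hUo, hq₁U⟩ := mem_nhds_iff.1 ((hO₁o.eventually_mem hq₁).and
    (eventually_notMem_frameSpan hR hz (hO₁O hq₁) (hR.contDiffAt_out (hO₁O hq₁) _ _) hq₁n))
  have hUO : U ⊆ O := fun q hq => hO₁O (hU hq).1
  have hUn : ∀ q ∈ U, fderiv ℝ (outDeriv F N φ 1 (k 1 + ρ)) q ∉
      frameSpan F N φ k s z 0 n (ρ + 1) 0 q := fun q hq => (hU hq).2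
  have hdim : n ≤ k 0 + k 1 + ρ :=
    dim_le_of_leading_input (hR.mono hUo hUO) (hz.mono hUO) hRN hρR
      (fun q hq => hmem q (hU hq).1) hUn hq₁U (hx q₁ (hUO hq₁U))
  have hUn' : ∀ q ∈ U, fderiv ℝ (outDeriv F N φ 1 (k 1 + ρ)) q ∉
      frameSpan F N φ k s z 0 n (N + 1) 0 q := by
    intro q hq h
    refine hUn q hq ?_
    have := frameSpan_inf_le hR hz (hUO hq) _ _ _ _ _ _ ⟨h, hmem q (hU hq).1⟩
    exact frameSpan_mono (by simp) (by simp) (by simp) q this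
  obtain ⟨q₀, hq₀, hfull⟩ := exists_finrank_outSpan_eq hR hz hUo hUO ⟨q₁, hq₁U⟩
    (by omega) (fun q hq i hi => hlow q (hU hq).1 i hi) hUn'
  have hle : ∀ q ∈ O₁, ∀ l ≤ ρ, outSpan F N φ (k 0 + l) (k 1 + l) q ≤
      frameSpan F N φ k s z 0 n l 0 q := fun q hq l hl =>
    outSpan_zero_le_frameSpan hR hz (hO₁O hq) (by omega) fun i hi =>
      frameSpan_mono le_rfl (by omega) le_rfl q (hlow q hq i (by omega))
  have hfull' : ∀ l ≤ ρ, Module.finrank ℝ (outSpan F N φ (k 0 + l) (k 1 + l) q₀) =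
      k 0 + l + (k 1 + l) := fun l hl =>
    finrank_outSpan_of_le hfull (by omega) (by omega)
  -- the outputs up to `K - 1 + ρ` are independent functions of `n + ρ` variables
  have hdim' : k 0 + k 1 + ρ = n := by
    have h1 := Submodule.finrank_mono (hle q₀ (hU hq₀).1 ρ le_rfl)
    rw [hfull' ρ le_rfl, finrank_frameSpan hR hz (hUO hq₀) le_rfl (by omega) (by omega)] at h1
    omega
  have hord : ∀ j, k j + ρ ≤ R j := by
    have h0 := dim_add_order_le hR hz hp (hx p hp) hRN 0
    have h1 := dim_add_order_le hR hz hp (hx p hp) hRN 1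
    intro j
    fin_cases j
    · simp; omega
    · simp; omega
  have hlast : Module.finrank ℝ (outSpan F N φ (k 0 + (ρ + 1)) (k 1 + (ρ + 1)) q₀) =
      k 0 + (ρ + 1) + (k 1 + (ρ + 1)) := by
    have hq₀O := hUO hq₀
    have e1 : fderiv ℝ (outDeriv F N φ 0 (k 0 + ρ)) q₀ ∉
        outSpan F N φ (k 0 + ρ) (k 1 + ρ) q₀ := fun h =>
      out_notMem_frameSpan hR hz hq₀O (by omega) n 0 le_rfl (hle q₀ (hU hq₀).1 ρ le_rfl h)
    have e2 : fderiv ℝ (outDeriv F N φ 1 (k 1 + ρ)) q₀ ∉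
        outSpan F N φ (k 0 + ρ + 1) (k 1 + ρ) q₀ := by
      intro h
      refine hUn q₀ hq₀ (outSpan_zero_le_frameSpan (l := ρ + 1) (l' := ρ) hR hz hq₀O (by omega)
        (fun i hi => ?_) h)
      exact frameSpan_mono le_rfl (by omega) le_rfl q₀ (hlow q₀ (hU hq₀).1 i hi)
    rw [← add_assoc, ← add_assoc, outSpan_succ_one, Submodule.finrank_sup_span_singleton e2,
      outSpan_succ_zero, Submodule.finrank_sup_span_singleton e1, hfull' ρ le_rfl]
    omega
  have hO₁full : ∀ q ∈ O₁, ∀ l ≤ ρ + 1,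
      Module.finrank ℝ (outSpan F N φ (k 0 + l) (k 1 + l) q) = k 0 + k 1 + 2 * l := by
    intro q hq l hl
    have hc : ∀ q ∈ O₁, _ := fun q hq => (hO₁ hq).2.2 l
      (Finset.mem_range.2 (by have := hord 1; omega)) (fun j => by
        have := hord j; have := hR.one_le j; omega)
    rw [hc q hq, ← hc q₀ (hU hq₀).1]
    rcases Nat.lt_or_ge ρ l with h | h
    · obtain rfl : l = ρ + 1 := by omega
      rw [hlast]; omega
    · rw [hfull' l h]; omega
  refine ⟨ρ, hdim', hord, O₁, hO₁O, hO₁o, hpO₁, hO₁full, fun q hq l hl => ?_⟩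
  have hqO := hO₁O hq
  have hsup : outSpan F N φ (k 0 + l) (k 1 + l) q ⊔ spanDx n N =
      frameSpan F N φ k s z 0 n l 0 q := by
    refine le_antisymm (sup_le (hle q hq l hl) ((spanDx_le_frameSpan hR hz hqO).trans
      (frameSpan_mono le_rfl (by omega) le_rfl q))) (frameSpan_le (fun i _ =>
      Submodule.mem_sup_right (fderiv_comp_fst_mem_spanDx
        ((hz.smooth q hqO i).differentiableAt (by simp)))) (fun i hi _ =>
      Submodule.mem_sup_left (mem_outSpan_zero (by omega) q)) (by simp))
  have h1 := Submodule.finrank_sup_add_finrank_inf_eq (outSpan F N φ (k 0 + l) (k 1 + l) q)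
    (spanDx n N)
  rw [hsup, finrank_frameSpan hR hz hqO le_rfl (by omega) (by omega),
    hO₁full q hq l (by omega), finrank_spanDx hR hqO] at h1
  omega

end Ranks

/-! ### Consequences of the hypotheses near a point -/

section Hypotheses

variable {n N : ℕ} {F : System n} {φ : Fin 2 → (Fin n → ℝ) → ℝ} {k R : Fin 2 → ℕ}
  {X : Set (Fin n → ℝ)} {p : Jet n N}

/-- Relative degrees at `p` give a neighbourhood on which they persist, with an input component `sⱼ`
that enters `φʲ_[kⱼ]` regularly throughout. -/
theorem exists_regularOn (hX : IsOpen X)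
    (hF : ContDiffOn ℝ ∞ (fun y : (Fin n → ℝ) × (Fin 2 → ℝ) => F y.1 y.2) (X ×ˢ univ))
    (hφ : ∀ j, ContDiffOn ℝ ∞ (φ j) X) (hp : p.1 ∈ X)
    (hk : ∀ j, HasRelativeDegree F N φ j (k j) p) :
    ∃ (s : Fin 2 → Fin 2) (O : Set (Jet n N)), p ∈ O ∧ RegularOn F φ k s X O := by
  have hs : ∀ j, ∃ t : Fin 2,
      fderiv ℝ (outDeriv F N φ j (k j)) p (0, Pi.single 0 (Pi.single t 1)) ≠ 0 := by
    intro j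
    obtain ⟨h1, h2, h3⟩ := hk j
    obtain ⟨a, ha⟩ : ∃ a, k j = a + 1 := ⟨k j - 1, by omega⟩
    by_contra! hcon
    refine h3 (mem_spanDx_iff.2 fun ζ => ?_)
    have hev : ∀ᶠ x in 𝓝 p, fderiv ℝ (outDeriv F N φ j a) x ∈ spanDxDu n N 0 := by
      rw [spanDxDu_zero]; exact h2 a (by omega)
    have hform : ∀ ζ : Fin (N + 1) → Fin 2 → ℝ, fderiv ℝ (outDeriv F N φ j (k j)) p (0, ζ) =
        fderiv ℝ (outDeriv F N φ j a) p
          (fderiv ℝ (fun y : (Fin n → ℝ) × (Fin 2 → ℝ) => F y.1 y.2) (p.1, p.2 0) (0, ζ 0), 0) := by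
      intro ζ
      rw [ha, outDeriv_succ, fderiv_timeDeriv_vertical hX hF hp
        (contDiffAt_outDeriv hX hF hφ hp j a) hev (by simp)]
      have h4 := hev.self_of_nhds (jetShift N ζ) (by simp)
      rw [← add_zero (fderiv ℝ (fun y : (Fin n → ℝ) × (Fin 2 → ℝ) => F y.1 y.2) (p.1, p.2 0)
        (0, ζ 0)), ← zero_add (jetShift N ζ), ← Prod.mk_add_mk, map_add, h4, add_zero, add_zero]
    have h5 : fderiv ℝ (outDeriv F N φ j (k j)) p (0, ζ) =
        fderiv ℝ (outDeriv F N φ j (k j)) p (0, Pi.single 0 (ζ 0)) := by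
      rw [hform, hform, Pi.single_eq_same]
    have h6 : ((0 : Fin n → ℝ), (Pi.single 0 (ζ 0) : Fin (N + 1) → Fin 2 → ℝ)) =
        ∑ t, ζ 0 t • (0, Pi.single 0 (Pi.single t 1)) := by
      refine Prod.ext (by simp) ?_
      funext α t
      rcases eq_or_ne α 0 with rfl | hα
      · fin_cases t <;> simp
      · simp [hα]
    rw [h5, h6, map_sum]
    exact Finset.sum_eq_zero fun t _ => by rw [map_smul, hcon t, smul_zero]
  choose s hs using hs
  have hev : ∀ᶠ q in 𝓝 p, q.1 ∈ X ∧ (∀ j, ∀ a ∈ Finset.range (k j),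
      fderiv ℝ (outDeriv F N φ j a) q ∈ spanDx n N) ∧ ∀ j,
      fderiv ℝ (outDeriv F N φ j (k j)) q (0, Pi.single 0 (Pi.single (s j) 1)) ≠ 0 := by
    refine (continuousAt_fst.eventually (hX.eventually_mem hp)).and
      ((eventually_all.2 fun j => (Finset.eventually_all _).2 fun a ha =>
        (hk j).2.1 a (Finset.mem_range.1 ha)).and (eventually_all.2 fun j => ?_))
    have hc : ContinuousAt (fun q => fderiv ℝ (outDeriv F N φ j (k j)) q
        (0, Pi.single 0 (Pi.single (s j) 1))) p :=
      (((contDiffAt_outDeriv hX hF hφ hp j (k j)).fderiv_right (m := 0)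
        (by norm_cast)).continuousAt).clm_apply continuousAt_const
    exact hc.eventually_ne (hs j)
  obtain ⟨O, hO, hOo, hpO⟩ := mem_nhds_iff.1 hev
  exact ⟨s, O, hpO, hX, hOo, fun q hq => (hO hq).1, hF, hφ, fun j => (hk j).1,
    fun j a ha q hq => (hO hq).2.1 j a (Finset.mem_range.2 ha), fun j q hq => (hO hq).2.2 j⟩

/-- The chain rule: a function of the outputs has its differential in their span. -/
theorem fderiv_mem_outSpan_of_comp {q : Jet n N} {B : Fin 2 → ℕ}
    (hd : ∀ j a, DifferentiableAt ℝ (outDeriv F N φ j a) q) {h : Jet n N → ℝ}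
    {G : ((j : Fin 2) → Fin (B j) → ℝ) → ℝ} (hG : DifferentiableAt ℝ G (outJet F N φ B q))
    (heq : h =ᶠ[𝓝 q] fun x => G (outJet F N φ B x)) :
    fderiv ℝ h q ∈ outSpan F N φ (B 0) (B 1) q := by
  have h1 : HasFDerivAt (outJet F N φ B) (ContinuousLinearMap.pi fun j =>
      ContinuousLinearMap.pi fun a : Fin (B j) => fderiv ℝ (outDeriv F N φ j a) q) q :=
    hasFDerivAt_pi.2 fun j => hasFDerivAt_pi.2 fun a => (hd j a).hasFDerivAt
  have h2 : HasFDerivAt (fun x => G (outJet F N φ B x)) _ q := hG.hasFDerivAt.comp q h1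
  rw [heq.fderiv_eq, h2.fderiv]
  refine mem_span_of_common_kernel _ _ fun ξ hξ => ?_
  have h0 : (ContinuousLinearMap.pi fun j =>
      ContinuousLinearMap.pi fun a : Fin (B j) => fderiv ℝ (outDeriv F N φ j a) q) ξ = 0 := by
    funext j a
    fin_cases j
    · exact hξ (Sum.inl a)
    · exact hξ (Sum.inr a)
  rw [ContinuousLinearMap.comp_apply, h0, map_zero]

/-- Flatness on the level of differentials: `dx ∈ span{dφ_[0,R-1]}` and `du ∈ span{dφ_[0,R]}`. -/
theorem FlatParametrization.eventually_span (hX : IsOpen X)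
    (hF : ContDiffOn ℝ ∞ (fun y : (Fin n → ℝ) × (Fin 2 → ℝ) => F y.1 y.2) (X ×ˢ univ))
    (hφ : ∀ j, ContDiffOn ℝ ∞ (φ j) X) (hp : p.1 ∈ X) (hR : FlatParametrization F N φ p R) :
    ∀ᶠ q in 𝓝 p, spanDx n N ≤ outSpan F N φ (R 0) (R 1) q ∧
      ∀ t, fderiv ℝ (fun q : Jet n N => q.2 0 t) q ∈ outSpan F N φ (R 0 + 1) (R 1 + 1) q := by
  obtain ⟨Vx, Vu, Fx, Fu, hVx, hVu, hFx, hFu, hev⟩ := hR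
  filter_upwards [hev.eventually_nhds, continuousAt_fst.eventually (hX.eventually_mem hp)]
    with q hq hqX
  have hd : ∀ j a, DifferentiableAt ℝ (outDeriv F N φ j a) q := fun j a =>
    (contDiffAt_outDeriv hX hF hφ hqX j a).differentiableAt (by simp)
  obtain ⟨hqx, -, hqu, -⟩ := hq.self_of_nhds
  constructor
  · refine Submodule.span_le.2 ?_
    rintro _ ⟨i, rfl⟩
    have h1 : DifferentiableAt ℝ (fun y => Fx y i) (outJet F N φ R q) :=
      differentiableAt_pi.1 ((hFx.contDiffAt (hVx.mem_nhds hqx)).differentiableAt (by simp)) i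
    have h2 := fderiv_mem_outSpan_of_comp (h := fun q : Jet n N => q.1 i) hd h1
      (hq.mono fun x hx => congrFun hx.2.1 i)
    have h3 : fderiv ℝ (fun x : Fin n → ℝ => x i) q.1 = ContinuousLinearMap.proj i :=
      (ContinuousLinearMap.proj (R := ℝ) (φ := fun _ : Fin n => ℝ) i).hasFDerivAt.fderiv
    rwa [fderiv_comp_fst (h := fun x : Fin n → ℝ => x i) (by fun_prop), h3] at h2
  · intro t
    have h1 : DifferentiableAt ℝ (fun y => Fu y t) (outJet F N φ (fun j => R j + 1) q) :=
      differentiableAt_pi.1 ((hFu.contDiffAt (hVu.mem_nhds hqu)).differentiableAt (by simp)) t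
    exact fderiv_mem_outSpan_of_comp (B := fun j => R j + 1) hd h1
      (hq.mono fun x hx => congrFun hx.2.2.2 t)

end Hypotheses

/-! ### The triangular form implies integrability -/

section TriangularToIntegrable

variable {n N : ℕ} {F : System n} {φ : Fin 2 → (Fin n → ℝ) → ℝ} {k R : Fin 2 → ℕ}
  {s : Fin 2 → Fin 2} {X : Set (Fin n → ℝ)} {O : Set (Jet n N)} {p : Jet n N}
  {z : Fin n → (Fin n → ℝ) → ℝ} {j : Fin 2}

theorem completelyIntegrableNear_of_frameSpan (hR : RegularOn F φ k s X O) (hz : CoordsOn z O)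
    (hp : p ∈ O) {Q : Codistribution (Jet n N)} {c : ℕ} (hc : c ≤ n)
    (hQ : ∀ q ∈ O, Q q = frameSpan F N φ k s z j c 0 0 q) : CompletelyIntegrableNear Q p := by
  refine ⟨O, c, fun i q => z (Fin.castLE hc i) q.1, hR.isOpen, hp, fun i q hq =>
    ((hz.smooth q hq _).comp q contDiffAt_fst).contDiffWithinAt, fun q hq => ⟨?_, ?_⟩⟩
  · exact (linearIndependent_frame (j := j) hR hz hq).comp (fun i => Sum.inl (Fin.castLE hc i))
      (Sum.inl_injective.comp (Fin.castLE_injective hc))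
  · rw [hQ q hq]
    refine le_antisymm (frameSpan_le (fun i hi => Submodule.subset_span ⟨⟨i, hi⟩, rfl⟩)
      (by simp) (by simp)) (Submodule.span_le.2 ?_)
    rintro _ ⟨i, rfl⟩
    exact coord_mem_frameSpan _ i.2

/-- A function of the first `l` coordinates has no derivative along the others, also where only the
composite with the projection is known to be differentiable. -/
theorem fderiv_comp_firstCoords_eq_zero {l : ℕ} (hl : l ≤ n) {c : (Fin l → ℝ) → ℝ} {y : Fin n → ℝ}
    (hc : DifferentiableAt ℝ (fun y => c (firstCoords hl y)) y) {η : Fin n → ℝ}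
    (hη : ∀ i : Fin n, (i : ℕ) < l → η i = 0) :
    fderiv ℝ (fun y => c (firstCoords hl y)) y η = 0 := by
  have h0 : lineDeriv ℝ (fun y => c (firstCoords hl y)) y η =
      fderiv ℝ (fun y => c (firstCoords hl y)) y η := hc.lineDeriv_eq_fderiv
  rw [← h0]
  change deriv (fun t : ℝ => c (firstCoords hl (y + t • η))) 0 = 0
  have : (fun t : ℝ => c (firstCoords hl (y + t • η))) = fun _ => c (firstCoords hl y) := by
    funext t
    congr 1
    funext i
    simp [firstCoords, hη (Fin.castLE hl i) i.2]
  rw [this]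
  simp

/-- The components of the state transformation are coordinates. -/
theorem StaticFeedbackEquiv.coordsOn {G : System n} {x₀ : Fin n → ℝ} {u₀ : Fin 2 → ℝ}
    (E : StaticFeedbackEquiv F G x₀ u₀) {O : Set (Jet n N)}
    (hO : ∀ q ∈ O, q.1 ∈ E.Φx.source) : CoordsOn (fun i x => E.Φx x i) O := by
  refine ⟨fun q hq i => ?_, fun q hq ξ hξ => ?_⟩
  · exact contDiffAt_pi.1 (E.smooth_x.contDiffAt (E.Φx.open_source.mem_nhds (hO q hq))) i
  · have h1 : DifferentiableAt ℝ E.Φx q.1 :=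
      (E.smooth_x.contDiffAt (E.Φx.open_source.mem_nhds (hO q hq))).differentiableAt (by simp)
    have h6 : fderiv ℝ E.Φx q.1 ξ = 0 := by
      funext i
      have h7 := hξ i
      rw [fderiv_apply h1] at h7
      exact h7
    rw [← fderiv_symm_fderiv E.smooth_x E.smooth_x_symm (hO q hq) ξ, h6, map_zero]

/-- If the derivative of each coordinate involves the coordinates up to the next one and `v¹`
only, then the outputs and their derivatives of order at most `K - 1 + l` are functions of
`z¹, …, z^{k₁+k₂+l}` and `v¹, …, v¹_[l-1]`, here on the level of differentials. -/
theorem outSpan_le_of_triangular (hR : RegularOn F φ k s X O) (hz : CoordsOn z O) {m : ℕ}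
    (hm : k 0 + k 1 + m = n) (hmN : m ≤ N)
    (hφ1 : ∀ q ∈ O, ∀ i (hi : i < k 0), fderiv ℝ (outDeriv F N φ 0 i) q =
      fderiv ℝ (fun q : Jet n N => z ⟨i, by omega⟩ q.1) q)
    (hφ2 : ∀ q ∈ O, ∀ i (hi : i < k 1), fderiv ℝ (outDeriv F N φ 1 i) q =
      fderiv ℝ (fun q : Jet n N => z ⟨k 0 + i, by omega⟩ q.1) q)
    (hdot : ∀ q ∈ O, ∀ i : Fin n, (i : ℕ) + 1 < n →
      fderiv ℝ (timeDeriv F N fun q => z i q.1) q ∈ frameSpan F N φ k s z 0 (i + 2) 1 0 q)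
    {l : ℕ} (hl : l ≤ m) {q : Jet n N} (hq : q ∈ O) :
    outSpan F N φ (k 0 + l) (k 1 + l) q ≤ frameSpan F N φ k s z 0 (k 0 + k 1 + l) l 0 q := by
  obtain ⟨b, hb⟩ : ∃ b, k 1 = b + 1 := ⟨k 1 - 1, by have := hR.one_le 1; omega⟩
  have key : ∀ i ≤ m, ∀ q ∈ O, fderiv ℝ (outDeriv F N φ 1 (b + i)) q ∈
      frameSpan F N φ k s z 0 (k 0 + k 1 + i) i 0 q := by
    intro i
    induction i with
    | zero =>
      intro _ q hq
      rw [hφ2 q hq (b + 0) (by omega)]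
      exact coord_mem_frameSpan _ (by simp; omega)
    | succ i ih =>
      intro hi q hq
      rw [← add_assoc b i 1, outDeriv_succ]
      refine fderiv_timeDeriv_mem hR hz hq (hR.contDiffAt_out hq _ _)
        (by filter_upwards [hR.isOpen.mem_nhds hq] with x hx using ih (by omega) x hx)
        (frameSpan_mono (by omega) (by omega) le_rfl q) ?_ ?_ (by simp)
      · exact fun r hr => frameSpan_mono (by omega) (by omega) le_rfl q
          (hdot q hq r (by omega))
      · exact fun r hr => out_mem_frameSpan (i := r + 1) (by omega) (by omega)
  refine outSpan_le (fun i hi => ?_) fun i hi => ?_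
  · rcases lt_or_ge i (k 0) with h | h
    · rw [hφ1 q hq i h]
      exact coord_mem_frameSpan _ (by simp; omega)
    · obtain ⟨i', rfl⟩ := Nat.exists_eq_add_of_le h
      exact out_mem_frameSpan (by omega) (by omega)
  · rcases lt_or_ge i b with h | h
    · rw [hφ2 q hq i (by omega)]
      exact coord_mem_frameSpan _ (by simp; omega)
    · obtain ⟨i', rfl⟩ := Nat.exists_eq_add_of_le h
      exact frameSpan_mono (by omega) (by omega) le_rfl q (key i' (by omega) q hq)

/-- In the triangular form `P_{K-1+l}` is spanned by `dz¹, …, dz^{k₁+k₂+l}` and `dv¹, …, dv¹_[l-1]`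
(the inclusion is an equality by the ranks), so that `Q_{K-1+l}` is spanned by the former, and
equals `span{dx}` for `l` beyond `n - k₁ - k₂`. -/
theorem completelyIntegrableNear_of_equiv (hR : RegularOn F φ k s X O) (hp : p ∈ O) {m : ℕ}
    (hm : k 0 + k 1 + m = n) (hmN : m ≤ N)
    (hrank : ∀ q ∈ O, ∀ l ≤ m,
        Module.finrank ℝ (outSpan F N φ (k 0 + l) (k 1 + l) q) = k 0 + k 1 + 2 * l)
    (hE : EquivToTriangular F φ k p.1 (p.2 0)) (l : ℕ) :
    CompletelyIntegrableNear (codistQ F N φ fun j => k j - 1 + l) p := by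
  obtain ⟨-, a, b, E, ⟨i₀, i₁, hi₀, hi₁, hout⟩, hsm, -, -⟩ := hE
  have hk0 := hR.one_le 0
  have hk1 := hR.one_le 1
  set z : Fin n → (Fin n → ℝ) → ℝ := fun i x => E.Φx x i with hzdef
  set W : Set (Jet n N) := O ∩ (fun q : Jet n N => (q.1, q.2 0)) ⁻¹' E.Φ.source with hW
  have hcont : Continuous fun q : Jet n N => (q.1, q.2 0) := by fun_prop
  have hWo : IsOpen W := hR.isOpen.inter (E.Φ.open_source.preimage hcont)
  have hpW : p ∈ W := ⟨hp, E.mem⟩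
  have hRW : RegularOn F φ k s X W := hR.mono hWo inter_subset_left
  have hsrc : ∀ q ∈ W, q.1 ∈ E.Φx.source := fun q hq => E.source_x _ hq.2
  have hz : CoordsOn z W := E.coordsOn hsrc
  set v : Jet n N → ℝ := fun q => (E.Φ (q.1, q.2 0)).2 0 with hv
  have hdotval : ∀ q ∈ W, ∀ i : Fin n, timeDeriv F N (fun q => z i q.1) q =
      triangularSystem k a b (E.Φx q.1) (E.Φ (q.1, q.2 0)).2 i := by
    intro q hq i
    have h1 := E.conj _ hq.2
    rw [E.fst_eq _ hq.2] at h1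
    have h2 : DifferentiableAt ℝ E.Φx q.1 :=
      (E.smooth_x.contDiffAt (E.Φx.open_source.mem_nhds (hsrc q hq))).differentiableAt (by simp)
    simp only [timeDeriv]
    rw [fderiv_comp_fst ((hz.smooth q hq i).differentiableAt (by simp)),
      ContinuousLinearMap.comp_apply, ← congrFun h1 i]
    exact congrArg (fun L : (Fin n → ℝ) →L[ℝ] ℝ => L (F q.1 (q.2 0))) (fderiv_apply h2 i)
  have hev : ∀ {h h' : Jet n N → ℝ}, (∀ q ∈ W, h q = h' q) → ∀ q ∈ W,
      fderiv ℝ h q = fderiv ℝ h' q := fun hh q hq =>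
    Filter.EventuallyEq.fderiv_eq (by filter_upwards [hWo.mem_nhds hq] with x hx using hh x hx)
  have hφ1 : ∀ i (hi : i < k 0), ∀ q ∈ W, outDeriv F N φ 0 i q = z ⟨i, by omega⟩ q.1 := by
    intro i
    induction i with
    | zero =>
      intro hi q hq
      have := (hout q.1 (hsrc q hq)).1
      rwa [show i₀ = ⟨0, by omega⟩ from Fin.ext hi₀] at this
    | succ i ih =>
      intro hi q hq
      have h1 := hdotval q hq ⟨i, by omega⟩
      rw [timeDeriv, ← hev (ih (by omega)) q hq] at h1
      rw [outDeriv_succ]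
      refine h1.trans ?_
      simp only [triangularSystem]
      rw [dif_neg (by omega), if_neg (by omega), if_pos (by omega)]
  have hv1 : ∀ q ∈ W, outDeriv F N φ 0 (k 0) q = v q := by
    intro q hq
    obtain ⟨c, hc⟩ : ∃ c, k 0 = c + 1 := ⟨k 0 - 1, by omega⟩
    have h1 := hdotval q hq ⟨c, by omega⟩
    rw [timeDeriv, ← hev (hφ1 c (by omega)) q hq] at h1
    rw [hc, outDeriv_succ]
    refine h1.trans ?_
    simp only [triangularSystem]
    rw [dif_neg (by omega), if_pos (by omega)]
  have hφ2 : ∀ i (hi : i < k 1), ∀ q ∈ W, outDeriv F N φ 1 i q = z ⟨k 0 + i, by omega⟩ q.1 := by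
    intro i
    induction i with
    | zero =>
      intro hi q hq
      have := (hout q.1 (hsrc q hq)).2
      rwa [show i₁ = ⟨k 0 + 0, by omega⟩ from Fin.ext (by simpa using hi₁)] at this
    | succ i ih =>
      intro hi q hq
      have h1 := hdotval q hq ⟨k 0 + i, by omega⟩
      rw [timeDeriv, ← hev (ih (by omega)) q hq] at h1
      rw [outDeriv_succ]
      refine h1.trans ?_
      simp only [triangularSystem]
      rw [dif_neg (by omega), if_neg (by omega), if_pos (by omega)]
      rfl
  have hdot : ∀ q ∈ W, ∀ i : Fin n, (i : ℕ) + 1 < n →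
      fderiv ℝ (timeDeriv F N fun q => z i q.1) q ∈ frameSpan F N φ k s z 0 (i + 2) 1 0 q := by
    intro q hq i hi
    rcases eq_or_ne ((i : ℕ) + 1) (k 0) with h | h
    · have h1 : ∀ q ∈ W, timeDeriv F N (fun q => z i q.1) q = outDeriv F N φ 0 (k 0 + 0) q := by
        intro q hq
        rw [hdotval q hq, add_zero, hv1 q hq, triangularSystem, dif_neg (by omega), if_pos h]
      rw [hev h1 q hq]
      exact out_mem_frameSpan (by omega) (by omega)
    rcases lt_or_ge ((i : ℕ) + 1) (k 0 + k 1) with h' | h'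
    · have h1 : ∀ q ∈ W, timeDeriv F N (fun q => z i q.1) q = z ⟨i + 1, hi⟩ q.1 := by
        intro q hq
        rw [hdotval q hq, triangularSystem, dif_neg (by omega), if_neg h, if_pos h']
      rw [hev h1 q hq]
      exact coord_mem_frameSpan _ (by simp)
    · have hl : (i : ℕ) + 1 + 1 ≤ n := hi
      obtain ⟨ha, hb⟩ := hsm ((i : ℕ) + 1) h' hl
      have h1 : ∀ q ∈ W, timeDeriv F N (fun q => z i q.1) q =
          (fun q : Jet n N => a (i + 1) (firstCoords hl (E.Φx q.1)) +
            b (i + 1) (firstCoords hl (E.Φx q.1)) * outDeriv F N φ 0 (k 0 + 0) q) q := by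
        intro q hq
        rw [hdotval q hq, triangularSystem, dif_neg (by omega), if_neg h, if_neg (by omega)]
        simp only [add_zero]
        rw [hv1 q hq]
      rw [hev h1 q hq]
      have hcd : ∀ c : (Fin ((i : ℕ) + 1 + 1) → ℝ) → ℝ,
          ContDiffOn ℝ ∞ c (firstCoords hl '' E.Φx.target) →
          DifferentiableAt ℝ (fun x => c (firstCoords hl (E.Φx x))) q.1 ∧
          fderiv ℝ (fun q : Jet n N => c (firstCoords hl (E.Φx q.1))) q ∈
            frameSpan F N φ k s z 0 (i + 2) 1 0 q := by
        intro c hc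
        have hx := hsrc q hq
        have h2 : DifferentiableAt ℝ E.Φx q.1 :=
          (E.smooth_x.contDiffAt (E.Φx.open_source.mem_nhds hx)).differentiableAt (by simp)
        have h3 : ContDiffOn ℝ ∞ (fun y : Fin n → ℝ => c (firstCoords hl y)) E.Φx.target := by
          refine hc.comp (ContDiff.contDiffOn ?_) (mapsTo_image _ _)
          exact contDiff_pi.2 fun r => contDiff_apply ℝ ℝ _
        have h4 : DifferentiableAt ℝ (fun y : Fin n → ℝ => c (firstCoords hl y)) (E.Φx q.1) :=
          (h3.contDiffAt (E.Φx.open_target.mem_nhds (E.Φx.map_source hx))).differentiableAt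
            (by simp)
        have h5 : DifferentiableAt ℝ (fun x => c (firstCoords hl (E.Φx x))) q.1 := h4.comp q.1 h2
        refine ⟨h5, ?_⟩
        have h6 : fderiv ℝ (fun q : Jet n N => c (firstCoords hl (E.Φx q.1))) q ∈
            Submodule.span ℝ (range fun r : Fin ((i : ℕ) + 2) =>
              fderiv ℝ (fun q : Jet n N => z (Fin.castLE hl r) q.1) q) := by
          refine mem_span_of_common_kernel _ _ fun ξ hξ => ?_
          have h6 : HasFDerivAt (fun x => c (firstCoords hl (E.Φx x))) _ q.1 :=
            h4.hasFDerivAt.comp q.1 h2.hasFDerivAt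
          rw [fderiv_comp_fst (h := fun x => c (firstCoords hl (E.Φx x))) h5,
            ContinuousLinearMap.comp_apply, h6.fderiv,
            ContinuousLinearMap.comp_apply]
          refine fderiv_comp_firstCoords_eq_zero hl h4 fun r hr => ?_
          have h7 := hξ ⟨r, hr⟩
          rw [fderiv_comp_fst ((hz.smooth q hq _).differentiableAt (by simp))] at h7
          have h8 : fderiv ℝ (fun x => E.Φx x r) q.1 ξ.1 = 0 := h7
          rw [fderiv_apply h2] at h8
          exact h8
        refine (Submodule.span_le.2 ?_ : Submodule.span ℝ _ ≤ _) h6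
        rintro _ ⟨r, rfl⟩
        exact coord_mem_frameSpan _ r.2
      obtain ⟨ha1, ha2⟩ := hcd _ ha
      obtain ⟨hb1, hb2⟩ := hcd _ hb
      have hbd : DifferentiableAt ℝ (fun q : Jet n N => b (i + 1) (firstCoords hl (E.Φx q.1))) q :=
        hb1.comp q differentiableAt_fst
      have had : DifferentiableAt ℝ (fun q : Jet n N => a (i + 1) (firstCoords hl (E.Φx q.1))) q :=
        ha1.comp q differentiableAt_fst
      have hod : DifferentiableAt ℝ (outDeriv F N φ 0 (k 0 + 0)) q :=
        (hRW.contDiffAt_out hq _ _).differentiableAt (by simp)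
      rw [(had.hasFDerivAt.fun_add (hbd.hasFDerivAt.fun_mul hod.hasFDerivAt)).fderiv]
      exact Submodule.add_mem _ ha2 (Submodule.add_mem _ (Submodule.smul_mem _ _
        (out_mem_frameSpan (by omega) (by omega))) (Submodule.smul_mem _ _ hb2))
  have hQ : ∀ l, codistQ F N φ (fun j => k j - 1 + l) =
      fun q => outSpan F N φ (k 0 + l) (k 1 + l) q ⊓ spanDx n N := by
    intro l
    funext q
    rw [codistQ, codistP_eq_outSpan]
    simp only [show k 0 - 1 + l + 1 = k 0 + l by omega, show k 1 - 1 + l + 1 = k 1 + l by omega]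
  have heq : ∀ l ≤ m, ∀ q ∈ W, outSpan F N φ (k 0 + l) (k 1 + l) q =
      frameSpan F N φ k s z 0 (k 0 + k 1 + l) l 0 q := by
    intro l hl q hq
    refine Submodule.eq_of_le_of_finrank_eq (outSpan_le_of_triangular hRW hz hm hmN
      (fun q hq i hi => hev (hφ1 i hi) q hq) (fun q hq i hi => hev (hφ2 i hi) q hq) hdot hl hq) ?_
    rw [hrank q hq.1 l hl, finrank_frameSpan hRW hz hq (by omega) (by omega) (by omega)]
    omega
  rcases le_or_gt l m with hl | hl
  · refine completelyIntegrableNear_of_frameSpan (j := 0) (c := k 0 + k 1 + l) hRW hz hpW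
      (by omega) fun q hq => ?_
    rw [hQ]
    simp only
    rw [heq l hl q hq]
    refine le_antisymm ?_ (le_inf (frameSpan_mono le_rfl (by omega) le_rfl q)
      (frameSpan_zero_le_spanDx hz hq))
    refine (inf_le_inf_left _ (spanDx_le_frameSpan hRW hz hq)).trans
      ((frameSpan_inf_le hRW hz hq _ _ _ _ _ _).trans (frameSpan_mono ?_ ?_ ?_ q)) <;> simp
  · refine completelyIntegrableNear_of_frameSpan (j := 0) (c := n) hRW hz hpW le_rfl fun q hq => ?_
    rw [hQ]
    simp only
    have h1 : frameSpan F N φ k s z 0 n 0 0 q ≤ outSpan F N φ (k 0 + l) (k 1 + l) q := by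
      refine le_trans ?_ (outSpan_mono (a := k 0 + m) (b := k 1 + m) (by omega) (by omega) q)
      rw [heq m le_rfl q hq]
      exact frameSpan_mono (by omega) (by omega) le_rfl q
    exact le_antisymm (inf_le_right.trans (spanDx_le_frameSpan hRW hz hq))
      (le_inf h1 (frameSpan_zero_le_spanDx hz hq))

end TriangularToIntegrable

/-! ### Integrability yields adapted coordinates -/

section AdaptedCoordinates

variable {n N : ℕ} {F : System n} {φ : Fin 2 → (Fin n → ℝ) → ℝ} {k : Fin 2 → ℕ}
  {s : Fin 2 → Fin 2} {X : Set (Fin n → ℝ)} {O : Set (Jet n N)} {p : Jet n N}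

/-- A function on the jet space whose differential is horizontal is, near `p`, a function of the
state, namely its restriction to the slice through `p`. -/
theorem exists_slice {h : Jet n N → ℝ} (hh : ∀ᶠ q in 𝓝 p, ContDiffAt ℝ ∞ h q)
    (hmem : ∀ᶠ q in 𝓝 p, fderiv ℝ h q ∈ spanDx n N) :
    ∀ᶠ q in 𝓝 p, ContDiffAt ℝ ∞ (fun x => h (x, p.2)) q.1 ∧ h q = h (q.1, p.2) := by
  obtain ⟨r, hr, hball⟩ := Metric.eventually_nhds_iff_ball.1 (hh.and hmem)
  filter_upwards [Metric.ball_mem_nhds p hr] with q hq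
  have hq' : (q.1, p.2) ∈ Metric.ball p r := by
    rw [Metric.mem_ball, Prod.dist_eq] at hq ⊢
    simpa [hr] using (le_max_left _ _).trans_lt hq
  refine ⟨(hball _ hq').1.comp q.1 (contDiffAt_id.prodMk contDiffAt_const), ?_⟩
  refine eq_of_fderiv_sub_eq_zero Metric.isOpen_ball (convex_ball p r)
    (fun x hx => ((hball x hx).1.differentiableAt (by simp)).differentiableWithinAt) hq hq'
    fun x hx => ?_
  have h1 := mem_spanDx_iff.1 (hball x hx).2 (p.2 - q.2)
  rwa [show ((q.1, p.2) - q : Jet n N) = (0, p.2 - q.2) from Prod.ext (sub_self _) rfl]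

/-- If `Q_{l+1}` is integrable and of larger rank than `Q_l`, then one of the functions whose
differentials span `Q_{l+1}` is independent of `Q_l`. -/
theorem CompletelyIntegrableNear.exists_notMem {Q : Codistribution (Jet n N)}
    (hQ : CompletelyIntegrableNear Q p) {S : Submodule ℝ (Jet n N →L[ℝ] ℝ)} (hS : ¬ Q p ≤ S) :
    ∃ y : Jet n N → ℝ, (∀ᶠ q in 𝓝 p, ContDiffAt ℝ ∞ y q ∧ fderiv ℝ y q ∈ Q q) ∧
      fderiv ℝ y p ∉ S := by
  obtain ⟨W, r, h, hW, hpW, hsm, hbas⟩ := hQ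
  by_contra! hcon
  refine hS ?_
  rw [(hbas p hpW).2]
  refine Submodule.span_le.2 ?_
  rintro _ ⟨i, rfl⟩
  refine hcon (h i) ?_
  filter_upwards [hW.mem_nhds hpW] with q hq
  refine ⟨(hsm i).contDiffAt (hW.mem_nhds hq), ?_⟩
  rw [(hbas q hq).2]
  exact Submodule.subset_span ⟨i, rfl⟩

/-- Coordinates adapted to the codistributions `Q_l`: the first `k₁ + k₂` of them are the output
derivatives that depend on the state only, and the following ones successively complete a basis of
exact differentials of `Q_1, Q_2, …`. -/
theorem exists_adapted_coords (hR : RegularOn F φ k s X O) (hp : p ∈ O) {m : ℕ}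
    (hm : k 0 + k 1 + m = n) (hmN : m ≤ N)
    (hrank : ∀ q ∈ O, ∀ l ≤ m,
      Module.finrank ℝ (outSpan F N φ (k 0 + l) (k 1 + l) q) = k 0 + k 1 + 2 * l)
    (hQrank : ∀ q ∈ O, ∀ l ≤ m, Module.finrank ℝ
      (outSpan F N φ (k 0 + l) (k 1 + l) q ⊓ spanDx n N : Submodule ℝ _) = k 0 + k 1 + l)
    (hint : ∀ l ≤ m, CompletelyIntegrableNear
      (fun q => outSpan F N φ (k 0 + l) (k 1 + l) q ⊓ spanDx n N) p) :
    ∃ z : Fin n → (Fin n → ℝ) → ℝ, ∃ r > 0, Metric.ball p r ⊆ O ∧ CoordsOn z (Metric.ball p r) ∧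
      (∀ q ∈ Metric.ball p r, ∀ i (hi : i < k 0), outDeriv F N φ 0 i q = z ⟨i, by omega⟩ q.1) ∧
      (∀ q ∈ Metric.ball p r, ∀ i (hi : i < k 1),
        outDeriv F N φ 1 i q = z ⟨k 0 + i, by omega⟩ q.1) ∧
      ∀ q ∈ Metric.ball p r, ∀ l ≤ m, outSpan F N φ (k 0 + l) (k 1 + l) q =
        frameSpan F N φ k s z 0 (k 0 + k 1 + l) l 0 q := by
  have hchoice : ∀ l, ∃ y : Jet n N → ℝ, l < m →
      (∀ᶠ q in 𝓝 p, ContDiffAt ℝ ∞ y q ∧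
        fderiv ℝ y q ∈ outSpan F N φ (k 0 + (l + 1)) (k 1 + (l + 1)) q ⊓ spanDx n N) ∧
      fderiv ℝ y p ∉ outSpan F N φ (k 0 + l) (k 1 + l) p ⊓ spanDx n N := by
    intro l
    by_cases hl : l < m
    · obtain ⟨y, hy⟩ := (hint (l + 1) hl).exists_notMem
        (S := outSpan F N φ (k 0 + l) (k 1 + l) p ⊓ spanDx n N) (fun hle => by
          have := Submodule.finrank_mono hle
          rw [hQrank p hp l hl.le, hQrank p hp (l + 1) hl] at this
          omega)
      exact ⟨y, fun _ => hy⟩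
    · exact ⟨0, fun h => absurd h hl⟩
  choose y hy using hchoice
  set H : ℕ → Jet n N → ℝ := fun i => if i < k 0 then outDeriv F N φ 0 i else
    if i < k 0 + k 1 then outDeriv F N φ 1 (i - k 0) else y (i - (k 0 + k 1)) with hH
  have H0 : ∀ i < k 0, H i = outDeriv F N φ 0 i := fun i hi => by simp only [hH, if_pos hi]
  have H1 : ∀ i < k 1, H (k 0 + i) = outDeriv F N φ 1 i := fun i hi => by
    simp only [hH]
    rw [if_neg (by omega), if_pos (by omega), Nat.add_sub_cancel_left]
  have H2 : ∀ l, H (k 0 + k 1 + l) = y l := fun l => by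
    simp only [hH]
    rw [if_neg (by omega), if_neg (by omega), Nat.add_sub_cancel_left]
  have hcases : ∀ i, (i < k 0) ∨ (∃ i' < k 1, i = k 0 + i') ∨ ∃ l, i = k 0 + k 1 + l := by
    intro i
    rcases lt_or_ge i (k 0) with h | h
    · exact Or.inl h
    rcases lt_or_ge i (k 0 + k 1) with h' | h'
    · exact Or.inr (Or.inl ⟨i - k 0, by omega, by omega⟩)
    · exact Or.inr (Or.inr ⟨i - (k 0 + k 1), by omega⟩)
  have hprop : ∀ᶠ q in 𝓝 p, ∀ i : Fin n, ContDiffAt ℝ ∞ (H i) q ∧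
      fderiv ℝ (H i) q ∈ spanDx n N ∧
      ∀ l, (i : ℕ) < k 0 + k 1 + l → fderiv ℝ (H i) q ∈ outSpan F N φ (k 0 + l) (k 1 + l) q := by
    refine eventually_all.2 fun i => ?_
    rcases hcases i with h | ⟨i', h, hi⟩ | ⟨l, hi⟩
    · filter_upwards [hR.isOpen.mem_nhds hp] with q hq
      rw [H0 i h]
      exact ⟨hR.contDiffAt_out hq _ _, hR.horizontal _ _ h q hq,
        fun l _ => mem_outSpan_zero (by omega) q⟩
    · filter_upwards [hR.isOpen.mem_nhds hp] with q hq
      rw [hi, H1 i' h]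
      exact ⟨hR.contDiffAt_out hq _ _, hR.horizontal _ _ h q hq,
        fun l _ => mem_outSpan_one (by omega) q⟩
    · filter_upwards [(hy l (by have := i.2; omega)).1] with q hq
      rw [hi, H2 l]
      exact ⟨hq.1, hq.2.2, fun l' hl' => outSpan_mono (by omega) (by omega) q hq.2.1⟩
  -- at `p` the differentials of the first `k₁ + k₂ + l` functions span `Q_l`
  have hspan : ∀ l ≤ m, outSpan F N φ (k 0 + l) (k 1 + l) p ⊓ spanDx n N ≤
      Submodule.span ℝ {η | ∃ i < k 0 + k 1 + l, η = fderiv ℝ (H i) p} := by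
    intro l
    induction l with
    | zero =>
      intro _
      refine inf_le_left.trans (outSpan_le (fun i hi => Submodule.subset_span ⟨i, by omega, ?_⟩)
        fun i hi => Submodule.subset_span ⟨k 0 + i, by omega, ?_⟩)
      · rw [H0 i (by omega)]
      · rw [H1 i (by omega)]
    | succ l ih =>
      intro hl
      set S : Submodule ℝ (Jet n N →L[ℝ] ℝ) :=
        outSpan F N φ (k 0 + l) (k 1 + l) p ⊓ spanDx n N with hS
      have h1 := (hy l (by omega)).1.self_of_nhds.2
      have h2 := (hy l (by omega)).2
      have h3 : S ⊔ Submodule.span ℝ {fderiv ℝ (y l) p} =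
          outSpan F N φ (k 0 + (l + 1)) (k 1 + (l + 1)) p ⊓ spanDx n N := by
        refine Submodule.eq_of_le_of_finrank_le (sup_le (inf_le_inf_right _
          (outSpan_mono (by omega) (by omega) p)) (by simpa using h1)) ?_
        have h4 := finrank_lt_of_mem_of_notMem (S := S)
          (T := S ⊔ Submodule.span ℝ {fderiv ℝ (y l) p}) le_sup_left
          (Submodule.mem_sup_right (Submodule.mem_span_singleton_self _)) h2
        rw [hQrank p hp l (by omega)] at h4
        rw [hQrank p hp (l + 1) hl]
        omega
      rw [← h3]
      refine sup_le ((ih (by omega)).trans (Submodule.span_mono ?_)) ?_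
      · rintro _ ⟨i, hi, rfl⟩
        exact ⟨i, by omega, rfl⟩
      · rw [Submodule.span_singleton_le_iff_mem]
        exact Submodule.subset_span ⟨k 0 + k 1 + l, by omega, by rw [H2]⟩
  have hspan' : spanDx n N ≤
      Submodule.span ℝ (range fun i : Fin n => fderiv ℝ (H i) p) := by
    have h1 : outSpan F N φ (k 0 + m) (k 1 + m) p ⊓ spanDx n N = spanDx n N :=
      Submodule.eq_of_le_of_finrank_eq inf_le_right
        (by rw [hQrank p hp m le_rfl, finrank_spanDx hR hp, hm])
    rw [← h1]
    refine (hspan m le_rfl).trans (Submodule.span_mono ?_)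
    rintro _ ⟨i, hi, rfl⟩
    exact ⟨⟨i, by omega⟩, rfl⟩
  have hli : LinearIndependent ℝ fun i : Fin n => fderiv ℝ (H i) p := by
    rw [linearIndependent_iff_card_le_finrank_span, Fintype.card_fin]
    exact (finrank_spanDx hR hp).ge.trans (Submodule.finrank_mono hspan')
  set z : Fin n → (Fin n → ℝ) → ℝ := fun i x => H i (x, p.2) with hzdef
  have hslice : ∀ᶠ q in 𝓝 p, ∀ i : Fin n, ContDiffAt ℝ ∞ (z i) q.1 ∧ H i q = z i q.1 :=
    eventually_all.2 fun i => exists_slice (hprop.mono fun q hq => (hq i).1)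
      (hprop.mono fun q hq => (hq i).2.1)
  have hlin : ∀ᶠ q in 𝓝 p, LinearIndependent ℝ fun i : Fin n => fderiv ℝ (H i) q :=
    eventually_linearIndependent (w := fun (i : Fin n) q => fderiv ℝ (H i) q) (fun i =>
      (((hprop.self_of_nhds i).1).fderiv_right (m := 0) (by norm_cast)).continuousAt) hli
  obtain ⟨r, hr, hball⟩ := Metric.eventually_nhds_iff_ball.1
    ((hslice.and hprop).and (hlin.and (hR.isOpen.eventually_mem hp)))
  have hd : ∀ q ∈ Metric.ball p r, ∀ i : Fin n,
      fderiv ℝ (fun q : Jet n N => z i q.1) q = fderiv ℝ (H i) q := by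
    intro q hq i
    refine Filter.EventuallyEq.fderiv_eq ?_
    filter_upwards [Metric.isOpen_ball.mem_nhds hq] with x hx
    exact ((hball x hx).1.1 i).2.symm
  have hz : CoordsOn z (Metric.ball p r) := by
    refine ⟨fun q hq i => ((hball q hq).1.1 i).1, fun q hq ξ hξ => ?_⟩
    obtain ⟨⟨hsl, hpr⟩, hlq, hqO⟩ := hball q hq
    have h1 : Submodule.span ℝ (range fun i : Fin n => fderiv ℝ (H i) q) = spanDx n N := by
      refine Submodule.eq_of_le_of_finrank_eq (Submodule.span_le.2 ?_) ?_
      · rintro _ ⟨i, rfl⟩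
        exact (hpr i).2.1
      · rw [finrank_span_eq_card hlq, Fintype.card_fin, finrank_spanDx hR hp]
    have h2 : ∀ η ∈ spanDx n N, η (ξ, 0) = 0 := by
      intro η hη
      rw [← h1] at hη
      induction hη using Submodule.span_induction with
      | mem x hx =>
        obtain ⟨i, rfl⟩ := hx
        simp only
        rw [← hd q hq i, fderiv_comp_fst ((hsl i).1.differentiableAt (by simp))]
        exact hξ i
      | zero => rfl
      | add x y _ _ hx hy => rw [add_apply, hx, hy, add_zero]
      | smul c x _ hx => rw [smul_apply, hx, smul_zero]
    funext i
    exact h2 _ (Submodule.subset_span ⟨i, rfl⟩)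
  have hRb : RegularOn F φ k s X (Metric.ball p r) :=
    hR.mono Metric.isOpen_ball fun q hq => (hball q hq).2.2
  refine ⟨z, r, hr, fun q hq => (hball q hq).2.2, hz, fun q hq i hi => ?_, fun q hq i hi => ?_,
    fun q hq l hl => ?_⟩
  · rw [← ((hball q hq).1.1 ⟨i, by omega⟩).2, H0 i hi]
  · rw [← ((hball q hq).1.1 ⟨k 0 + i, by omega⟩).2, H1 i hi]
  · refine (Submodule.eq_of_le_of_finrank_eq (frameSpan_le (fun i hi => ?_) (fun i hi _ =>
      mem_outSpan_zero (by omega) q) (by simp)) ?_).symm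
    · rw [hd q hq i]
      exact ((hball q hq).1.2 i).2.2 l hi
    · rw [hrank q (hball q hq).2.2 l hl, finrank_frameSpan hRb hz hq (by omega) (by omega)
        (by omega)]
      omega

/-- The chain structure of adapted coordinates: the derivative of each coordinate but the last
involves only the next coordinate and `φ¹_[k₁]`, and, beyond the outputs, genuinely so. -/
theorem fderiv_timeDeriv_coord_of_outSpan_eq (hR : RegularOn F φ k s X O)
    {z : Fin n → (Fin n → ℝ) → ℝ} (hz : CoordsOn z O) {m : ℕ}
    (hm : k 0 + k 1 + m = n) (hmN : m ≤ N)
    (hrank : ∀ q ∈ O, ∀ l ≤ m + 1,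
      Module.finrank ℝ (outSpan F N φ (k 0 + l) (k 1 + l) q) = k 0 + k 1 + 2 * l)
    (h1 : ∀ q ∈ O, ∀ i (hi : i < k 0), outDeriv F N φ 0 i q = z ⟨i, by omega⟩ q.1)
    (h2 : ∀ q ∈ O, ∀ i (hi : i < k 1), outDeriv F N φ 1 i q = z ⟨k 0 + i, by omega⟩ q.1)
    (heq : ∀ q ∈ O, ∀ l ≤ m, outSpan F N φ (k 0 + l) (k 1 + l) q =
        frameSpan F N φ k s z 0 (k 0 + k 1 + l) l 0 q) :
    (∀ q ∈ O, ∀ i : Fin n, (i : ℕ) + 1 < n →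
      fderiv ℝ (timeDeriv F N fun q => z i q.1) q ∈ frameSpan F N φ k s z 0 (i + 2) 1 0 q) ∧
    ∀ q ∈ O, ∀ l ≤ m, ∀ i : Fin n, (i : ℕ) + 1 = k 0 + k 1 + l →
      fderiv ℝ (timeDeriv F N fun q => z i q.1) q ∉
        frameSpan F N φ k s z 0 (k 0 + k 1 + l) (l + 1) 0 q := by
  have hk0 := hR.one_le 0
  have hk1 := hR.one_le 1
  obtain ⟨b, hb⟩ : ∃ b, k 1 = b + 1 := ⟨k 1 - 1, by omega⟩
  have hev : ∀ {h h' : Jet n N → ℝ}, (∀ q ∈ O, h q = h' q) → ∀ q ∈ O,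
      fderiv ℝ h q = fderiv ℝ h' q := fun hh q hq => Filter.EventuallyEq.fderiv_eq
    (by filter_upwards [hR.isOpen.mem_nhds hq] with x hx using hh x hx)
  have hT : ∀ {h h' : Jet n N → ℝ}, (∀ q ∈ O, h q = h' q) → ∀ q ∈ O,
      timeDeriv F N h q = timeDeriv F N h' q := fun hh q hq => by
    simp only [timeDeriv, hev hh q hq]
  -- the coordinates below the last output derivative
  have hlow : ∀ q ∈ O, ∀ i : Fin n, (i : ℕ) + 1 < k 0 + k 1 →
      fderiv ℝ (timeDeriv F N fun q => z i q.1) q ∈ frameSpan F N φ k s z 0 (i + 2) 1 0 q := by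
    intro q hq i hi
    rcases lt_or_ge (i : ℕ) (k 0) with h | h
    · have h3 : ∀ q ∈ O, timeDeriv F N (fun q => z i q.1) q = outDeriv F N φ 0 (i + 1) q :=
        fun q hq => by rw [← hT (fun q hq => h1 q hq i h) q hq, outDeriv_succ]
      rw [hev h3 q hq]
      rcases Nat.lt_or_ge ((i : ℕ) + 1) (k 0) with h' | h'
      · rw [hev (fun q hq => h1 q hq (i + 1) h') q hq]
        exact coord_mem_frameSpan _ (by simp)
      · rw [show (i : ℕ) + 1 = k 0 + 0 by omega]
        exact out_mem_frameSpan (by omega) (by omega)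
    · obtain ⟨i', hi'⟩ := Nat.exists_eq_add_of_le h
      have hi0 : i = ⟨k 0 + i', by omega⟩ := Fin.ext hi'
      have h3 : ∀ q ∈ O, timeDeriv F N (fun q => z i q.1) q = outDeriv F N φ 1 (i' + 1) q :=
        fun q hq => by
          rw [hi0, ← hT (fun q hq => h2 q hq i' (by omega)) q hq, outDeriv_succ]
      rw [hev h3 q hq, hev (fun q hq => h2 q hq (i' + 1) (by omega)) q hq]
      exact coord_mem_frameSpan _ (by simp; omega)
  have key : ∀ l ≤ m, ∀ q ∈ O, ∀ i : Fin n, (i : ℕ) + 1 = k 0 + k 1 + l →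
      (fderiv ℝ (timeDeriv F N fun q => z i q.1) q ∉
        frameSpan F N φ k s z 0 (k 0 + k 1 + l) (l + 1) 0 q) ∧
      (l < m → fderiv ℝ (timeDeriv F N fun q => z i q.1) q ∈
        frameSpan F N φ k s z 0 (i + 2) 1 0 q) := by
    intro l
    induction l using Nat.strong_induction_on with
    | _ l ih =>
    intro hl q hq i hi
    have hprev : ∀ i' : Fin n, (i' : ℕ) < i →
        fderiv ℝ (timeDeriv F N fun q => z i' q.1) q ∈ frameSpan F N φ k s z 0 (i' + 2) 1 0 q := by
      intro i' hi'
      rcases Nat.lt_or_ge ((i' : ℕ) + 1) (k 0 + k 1) with h | h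
      · exact hlow q hq i' h
      · exact (ih (i' + 1 - (k 0 + k 1)) (by omega) (by omega) q hq i' (by omega)).2 (by omega)
    set B := frameSpan F N φ k s z 0 (k 0 + k 1 + l) (l + 1) 0 q with hB
    have hmem : ∀ᶠ x in 𝓝 q, fderiv ℝ (outDeriv F N φ 1 (b + l)) x ∈
        frameSpan F N φ k s z 0 (k 0 + k 1 + l) l 0 x := by
      filter_upwards [hR.isOpen.mem_nhds hq] with x hx
      rw [← heq x hx l hl]
      exact mem_outSpan_one (by omega) x
    have hi₀ : (Sum.inl i : Fin n ⊕ (Fin (N + 1) ⊕ Fin (N + 1))) ∈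
        frameIndex n N (k 0 + k 1 + l) l 0 := by
      simp [frameIndex]; omega
    have hB' : ∀ r ∈ frameIndex n N (k 0 + k 1 + l) l 0, r ≠ Sum.inl i →
        fderiv ℝ (timeDeriv F N (frameFun F N φ k s z 0 r)) q ∈ B := by
      rintro (r | r | r) hr hne
      · have hr' : (r : ℕ) < k 0 + k 1 + l := by simpa [frameIndex] using hr
        have hne' : (r : ℕ) ≠ i := fun h => hne (by rw [Fin.ext h])
        exact frameSpan_mono (by omega) (by omega) le_rfl q (hprev r (by omega))
      · have hr' : (r : ℕ) < l := by simpa [frameIndex] using hr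
        have h3 : timeDeriv F N (frameFun F N φ k s z 0 (Sum.inr (Sum.inl r))) =
          outDeriv F N φ 0 (k 0 + (r + 1)) := (outDeriv_succ F φ 0 (k 0 + r)).symm
        rw [h3]
        exact out_mem_frameSpan (by omega) (by omega)
      · simp [frameIndex] at hr
    -- differentiating this relation: modulo `B`, `dφ²_[k₂+l]` is a multiple of `dż^i`
    obtain ⟨r, -, hr⟩ := exists_leading_coeff_frame (A := ⊤) hR hz hq
      (hR.contDiffAt_out hq 1 (b + l)) hmem hi₀ (fun _ _ _ => Submodule.mem_top)
      (frameSpan_mono le_rfl (by omega) le_rfl q) hB'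
    rw [← outDeriv_succ, show b + l + 1 = k 1 + l by omega] at hr
    have hr' : fderiv ℝ (outDeriv F N φ 1 (k 1 + l)) q -
      r • fderiv ℝ (timeDeriv F N fun q => z i q.1) q ∈ B := hr
    have hBle : B ≤ outSpan F N φ (k 0 + l + 1) (k 1 + l) q := by
      refine frameSpan_le (fun i hi => ?_) (fun i hi _ => mem_outSpan_zero (by omega) q) (by simp)
      refine outSpan_mono (a := k 0 + l) (by omega) le_rfl q ?_
      rw [heq q hq l hl]
      exact coord_mem_frameSpan i hi
    have hnot : fderiv ℝ (outDeriv F N φ 1 (k 1 + l)) q ∉ B := by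
      intro hcon
      have h3 : outSpan F N φ (k 0 + l + 1) (k 1 + l + 1) q =
          outSpan F N φ (k 0 + l + 1) (k 1 + l) q := by
        rw [outSpan_succ_one, sup_eq_left, Submodule.span_singleton_le_iff_mem]
        exact hBle hcon
      have h4 := hrank q hq (l + 1) (by omega)
      have h5 := finrank_outSpan_le (F := F) (φ := φ) (k 0 + l + 1) (k 1 + l) q
      rw [← h3] at h5
      rw [← add_assoc, ← add_assoc] at h4
      omega
    refine ⟨fun hcon => hnot ?_, fun hlm => ?_⟩
    · have := Submodule.add_mem _ hr' (Submodule.smul_mem _ r hcon)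
      rwa [sub_add_cancel] at this
    · have hr0 : r ≠ 0 := by
        rintro rfl
        rw [zero_smul, sub_zero] at hr'
        exact hnot hr'
      have h3 : fderiv ℝ (outDeriv F N φ 1 (k 1 + l)) q ∈
          frameSpan F N φ k s z 0 (k 0 + k 1 + (l + 1)) (l + 1) 0 q := by
        rw [← heq q hq (l + 1) (by omega)]
        exact mem_outSpan_one (by omega) q
      have h4 := Submodule.sub_mem _ h3
        (frameSpan_mono (c' := k 0 + k 1 + (l + 1)) (by omega) le_rfl le_rfl q hr')
      rw [sub_sub_cancel] at h4
      have h5 := (Submodule.smul_mem_iff _ hr0).1 h4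
      have h6 := spanDxDu_le_frameSpan (j := 0) hR hz hq 1 (fderiv_timeDeriv_coord_mem hR hz hq i)
      refine frameSpan_mono ?_ ?_ ?_ q (frameSpan_inf_le hR hz hq _ _ _ _ _ _ ⟨h5, h6⟩)
      · omega
      · omega
      · omega
  refine ⟨fun q hq i hi => ?_, fun q hq l hl i hi => (key l hl q hq i hi).1⟩
  rcases Nat.lt_or_ge ((i : ℕ) + 1) (k 0 + k 1) with h | h
  · exact hlow q hq i h
  · exact (key (i + 1 - (k 0 + k 1)) (by omega) q hq i (by omega)).2 (by omega)

end AdaptedCoordinates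

/-! ### Affine dependence on the inputs -/

section Affine

variable {n N : ℕ} {f : (Fin n → ℝ) → (Fin n → ℝ)} {g : Fin 2 → (Fin n → ℝ) → (Fin n → ℝ)}
  {φ : Fin 2 → (Fin n → ℝ) → ℝ} {k : Fin 2 → ℕ} {s : Fin 2 → Fin 2} {X : Set (Fin n → ℝ)}

theorem contDiffOn_affineSystem (hf : ContDiffOn ℝ ∞ f X) (hg : ∀ j, ContDiffOn ℝ ∞ (g j) X) :
    ContDiffOn ℝ ∞ (fun y : (Fin n → ℝ) × (Fin 2 → ℝ) => affineSystem f g y.1 y.2)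
      (X ×ˢ univ) := by
  have h1 : MapsTo (Prod.fst : (Fin n → ℝ) × (Fin 2 → ℝ) → _) (X ×ˢ univ) X := fun y hy => hy.1
  have h2 : ∀ t, ContDiffOn ℝ ∞ (fun y : (Fin n → ℝ) × (Fin 2 → ℝ) => y.2 t) (X ×ˢ univ) :=
    fun t => ContDiff.contDiffOn (by fun_prop)
  exact ((hf.comp contDiffOn_fst h1).add ((h2 0).smul ((hg 0).comp contDiffOn_fst h1))).add
    ((h2 1).smul ((hg 1).comp contDiffOn_fst h1))

theorem hasFDerivAt_affineSystem_input (x : Fin n → ℝ) (u : Fin 2 → ℝ) :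
    HasFDerivAt (affineSystem f g x)
      ((ContinuousLinearMap.proj (R := ℝ) (φ := fun _ : Fin 2 => ℝ) 0).smulRight (g 0 x) +
        (ContinuousLinearMap.proj (R := ℝ) (φ := fun _ : Fin 2 => ℝ) 1).smulRight (g 1 x)) u := by
  have h : ∀ t, HasFDerivAt (fun u : Fin 2 → ℝ => u t • g t x)
      ((ContinuousLinearMap.proj (R := ℝ) (φ := fun _ : Fin 2 => ℝ) t).smulRight (g t x)) u :=
    fun t => ((ContinuousLinearMap.proj (R := ℝ) (φ := fun _ : Fin 2 => ℝ) t).smulRight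
      (g t x)).hasFDerivAt
  have h1 := ((hasFDerivAt_const (f x) u).fun_add (h 0)).fun_add (h 1)
  rw [zero_add] at h1
  exact h1

/-- The Lie derivative of a function of the state along a vector field on the state space. -/
noncomputable def stateLie (v : (Fin n → ℝ) → (Fin n → ℝ)) (h : (Fin n → ℝ) → ℝ) :
    (Fin n → ℝ) → ℝ :=
  fun x => fderiv ℝ h x (v x)

theorem contDiffAt_stateLie {v : (Fin n → ℝ) → (Fin n → ℝ)} {h : (Fin n → ℝ) → ℝ}
    {x : Fin n → ℝ} (hv : ContDiffAt ℝ ∞ v x) (hh : ContDiffAt ℝ ∞ h x) :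
    ContDiffAt ℝ ∞ (stateLie v h) x :=
  (hh.fderiv_right (m := ∞) (by norm_cast)).clm_apply hv

theorem fderiv_apply_affineSystem (h : (Fin n → ℝ) → ℝ) (x : Fin n → ℝ) (u : Fin 2 → ℝ) :
    fderiv ℝ h x (affineSystem f g x u) =
      stateLie f h x + u 0 * stateLie (g 0) h x + u 1 * stateLie (g 1) h x := by
  simp [affineSystem, stateLie]

theorem timeDeriv_coord {h : (Fin n → ℝ) → ℝ} {q : Jet n N} (hh : DifferentiableAt ℝ h q.1) :
    timeDeriv (affineSystem f g) N (fun q => h q.1) q =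
      stateLie f h q.1 + q.2 0 0 * stateLie (g 0) h q.1 + q.2 0 1 * stateLie (g 1) h q.1 := by
  rw [timeDeriv, fderiv_comp_fst hh]
  exact fderiv_apply_affineSystem h _ _

/-- The derivative of a function of the state is affine in `u`, with the Lie derivatives along the
input fields as its slopes, and does not involve `u_[1], u_[2], …`. -/
theorem fderiv_timeDeriv_coord_vertical (hX : IsOpen X) (hf : ContDiffOn ℝ ∞ f X)
    (hg : ∀ j, ContDiffOn ℝ ∞ (g j) X) {h : (Fin n → ℝ) → ℝ} {q : Jet n N} (hq : q.1 ∈ X)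
    (hh : ContDiffAt ℝ ∞ h q.1) (ζ : Fin (N + 1) → Fin 2 → ℝ) :
    fderiv ℝ (timeDeriv (affineSystem f g) N fun q => h q.1) q (0, ζ) =
      ζ 0 0 * stateLie (g 0) h q.1 + ζ 0 1 * stateLie (g 1) h q.1 := by
  have hF := contDiffOn_affineSystem hf hg
  have hdF : DifferentiableAt ℝ (fun y : (Fin n → ℝ) × (Fin 2 → ℝ) => affineSystem f g y.1 y.2)
      (q.1, q.2 0) :=
    (hF.contDiffAt ((hX.prod isOpen_univ).mem_nhds ⟨hq, mem_univ _⟩)).differentiableAt (by simp)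
  have h1 : ∀ᶠ x in 𝓝 q, fderiv ℝ (fun q : Jet n N => h q.1) x ∈ spanDxDu n N 0 := by
    have h2 : ∀ᶠ x in 𝓝 q.1, DifferentiableAt ℝ h x :=
      ((hh.of_le (m := 1) (by norm_cast)).eventually (by simp)).mono
        fun x hx => hx.differentiableAt (by simp)
    filter_upwards [continuousAt_fst.eventually h2] with x hx
    rw [spanDxDu_zero]
    exact fderiv_comp_fst_mem_spanDx hx
  have h2 : ContDiffAt ℝ ∞ (fun q : Jet n N => h q.1) q := hh.comp q contDiffAt_fst
  rw [fderiv_timeDeriv_vertical hX hF hq h2 h1 (by simp),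
    fderiv_comp_fst (hh.differentiableAt (by simp)), ContinuousLinearMap.comp_apply]
  have h3 : HasFDerivAt (affineSystem f g q.1) _ (q.2 0) :=
    hdF.hasFDerivAt.comp (q.2 0) (hasFDerivAt_prodMk_right q.1 (q.2 0))
  have h4 := congrArg (fun L : (Fin 2 → ℝ) →L[ℝ] (Fin n → ℝ) => L (ζ 0))
    (h3.unique (hasFDerivAt_affineSystem_input q.1 (q.2 0)))
  simp only [ContinuousLinearMap.comp_apply, ContinuousLinearMap.inr_apply] at h4
  rw [h4]
  simp [stateLie]

end Affine

/-! ### Covectors modulo the differential of the first input -/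

section Decoupling

variable {n N : ℕ} {F : System n} {φ : Fin 2 → (Fin n → ℝ) → ℝ} {k : Fin 2 → ℕ}
  {s : Fin 2 → Fin 2} {X : Set (Fin n → ℝ)} {O : Set (Jet n N)}
  {z : Fin n → (Fin n → ℝ) → ℝ} {j : Fin 2}

/-- A covector in the span of `dz¹, …, dz^c` and `dφʲ_[kⱼ]` lies in the span of the former up to a
multiple of the latter. -/
theorem exists_sub_smul_mem_frameSpan {c : ℕ} {q : Jet n N} {η : Jet n N →L[ℝ] ℝ}
    (hη : η ∈ frameSpan F N φ k s z j c 1 0 q) :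
    ∃ r : ℝ, η - r • fderiv ℝ (outDeriv F N φ j (k j)) q ∈ frameSpan F N φ k s z j c 0 0 q := by
  have h1 : frameSpan F N φ k s z j c 1 0 q ≤ frameSpan F N φ k s z j c 0 0 q ⊔
      Submodule.span ℝ {fderiv ℝ (outDeriv F N φ j (k j)) q} := by
    refine frameSpan_le (fun i hi => Submodule.mem_sup_left (coord_mem_frameSpan i hi))
      (fun i hi _ => Submodule.mem_sup_right ?_) (by simp)
    obtain rfl : i = 0 := by omega
    exact Submodule.mem_span_singleton_self _
  obtain ⟨a, ha, b, hb, rfl⟩ := Submodule.mem_sup.1 (h1 hη)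
  obtain ⟨r, rfl⟩ := Submodule.mem_span_singleton.1 hb
  exact ⟨r, by simpa using ha⟩

/-- Combinations of `dz¹, …, dz^c` vanish on the vectors along which these coordinates are
constant. -/
theorem apply_eq_zero_of_mem_frameSpan (hz : CoordsOn z O) {c : ℕ} {q : Jet n N} (hq : q ∈ O)
    {η : Jet n N →L[ℝ] ℝ} (hη : η ∈ frameSpan F N φ k s z j c 0 0 q) {ξ : Jet n N}
    (hξ : ∀ i : Fin n, (i : ℕ) < c → fderiv ℝ (z i) q.1 ξ.1 = 0) : η ξ = 0 := by
  have h1 : frameSpan F N φ k s z j c 0 0 q ≤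
      LinearMap.ker (ContinuousLinearMap.apply ℝ ℝ ξ).toLinearMap := by
    refine frameSpan_le (fun i hi => ?_) (by simp) (by simp)
    rw [fderiv_comp_fst ((hz.smooth q hq i).differentiableAt (by simp))]
    exact hξ i hi
  exact h1 hη

/-- A function of the state whose differential vanishes wherever `dz¹, …, dz^c` do is, on the level
of differentials, a function of these coordinates. -/
theorem fderiv_comp_fst_mem_frameSpan (hz : CoordsOn z O) {c d e : ℕ} {q : Jet n N} (hq : q ∈ O)
    {h : (Fin n → ℝ) → ℝ} (hh : DifferentiableAt ℝ h q.1)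
    (hker : ∀ ξ, (∀ i : Fin n, (i : ℕ) < c → fderiv ℝ (z i) q.1 ξ = 0) → fderiv ℝ h q.1 ξ = 0) :
    fderiv ℝ (fun q : Jet n N => h q.1) q ∈ frameSpan F N φ k s z j c d e q := by
  have h1 : fderiv ℝ (fun q : Jet n N => h q.1) q ∈ Submodule.span ℝ
      (range fun i : {i : Fin n // (i : ℕ) < c} => fderiv ℝ (fun q : Jet n N => z i q.1) q) := by
    refine mem_span_of_common_kernel _ _ fun ξ hξ => ?_
    rw [fderiv_comp_fst hh]
    refine hker _ fun i hi => ?_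
    have h2 := hξ ⟨i, hi⟩
    rwa [fderiv_comp_fst ((hz.smooth q hq i).differentiableAt (by simp))] at h2
  refine (Submodule.span_le.2 ?_ : Submodule.span ℝ _ ≤ _) h1
  rintro _ ⟨i, rfl⟩
  exact coord_mem_frameSpan _ i.2

end Decoupling

/-! ### The normal form `ż = a + b v` -/

section Normalization

variable {n N : ℕ} {f : (Fin n → ℝ) → (Fin n → ℝ)} {g : Fin 2 → (Fin n → ℝ) → (Fin n → ℝ)}
  {φ : Fin 2 → (Fin n → ℝ) → ℝ} {k : Fin 2 → ℕ} {s : Fin 2 → Fin 2} {X : Set (Fin n → ℝ)}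
  {p : Jet n N} {r : ℝ} {z : Fin n → (Fin n → ℝ) → ℝ} {j₀ : Fin n}

/-- The coefficient `b` in `ż = a + b v`, where `v` is the derivative of `h₀` and the input
`u^t` enters it regularly. -/
noncomputable def inputCoeff (g : Fin 2 → (Fin n → ℝ) → (Fin n → ℝ)) (t : Fin 2)
    (h₀ h : (Fin n → ℝ) → ℝ) : (Fin n → ℝ) → ℝ :=
  fun x => stateLie (g t) h x / stateLie (g t) h₀ x

/-- The coefficient `a` in `ż = a + b v`, where `v` is the derivative of `h₀` and the input
`u^t` enters it regularly. -/
noncomputable def driftCoeff (f : (Fin n → ℝ) → (Fin n → ℝ))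
    (g : Fin 2 → (Fin n → ℝ) → (Fin n → ℝ)) (t : Fin 2) (h₀ h : (Fin n → ℝ) → ℝ) :
    (Fin n → ℝ) → ℝ :=
  fun x => stateLie f h x - inputCoeff g t h₀ h x * stateLie f h₀ x

theorem mem_ball_jet {x : Fin n → ℝ} (hx : x ∈ Metric.ball p.1 r) : (x, p.2) ∈ Metric.ball p r := by
  rw [Metric.mem_ball, Prod.dist_eq] at *
  simpa [dist_nonneg.trans_lt hx] using hx

theorem fst_mem_ball {q : Jet n N} (hq : q ∈ Metric.ball p r) : q.1 ∈ Metric.ball p.1 r := by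
  rw [Metric.mem_ball, Prod.dist_eq] at *
  exact (le_max_left _ _).trans_lt hq

theorem update_mem_ball {x : Fin n → ℝ} (hx : x ∈ Metric.ball p.1 r) {u : Fin 2 → ℝ}
    (hu : u ∈ Metric.ball (p.2 0) r) : (x, Function.update p.2 0 u) ∈ Metric.ball p r := by
  have hr : 0 < r := dist_nonneg.trans_lt hx
  rw [Metric.mem_ball, Prod.dist_eq]
  refine max_lt hx ((dist_pi_lt_iff hr).2 fun α => ?_)
  rcases eq_or_ne α 0 with rfl | hα
  · simpa using hu
  · simpa [hα] using hr

/-- The situation in which the feedback is read off, on a ball around `p`: coordinates `z`, one of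
which, `z j₀`, has `φ¹_[k₁]` as its derivative. -/
structure AffineFrame (f : (Fin n → ℝ) → (Fin n → ℝ)) (g : Fin 2 → (Fin n → ℝ) → (Fin n → ℝ))
    (φ : Fin 2 → (Fin n → ℝ) → ℝ) (k : Fin 2 → ℕ) (s : Fin 2 → Fin 2) (X : Set (Fin n → ℝ))
    (p : Jet n N) (r : ℝ) (z : Fin n → (Fin n → ℝ) → ℝ) (j₀ : Fin n) : Prop where
  smooth_drift : ContDiffOn ℝ ∞ f X
  smooth_input : ∀ j, ContDiffOn ℝ ∞ (g j) X
  regular : RegularOn (affineSystem f g) φ k s X (Metric.ball p r)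
  coords : CoordsOn z (Metric.ball p r)
  output : ∀ q ∈ Metric.ball p r, outDeriv (affineSystem f g) N φ 0 (k 0) q =
    timeDeriv (affineSystem f g) N (fun q => z j₀ q.1) q

theorem fderiv_eq_of_ball {h h' : Jet n N → ℝ} (hh : ∀ q ∈ Metric.ball p r, h q = h' q)
    {q : Jet n N} (hq : q ∈ Metric.ball p r) : fderiv ℝ h q = fderiv ℝ h' q :=
  Filter.EventuallyEq.fderiv_eq
    (by filter_upwards [Metric.isOpen_ball.mem_nhds hq] with x hx using hh x hx)

namespace AffineFrame

variable (H : AffineFrame f g φ k s X p r z j₀)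
include H

theorem mem_base {x : Fin n → ℝ} (hx : x ∈ Metric.ball p.1 r) : x ∈ X :=
  H.regular.base_mem _ (mem_ball_jet hx)

theorem contDiffAt_coord {x : Fin n → ℝ} (hx : x ∈ Metric.ball p.1 r) (i : Fin n) :
    ContDiffAt ℝ ∞ (z i) x :=
  H.coords.smooth _ (mem_ball_jet hx) i

theorem vertical {q : Jet n N} (hq : q ∈ Metric.ball p r) (i : Fin n)
    (ζ : Fin (N + 1) → Fin 2 → ℝ) :
    fderiv ℝ (timeDeriv (affineSystem f g) N fun q => z i q.1) q (0, ζ) =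
      ζ 0 0 * stateLie (g 0) (z i) q.1 + ζ 0 1 * stateLie (g 1) (z i) q.1 :=
  fderiv_timeDeriv_coord_vertical H.regular.isOpen_base H.smooth_drift H.smooth_input
    (H.regular.base_mem _ hq) (H.coords.smooth _ hq i) ζ

theorem vertical_single {q : Jet n N} (hq : q ∈ Metric.ball p r) (i : Fin n) (t : Fin 2) :
    fderiv ℝ (timeDeriv (affineSystem f g) N fun q => z i q.1) q
      (0, Pi.single 0 (Pi.single t 1)) = stateLie (g t) (z i) q.1 := by
  rw [H.vertical hq]
  fin_cases t <;> simp

theorem stateLie_ne_zero {x : Fin n → ℝ} (hx : x ∈ Metric.ball p.1 r) :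
    stateLie (g (s 0)) (z j₀) x ≠ 0 := by
  have hq := mem_ball_jet hx
  have h1 := H.regular.vertical 0 _ hq
  rwa [fderiv_eq_of_ball H.output hq, H.vertical_single hq] at h1

theorem contDiffAt_stateLie_input {x : Fin n → ℝ} (hx : x ∈ Metric.ball p.1 r) (t : Fin 2)
    (i : Fin n) : ContDiffAt ℝ ∞ (stateLie (g t) (z i)) x :=
  contDiffAt_stateLie ((H.smooth_input t).contDiffAt
    (H.regular.isOpen_base.mem_nhds (H.mem_base hx))) (H.contDiffAt_coord hx i)

theorem contDiffAt_stateLie_drift {x : Fin n → ℝ} (hx : x ∈ Metric.ball p.1 r)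
    (i : Fin n) : ContDiffAt ℝ ∞ (stateLie f (z i)) x :=
  contDiffAt_stateLie (H.smooth_drift.contDiffAt
    (H.regular.isOpen_base.mem_nhds (H.mem_base hx))) (H.contDiffAt_coord hx i)

theorem contDiffAt_inputCoeff {x : Fin n → ℝ} (hx : x ∈ Metric.ball p.1 r) (i : Fin n) :
    ContDiffAt ℝ ∞ (inputCoeff g (s 0) (z j₀) (z i)) x :=
  (H.contDiffAt_stateLie_input hx _ _).div (H.contDiffAt_stateLie_input hx _ _)
    (H.stateLie_ne_zero hx)

theorem contDiffAt_driftCoeff {x : Fin n → ℝ} (hx : x ∈ Metric.ball p.1 r) (i : Fin n) :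
    ContDiffAt ℝ ∞ (driftCoeff f g (s 0) (z j₀) (z i)) x :=
  (H.contDiffAt_stateLie_drift hx _).sub
    ((H.contDiffAt_inputCoeff hx _).mul (H.contDiffAt_stateLie_drift hx _))

/-- Modulo `dz^1, …, dz^c`, the differential of `ż^i` is `b^i dφ¹_[k₁]`. -/
theorem fderiv_sub_smul_mem {i : Fin n} {c : ℕ} {q : Jet n N} (hq : q ∈ Metric.ball p r)
    (hi : fderiv ℝ (timeDeriv (affineSystem f g) N fun q => z i q.1) q ∈
      frameSpan (affineSystem f g) N φ k s z 0 c 1 0 q) :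
    fderiv ℝ (timeDeriv (affineSystem f g) N fun q => z i q.1) q -
      inputCoeff g (s 0) (z j₀) (z i) q.1 •
        fderiv ℝ (timeDeriv (affineSystem f g) N fun q => z j₀ q.1) q ∈
      frameSpan (affineSystem f g) N φ k s z 0 c 0 0 q := by
  obtain ⟨ρ, hρ⟩ := exists_sub_smul_mem_frameSpan hi
  rw [fderiv_eq_of_ball H.output hq] at hρ
  have h1 := mem_spanDx_iff.1 (frameSpan_zero_le_spanDx H.coords hq hρ)
    (Pi.single 0 (Pi.single (s 0) 1))
  rw [sub_apply, smul_apply, H.vertical_single hq, H.vertical_single hq,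
    sub_eq_zero] at h1
  rwa [inputCoeff, h1, smul_eq_mul, mul_div_cancel_right₀ _ (H.stateLie_ne_zero (fst_mem_ball hq))]

theorem stateLie_eq_mul {i : Fin n} {c : ℕ} {x : Fin n → ℝ} (hx : x ∈ Metric.ball p.1 r)
    (hi : fderiv ℝ (timeDeriv (affineSystem f g) N fun q => z i q.1) (x, p.2) ∈
      frameSpan (affineSystem f g) N φ k s z 0 c 1 0 (x, p.2)) (t : Fin 2) :
    stateLie (g t) (z i) x = inputCoeff g (s 0) (z j₀) (z i) x * stateLie (g t) (z j₀) x := by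
  have h1 := mem_spanDx_iff.1 (frameSpan_zero_le_spanDx H.coords (mem_ball_jet hx)
    (H.fderiv_sub_smul_mem (mem_ball_jet hx) hi)) (Pi.single 0 (Pi.single t 1))
  rwa [sub_apply, smul_apply, H.vertical_single (mem_ball_jet hx),
    H.vertical_single (mem_ball_jet hx), sub_eq_zero] at h1

/-- The coordinate `z^i` obeys `ż = a + b v` with `v = φ¹_[k₁]`. -/
theorem timeDeriv_eq {i : Fin n} {c : ℕ} (hi : ∀ q ∈ Metric.ball p r,
      fderiv ℝ (timeDeriv (affineSystem f g) N fun q => z i q.1) q ∈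
      frameSpan (affineSystem f g) N φ k s z 0 c 1 0 q) {q : Jet n N} (hq : q ∈ Metric.ball p r) :
    timeDeriv (affineSystem f g) N (fun q => z i q.1) q =
      driftCoeff f g (s 0) (z j₀) (z i) q.1 + inputCoeff g (s 0) (z j₀) (z i) q.1 *
        timeDeriv (affineSystem f g) N (fun q => z j₀ q.1) q := by
  have hx := fst_mem_ball hq
  rw [timeDeriv_coord ((H.contDiffAt_coord hx i).differentiableAt (by simp)),
    timeDeriv_coord ((H.contDiffAt_coord hx j₀).differentiableAt (by simp)),
    H.stateLie_eq_mul hx (hi _ (mem_ball_jet hx)) 0,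
    H.stateLie_eq_mul hx (hi _ (mem_ball_jet hx)) 1, driftCoeff]
  ring

theorem fderiv_timeDeriv_eq {i : Fin n} {c : ℕ} (hi : ∀ q ∈ Metric.ball p r,
      fderiv ℝ (timeDeriv (affineSystem f g) N fun q => z i q.1) q ∈
      frameSpan (affineSystem f g) N φ k s z 0 c 1 0 q) {q : Jet n N} (hq : q ∈ Metric.ball p r) :
    fderiv ℝ (timeDeriv (affineSystem f g) N fun q => z i q.1) q =
      fderiv ℝ (fun q : Jet n N => driftCoeff f g (s 0) (z j₀) (z i) q.1) q +
        (inputCoeff g (s 0) (z j₀) (z i) q.1 •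
          fderiv ℝ (timeDeriv (affineSystem f g) N fun q => z j₀ q.1) q +
        timeDeriv (affineSystem f g) N (fun q => z j₀ q.1) q •
          fderiv ℝ (fun q : Jet n N => inputCoeff g (s 0) (z j₀) (z i) q.1) q) := by
  have hx := fst_mem_ball hq
  have h1 : DifferentiableAt ℝ (fun q : Jet n N => driftCoeff f g (s 0) (z j₀) (z i) q.1) q :=
    ((H.contDiffAt_driftCoeff hx i).differentiableAt (by simp)).comp q differentiableAt_fst
  have h2 : DifferentiableAt ℝ (fun q : Jet n N => inputCoeff g (s 0) (z j₀) (z i) q.1) q :=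
    ((H.contDiffAt_inputCoeff hx i).differentiableAt (by simp)).comp q differentiableAt_fst
  have h3 : DifferentiableAt ℝ (timeDeriv (affineSystem f g) N fun q => z j₀ q.1) q :=
    (contDiffAt_timeDeriv H.regular.isOpen_base H.regular.smooth_system
      (H.regular.base_mem _ hq) (h := fun q : Jet n N => z j₀ q.1)
      ((H.coords.smooth _ hq j₀).comp q contDiffAt_fst)).differentiableAt (by simp)
  rw [fderiv_eq_of_ball (fun q hq => H.timeDeriv_eq hi hq) hq]
  exact (h1.hasFDerivAt.fun_add (h2.hasFDerivAt.fun_mul h3.hasFDerivAt)).fderiv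

/-- The coefficients `a`, `b` in `ż^i = a + b v` depend on `z^1, …, z^c` only. -/
theorem fderiv_coeff_eq_zero {i : Fin n} {c : ℕ} (hi : ∀ q ∈ Metric.ball p r,
      fderiv ℝ (timeDeriv (affineSystem f g) N fun q => z i q.1) q ∈
      frameSpan (affineSystem f g) N φ k s z 0 c 1 0 q) {x : Fin n → ℝ}
    (hx : x ∈ Metric.ball p.1 r) {η : Fin n → ℝ}
    (hη : ∀ l : Fin n, (l : ℕ) < c → fderiv ℝ (z l) x η = 0) :
    fderiv ℝ (driftCoeff f g (s 0) (z j₀) (z i)) x η = 0 ∧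
      fderiv ℝ (inputCoeff g (s 0) (z j₀) (z i)) x η = 0 := by
  have hr : 0 < r := dist_nonneg.trans_lt hx
  -- the relation `da + v db = 0` along `η` holds for all inputs; two values of `v` separate its
  -- terms
  have key : ∀ u ∈ Metric.ball (p.2 0) r, fderiv ℝ (driftCoeff f g (s 0) (z j₀) (z i)) x η +
      (stateLie f (z j₀) x + u 0 * stateLie (g 0) (z j₀) x + u 1 * stateLie (g 1) (z j₀) x) *
        fderiv ℝ (inputCoeff g (s 0) (z j₀) (z i)) x η = 0 := by
    intro u hu
    have hq := update_mem_ball hx hu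
    have h1 := apply_eq_zero_of_mem_frameSpan H.coords hq
      (H.fderiv_sub_smul_mem hq (hi _ hq)) (ξ := (η, 0)) hη
    rw [H.fderiv_timeDeriv_eq hi hq,
      fderiv_comp_fst ((H.contDiffAt_driftCoeff hx i).differentiableAt (by simp)),
      fderiv_comp_fst ((H.contDiffAt_inputCoeff hx i).differentiableAt (by simp)),
      timeDeriv_coord ((H.contDiffAt_coord hx j₀).differentiableAt (by simp))] at h1
    simp only [add_apply, sub_apply, smul_apply, ContinuousLinearMap.comp_apply,
      ContinuousLinearMap.coe_fst', Function.update_self, smul_eq_mul] at h1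
    linarith
  have h0 := key (p.2 0) (Metric.mem_ball_self hr)
  have h1 := key (p.2 0 + Pi.single (s 0) (r / 2)) (by
    rw [mem_ball_iff_norm, add_sub_cancel_left, Pi.norm_single, Real.norm_eq_abs,
      abs_of_pos (by positivity)]
    linarith)
  have hb : fderiv ℝ (inputCoeff g (s 0) (z j₀) (z i)) x η = 0 := by
    have h2 : r / 2 * stateLie (g (s 0)) (z j₀) x *
        fderiv ℝ (inputCoeff g (s 0) (z j₀) (z i)) x η = 0 := by
      generalize s 0 = t at h0 h1 ⊢
      obtain rfl | rfl : t = 0 ∨ t = 1 := by fin_cases t <;> simp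
      all_goals
        simp only [Pi.add_apply, Pi.single_eq_same, ne_eq, one_ne_zero, zero_ne_one,
          not_false_eq_true, Pi.single_eq_of_ne, add_zero] at h1
        linarith
    exact (mul_eq_zero.1 h2).resolve_left (mul_ne_zero (by positivity) (H.stateLie_ne_zero hx))
  rw [hb, mul_zero, add_zero] at h0
  exact ⟨h0, hb⟩

/-- If the coefficients `a`, `b` in `ż^i = a + b v` depend on `z^1, …, z^d` only, then so does
`ż^i` modulo `v`. -/
theorem fderiv_timeDeriv_mem_of_coeff {i : Fin n} {c d : ℕ} (hi : ∀ q ∈ Metric.ball p r,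
      fderiv ℝ (timeDeriv (affineSystem f g) N fun q => z i q.1) q ∈
      frameSpan (affineSystem f g) N φ k s z 0 c 1 0 q) {x : Fin n → ℝ}
    (hx : x ∈ Metric.ball p.1 r) (ha : ∀ η, (∀ l : Fin n, (l : ℕ) < d → fderiv ℝ (z l) x η = 0) →
      fderiv ℝ (driftCoeff f g (s 0) (z j₀) (z i)) x η = 0)
    (hb : ∀ η, (∀ l : Fin n, (l : ℕ) < d → fderiv ℝ (z l) x η = 0) →
      fderiv ℝ (inputCoeff g (s 0) (z j₀) (z i)) x η = 0) :
    fderiv ℝ (timeDeriv (affineSystem f g) N fun q => z i q.1) (x, p.2) ∈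
      frameSpan (affineSystem f g) N φ k s z 0 d 1 0 (x, p.2) := by
  have hq := mem_ball_jet hx
  rw [H.fderiv_timeDeriv_eq hi hq]
  refine Submodule.add_mem _ (fderiv_comp_fst_mem_frameSpan H.coords hq
    ((H.contDiffAt_driftCoeff hx i).differentiableAt (by simp)) ha) (Submodule.add_mem _
    (Submodule.smul_mem _ _ ?_) (Submodule.smul_mem _ _ (fderiv_comp_fst_mem_frameSpan H.coords hq
    ((H.contDiffAt_inputCoeff hx i).differentiableAt (by simp)) hb)))
  rw [← fderiv_eq_of_ball H.output hq]
  exact out_mem_frameSpan (i := 0) (by omega) (by omega)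

/-- If the input slopes of `ż^i` are proportional to those of `v = ż^{j₀}`, then `ż^i` depends on
the inputs through `v` only. -/
theorem fderiv_timeDeriv_mem_of_det {i : Fin n} {x : Fin n → ℝ} (hx : x ∈ Metric.ball p.1 r)
    (hdet : stateLie (g 0) (z j₀) x * stateLie (g 1) (z i) x =
      stateLie (g 1) (z j₀) x * stateLie (g 0) (z i) x) :
    fderiv ℝ (timeDeriv (affineSystem f g) N fun q => z i q.1) (x, p.2) ∈
      frameSpan (affineSystem f g) N φ k s z 0 n 1 0 (x, p.2) := by
  have hq := mem_ball_jet hx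
  have h0 := H.stateLie_ne_zero hx
  have hb : ∀ t, stateLie (g t) (z i) x =
      inputCoeff g (s 0) (z j₀) (z i) x * stateLie (g t) (z j₀) x := by
    intro t
    rw [inputCoeff, div_mul_eq_mul_div, eq_div_iff h0]
    generalize s 0 = t'
    fin_cases t <;> fin_cases t' <;> simp <;> linarith
  have h1 : fderiv ℝ (timeDeriv (affineSystem f g) N fun q => z i q.1) (x, p.2) -
      inputCoeff g (s 0) (z j₀) (z i) x •
        fderiv ℝ (timeDeriv (affineSystem f g) N fun q => z j₀ q.1) (x, p.2) ∈ spanDx n N := by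
    refine mem_spanDx_iff.2 fun ζ => ?_
    rw [sub_apply, smul_apply, H.vertical hq, H.vertical hq, hb 0, hb 1, smul_eq_mul]
    ring
  have h2 := Submodule.add_mem _ (frameSpan_mono (d' := 1) le_rfl (by omega) le_rfl _
    (spanDx_le_frameSpan (j := 0) H.regular H.coords hq h1)) (Submodule.smul_mem _
      (inputCoeff g (s 0) (z j₀) (z i) x) (out_mem_frameSpan (F := affineSystem f g) (φ := φ)
        (s := s) (z := z) (j := 0) (c := n) (d := 1) (e := 0) (q := (x, p.2)) (i := 0)
        (by omega) (by omega)))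
  rw [add_zero, fderiv_eq_of_ball H.output hq, sub_add_cancel] at h2
  exact h2

end AffineFrame

end Normalization

/-! ### Functions of the first coordinates -/

section FirstCoords

variable {n l : ℕ}

/-- The point of `ℝⁿ` with first coordinates `y` and the remaining coordinates those of `z₀`. -/
def extendCoords (z₀ : Fin n → ℝ) (y : Fin l → ℝ) : Fin n → ℝ :=
  fun j => if h : (j : ℕ) < l then y ⟨j, h⟩ else z₀ j

theorem contDiff_extendCoords (z₀ : Fin n → ℝ) :
    ContDiff ℝ ∞ (extendCoords z₀ : (Fin l → ℝ) → Fin n → ℝ) := by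
  refine contDiff_pi.2 fun j => ?_
  unfold extendCoords
  split_ifs with h
  · exact contDiff_apply ℝ ℝ _
  · exact contDiff_const

theorem extendCoords_firstCoords (hl : l ≤ n) (z₀ z : Fin n → ℝ) (j : Fin n) :
    extendCoords z₀ (firstCoords hl z) j = if (j : ℕ) < l then z j else z₀ j := by
  simp only [extendCoords, firstCoords]
  split_ifs <;> rfl

theorem extendCoords_mem_ball (hl : l ≤ n) {z₀ z : Fin n → ℝ} {r : ℝ}
    (hz : z ∈ Metric.ball z₀ r) : extendCoords z₀ (firstCoords hl z) ∈ Metric.ball z₀ r := by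
  have hr : 0 < r := dist_nonneg.trans_lt hz
  rw [Metric.mem_ball, dist_pi_lt_iff hr] at *
  intro j
  rw [extendCoords_firstCoords]
  split_ifs
  · exact hz j
  · simpa using hr

variable {c : (Fin n → ℝ) → ℝ} {z₀ : Fin n → ℝ} {r : ℝ}

/-- On a ball of the sup norm, a function whose derivative vanishes in the directions of the last
coordinates is a function of the first ones. -/
theorem comp_extendCoords_firstCoords (hl : l ≤ n) (hc : ContDiffOn ℝ ∞ c (Metric.ball z₀ r))
    (hker : ∀ y ∈ Metric.ball z₀ r, ∀ η : Fin n → ℝ, (∀ j : Fin n, (j : ℕ) < l → η j = 0) →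
      fderiv ℝ c y η = 0) {z : Fin n → ℝ} (hz : z ∈ Metric.ball z₀ r) :
    c (extendCoords z₀ (firstCoords hl z)) = c z := by
  refine eq_of_fderiv_sub_eq_zero Metric.isOpen_ball (convex_ball z₀ r)
    (hc.differentiableOn (by simp)) (extendCoords_mem_ball hl hz) hz fun y hy => hker y hy _ ?_
  intro j hj
  rw [Pi.sub_apply, extendCoords_firstCoords, if_pos hj, sub_self]

theorem contDiffOn_comp_extendCoords (hl : l ≤ n) (hc : ContDiffOn ℝ ∞ c (Metric.ball z₀ r)) :
    ContDiffOn ℝ ∞ (fun y : Fin l → ℝ => c (extendCoords z₀ y))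
      (firstCoords hl '' Metric.ball z₀ r) := by
  refine hc.comp (contDiff_extendCoords z₀).contDiffOn ?_
  rintro _ ⟨z, hz, rfl⟩
  exact extendCoords_mem_ball hl hz

theorem partialLast_comp_extendCoords (hl : l + 1 ≤ n)
    (hc : ContDiffOn ℝ ∞ c (Metric.ball z₀ r))
    (hker : ∀ y ∈ Metric.ball z₀ r, ∀ η : Fin n → ℝ, (∀ j : Fin n, (j : ℕ) < l + 1 → η j = 0) →
      fderiv ℝ c y η = 0) {z : Fin n → ℝ} (hz : z ∈ Metric.ball z₀ r) :
    partialLast (fun y : Fin (l + 1) → ℝ => c (extendCoords z₀ y)) (firstCoords hl z) =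
      fderiv ℝ c z (Pi.single ⟨l, hl⟩ 1) := by
  have h1 : DifferentiableAt ℝ (fun y : Fin (l + 1) → ℝ => c (extendCoords z₀ y))
      (firstCoords hl z) := by
    have h2 : ContDiffAt ℝ ∞ c (extendCoords z₀ (firstCoords hl z)) :=
      hc.contDiffAt (Metric.isOpen_ball.mem_nhds (extendCoords_mem_ball hl hz))
    exact (h2.differentiableAt (by simp)).comp _
      ((contDiff_extendCoords z₀).differentiable (by simp) _)
  set T : (Fin n → ℝ) →L[ℝ] (Fin (l + 1) → ℝ) := ContinuousLinearMap.pi fun i =>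
    ContinuousLinearMap.proj (R := ℝ) (φ := fun _ : Fin n => ℝ) (Fin.castLE hl i) with hT
  have h3 : HasFDerivAt (firstCoords hl) T z := T.hasFDerivAt
  have h4 : HasFDerivAt (fun z => c (extendCoords z₀ (firstCoords hl z))) _ z :=
    h1.hasFDerivAt.comp z h3
  have h5 : (fun z => c (extendCoords z₀ (firstCoords hl z))) =ᶠ[𝓝 z] c := by
    filter_upwards [Metric.isOpen_ball.mem_nhds hz] with y hy
    exact comp_extendCoords_firstCoords hl hc hker hy
  rw [← h5.fderiv_eq, h4.fderiv, ContinuousLinearMap.comp_apply, partialLast]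
  congr 1
  funext i
  simp only [hT, ContinuousLinearMap.pi_apply, ContinuousLinearMap.proj_apply, Pi.single_apply,
    Fin.ext_iff, Fin.val_last, Fin.val_castLE]

end FirstCoords

/-! ### The state and input transformations -/

section IntegrableToTriangular

variable {n N : ℕ} {f : (Fin n → ℝ) → (Fin n → ℝ)} {g : Fin 2 → (Fin n → ℝ) → (Fin n → ℝ)}
  {φ : Fin 2 → (Fin n → ℝ) → ℝ} {k : Fin 2 → ℕ} {s : Fin 2 → Fin 2} {X : Set (Fin n → ℝ)}
  {p : Jet n N} {r : ℝ} {z : Fin n → (Fin n → ℝ) → ℝ} {j₀ : Fin n}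

namespace AffineFrame

/-- Adapted coordinates are a local diffeomorphism of the state space. -/
theorem exists_stateDiffeo (H : AffineFrame f g φ k s X p r z j₀) (hr : 0 < r) :
    ∃ e : OpenPartialHomeomorph (Fin n → ℝ) (Fin n → ℝ), ⇑e = (fun x i => z i x) ∧
      p.1 ∈ e.source ∧ e.source ⊆ Metric.ball p.1 r ∧
      (∃ ρ > 0, e.target = Metric.ball (fun i => z i p.1) ρ) ∧
      ContDiffOn ℝ ∞ e e.source ∧ ContDiffOn ℝ ∞ e.symm e.target := by
  refine exists_localDiffeo (Z := fun x i => z i x) Metric.isOpen_ball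
    (Metric.mem_ball_self hr) (contDiffOn_pi.2 fun i x hx =>
      (H.contDiffAt_coord hx i).contDiffWithinAt) ?_
  have hd : DifferentiableAt ℝ (fun x i => z i x) p.1 := differentiableAt_pi.2 fun i =>
    (H.contDiffAt_coord (Metric.mem_ball_self hr) i).differentiableAt (by simp)
  have hinj : Function.Injective (fderiv ℝ (fun x i => z i x) p.1) := by
    refine (injective_iff_map_eq_zero _).2 fun ξ hξ => ?_
    refine H.coords.kernel p (Metric.mem_ball_self hr) ξ fun i => ?_
    have h1 : fderiv ℝ (fun x => z i x) p.1 = _ := fderiv_apply hd i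
    change fderiv ℝ (fun x => z i x) p.1 ξ = 0
    rw [h1, ContinuousLinearMap.comp_apply, hξ, map_zero]
  exact ⟨hinj, LinearMap.injective_iff_surjective
    (f := (fderiv ℝ (fun x i => z i x) p.1).toLinearMap).1 hinj⟩

/-- Adapted coordinates together with the derivatives of `z^{j₀}` and `z^i` are a local
diffeomorphism of the space of states and inputs, provided that these derivatives depend
independently on the inputs. -/
theorem exists_feedbackDiffeo (H : AffineFrame f g φ k s X p r z j₀) (hr : 0 < r) {i : Fin n}
    (hi : fderiv ℝ (timeDeriv (affineSystem f g) N fun q => z i q.1) p ∉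
      frameSpan (affineSystem f g) N φ k s z 0 n 1 0 p)
    {S : Set (Fin n → ℝ)} (hS : IsOpen S) (hpS : p.1 ∈ S) (hSr : S ⊆ Metric.ball p.1 r) :
    ∃ e : OpenPartialHomeomorph ((Fin n → ℝ) × (Fin 2 → ℝ)) ((Fin n → ℝ) × (Fin 2 → ℝ)),
      ⇑e = (fun y => (fun i => z i y.1, ![fderiv ℝ (z j₀) y.1 (affineSystem f g y.1 y.2),
        fderiv ℝ (z i) y.1 (affineSystem f g y.1 y.2)])) ∧
      (p.1, p.2 0) ∈ e.source ∧ e.source ⊆ S ×ˢ Metric.ball (p.2 0) r ∧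
      ContDiffOn ℝ ∞ e e.source ∧ ContDiffOn ℝ ∞ e.symm e.target := by
  set W : Fin n → (Fin n → ℝ) × (Fin 2 → ℝ) → ℝ := fun i y =>
    fderiv ℝ (z i) y.1 (affineSystem f g y.1 y.2) with hW
  set Ψ : (Fin n → ℝ) × (Fin 2 → ℝ) → (Fin n → ℝ) × (Fin 2 → ℝ) :=
    fun y => (fun i => z i y.1, ![W j₀ y, W i y]) with hΨ
  have hx₀ : p.1 ∈ Metric.ball p.1 r := Metric.mem_ball_self hr
  have hWs : ∀ i, ∀ y : (Fin n → ℝ) × (Fin 2 → ℝ), y.1 ∈ Metric.ball p.1 r →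
      ContDiffAt ℝ ∞ (W i) y := by
    intro i y hy
    have h1 : ContDiffAt ℝ ∞ (fun x => fderiv ℝ (z i) x) y.1 :=
      (H.contDiffAt_coord hy i).fderiv_right (m := ∞) (by norm_cast)
    exact (h1.comp y contDiffAt_fst).clm_apply (H.regular.smooth_system.contDiffAt
      ((H.regular.isOpen_base.prod isOpen_univ).mem_nhds ⟨H.mem_base hy, mem_univ _⟩))
  have hZs : ∀ y : (Fin n → ℝ) × (Fin 2 → ℝ), y.1 ∈ Metric.ball p.1 r →
      ContDiffAt ℝ ∞ (fun y : (Fin n → ℝ) × (Fin 2 → ℝ) => fun i => z i y.1) y := fun y hy =>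
    contDiffAt_pi.2 fun i => (H.contDiffAt_coord hy i).comp y contDiffAt_fst
  have hVs : ∀ y : (Fin n → ℝ) × (Fin 2 → ℝ), y.1 ∈ Metric.ball p.1 r →
      ContDiffAt ℝ ∞ (fun y => ![W j₀ y, W i y]) y := fun y hy =>
    contDiffAt_pi.2 fun t => by
      fin_cases t
      · exact hWs j₀ y hy
      · exact hWs i y hy
  have hinj : Function.Injective (fderiv ℝ Ψ (p.1, p.2 0)) := by
    refine (injective_iff_map_eq_zero _).2 ?_
    rintro ⟨η, w⟩ hηw
    have hdZ := (hZs (p.1, p.2 0) hx₀).differentiableAt (by simp)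
    have hdV := (hVs (p.1, p.2 0) hx₀).differentiableAt (by simp)
    rw [hΨ, hdZ.fderiv_prodMk hdV] at hηw
    have h1 := congrArg Prod.fst hηw
    have h2 := congrArg Prod.snd hηw
    have hη : η = 0 := by
      refine H.coords.kernel p (Metric.mem_ball_self hr) η fun l => ?_
      have h3 : HasFDerivAt (fun y : (Fin n → ℝ) × (Fin 2 → ℝ) => z l y.1) _ (p.1, p.2 0) :=
        HasFDerivAt.comp (p.1, p.2 0)
          ((H.contDiffAt_coord hx₀ l).differentiableAt (by simp)).hasFDerivAt hasFDerivAt_fst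
      have h4 := fderiv_apply hdZ l
      rw [h3.fderiv] at h4
      have h5 := congrArg (fun L : ((Fin n → ℝ) × (Fin 2 → ℝ)) →L[ℝ] ℝ => L (η, w)) h4
      exact h5.trans (congrFun h1 l)
    subst hη
    have hinput : ∀ l, fderiv ℝ (W l) (p.1, p.2 0) (0, w) =
        w 0 * stateLie (g 0) (z l) p.1 + w 1 * stateLie (g 1) (z l) p.1 := by
      intro l
      have h3 : HasFDerivAt (fun u => W l (p.1, u)) _ (p.2 0) :=
        ((hWs l (p.1, p.2 0) hx₀).differentiableAt (by simp)).hasFDerivAt.comp (p.2 0)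
          (hasFDerivAt_prodMk_right p.1 (p.2 0))
      have h4 : HasFDerivAt (fun u => W l (p.1, u)) _ (p.2 0) :=
        (fderiv ℝ (z l) p.1).hasFDerivAt.comp (p.2 0) (hasFDerivAt_affineSystem_input p.1 (p.2 0))
      have h5 := congrArg (fun L : (Fin 2 → ℝ) →L[ℝ] ℝ => L w) (h3.unique h4)
      refine h5.trans ?_
      simp [stateLie]
    have h3 : w 0 * stateLie (g 0) (z j₀) p.1 + w 1 * stateLie (g 1) (z j₀) p.1 = 0 := by
      rw [← hinput]
      have h4 := congrArg (fun L : ((Fin n → ℝ) × (Fin 2 → ℝ)) →L[ℝ] ℝ => L (0, w))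
        (fderiv_apply hdV 0)
      exact h4.trans (congrFun h2 0)
    have h4 : w 0 * stateLie (g 0) (z i) p.1 + w 1 * stateLie (g 1) (z i) p.1 = 0 := by
      rw [← hinput]
      have h4 := congrArg (fun L : ((Fin n → ℝ) × (Fin 2 → ℝ)) →L[ℝ] ℝ => L (0, w))
        (fderiv_apply hdV 1)
      exact h4.trans (congrFun h2 1)
    have hdet : stateLie (g 0) (z j₀) p.1 * stateLie (g 1) (z i) p.1 -
        stateLie (g 1) (z j₀) p.1 * stateLie (g 0) (z i) p.1 ≠ 0 := fun h0 =>
      hi (H.fderiv_timeDeriv_mem_of_det hx₀ (sub_eq_zero.1 h0))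
    have hw0 : w 0 = 0 := by
      refine (mul_eq_zero.1 (?_ : w 0 * _ = 0)).resolve_right hdet
      linear_combination stateLie (g 1) (z i) p.1 * h3 - stateLie (g 1) (z j₀) p.1 * h4
    have hw1 : w 1 = 0 := by
      refine (mul_eq_zero.1 (?_ : w 1 * _ = 0)).resolve_right hdet
      linear_combination stateLie (g 0) (z j₀) p.1 * h4 - stateLie (g 0) (z i) p.1 * h3
    refine Prod.ext rfl ?_
    funext t
    fin_cases t
    · exact hw0
    · exact hw1
  obtain ⟨e, h1, h2, h3, -, h4, h5⟩ := exists_localDiffeo (Z := Ψ)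
    (hS.prod (Metric.isOpen_ball (x := p.2 0) (ε := r)))
    (x₀ := (p.1, p.2 0)) ⟨hpS, Metric.mem_ball_self hr⟩ (fun y hy =>
      ((hZs y (hSr hy.1)).prodMk (hVs y (hSr hy.1))).contDiffWithinAt)
    ⟨hinj, LinearMap.injective_iff_surjective
      (f := (fderiv ℝ Ψ (p.1, p.2 0)).toLinearMap).1 hinj⟩
  exact ⟨e, h1, h2, h3, h4, h5⟩

end AffineFrame

end IntegrableToTriangular

/-! ### Construction of the triangular form -/

section IntegrableToTriangular

variable {n N : ℕ} {f : (Fin n → ℝ) → (Fin n → ℝ)} {g : Fin 2 → (Fin n → ℝ) → (Fin n → ℝ)}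
  {φ : Fin 2 → (Fin n → ℝ) → ℝ} {k : Fin 2 → ℕ} {s : Fin 2 → Fin 2} {X : Set (Fin n → ℝ)}
  {O : Set (Jet n N)} {p : Jet n N}

/-- Pulling a function back along the inverse of adapted coordinates turns dependence on
`z^1, …, z^c` into dependence on the first `c` coordinates. -/
theorem fderiv_comp_symm_eq_zero {e : OpenPartialHomeomorph (Fin n → ℝ) (Fin n → ℝ)}
    (h1 : ContDiffOn ℝ ∞ e e.source) (h2 : ContDiffOn ℝ ∞ e.symm e.target)
    {h : (Fin n → ℝ) → ℝ} (hh : ContDiffOn ℝ ∞ h e.source) {c : ℕ}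
    (hker : ∀ x ∈ e.source, ∀ ξ, (∀ j : Fin n, (j : ℕ) < c → fderiv ℝ e x ξ j = 0) →
      fderiv ℝ h x ξ = 0) {y : Fin n → ℝ} (hy : y ∈ e.target) {η : Fin n → ℝ}
    (hη : ∀ j : Fin n, (j : ℕ) < c → η j = 0) :
    fderiv ℝ (fun y => h (e.symm y)) y η = 0 := by
  have hx := e.map_target hy
  have h3 : HasFDerivAt (fun y => h (e.symm y)) _ y :=
    ((hh.contDiffAt (e.open_source.mem_nhds hx)).differentiableAt (by simp)).hasFDerivAt.comp y
      ((h2.contDiffAt (e.open_target.mem_nhds hy)).differentiableAt (by simp)).hasFDerivAt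
  rw [h3.fderiv, ContinuousLinearMap.comp_apply]
  refine hker _ hx _ fun j hj => ?_
  rw [fderiv_fderiv_symm h1 h2 hy]
  exact hη j hj

/-- If moreover the derivative along the last of these `c` coordinates vanishes, the function
depends on one coordinate less. -/
theorem fderiv_eq_zero_of_fderiv_comp_symm {e : OpenPartialHomeomorph (Fin n → ℝ) (Fin n → ℝ)}
    (h1 : ContDiffOn ℝ ∞ e e.source) (h2 : ContDiffOn ℝ ∞ e.symm e.target)
    {h : (Fin n → ℝ) → ℝ} (hh : ContDiffOn ℝ ∞ h e.source) {c : ℕ} (hc : c < n)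
    (hker : ∀ x ∈ e.source, ∀ ξ, (∀ j : Fin n, (j : ℕ) < c + 1 → fderiv ℝ e x ξ j = 0) →
      fderiv ℝ h x ξ = 0) {x : Fin n → ℝ} (hx : x ∈ e.source)
    (h0 : fderiv ℝ (fun y => h (e.symm y)) (e x) (Pi.single ⟨c, hc⟩ 1) = 0) {ξ : Fin n → ℝ}
    (hξ : ∀ j : Fin n, (j : ℕ) < c → fderiv ℝ e x ξ j = 0) : fderiv ℝ h x ξ = 0 := by
  have h3 : HasFDerivAt (fun y => h (e.symm y)) _ (e x) :=
    (((hh.contDiffAt (e.open_source.mem_nhds (e.map_target (e.map_source hx)))).differentiableAt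
      (by simp)).hasFDerivAt).comp (e x) ((h2.contDiffAt (e.open_target.mem_nhds
        (e.map_source hx))).differentiableAt (by simp)).hasFDerivAt
  rw [e.left_inv hx] at h3
  have h4 : fderiv ℝ h x ξ = fderiv ℝ (fun y => h (e.symm y)) (e x) (fderiv ℝ e x ξ) := by
    rw [h3.fderiv, ContinuousLinearMap.comp_apply, fderiv_symm_fderiv h1 h2 hx]
  set w := fderiv ℝ e x ξ with hw
  have h5 : fderiv ℝ (fun y => h (e.symm y)) (e x) (w - w ⟨c, hc⟩ • Pi.single ⟨c, hc⟩ 1) = 0 := by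
    refine fderiv_comp_symm_eq_zero h1 h2 hh hker (e.map_source hx) fun j hj => ?_
    rcases Nat.lt_succ_iff_lt_or_eq.1 hj with hj' | hj'
    · have : j ≠ ⟨c, hc⟩ := fun h => by simp [h] at hj'
      simp [hξ j hj', this]
    · obtain rfl : j = ⟨c, hc⟩ := Fin.ext hj'
      simp
  rw [map_sub, map_smul, h0, smul_zero, sub_zero] at h5
  rw [h4, h5]

/-- The integrability of the codistributions `Q_l` gives a static feedback equivalence to the
triangular form: the state transformation consists of adapted coordinates, and the new inputs
are `φ¹_[k₁]` and the derivative of the last coordinate. -/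
theorem equivToTriangular_of_integrable (hf : ContDiffOn ℝ ∞ f X)
    (hg : ∀ j, ContDiffOn ℝ ∞ (g j) X) (hR : RegularOn (affineSystem f g) φ k s X O) (hp : p ∈ O)
    {m : ℕ} (hm : k 0 + k 1 + m = n) (hmN : m ≤ N)
    (hrank : ∀ q ∈ O, ∀ l ≤ m + 1, Module.finrank ℝ
      (outSpan (affineSystem f g) N φ (k 0 + l) (k 1 + l) q) = k 0 + k 1 + 2 * l)
    (hQrank : ∀ q ∈ O, ∀ l ≤ m, Module.finrank ℝ
      (outSpan (affineSystem f g) N φ (k 0 + l) (k 1 + l) q ⊓ spanDx n N : Submodule ℝ _) =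
        k 0 + k 1 + l)
    (hint : ∀ l ≤ m, CompletelyIntegrableNear
      (fun q => outSpan (affineSystem f g) N φ (k 0 + l) (k 1 + l) q ⊓ spanDx n N) p) :
    EquivToTriangular (affineSystem f g) φ k p.1 (p.2 0) := by
  have hk0 := hR.one_le 0
  have hk1 := hR.one_le 1
  obtain ⟨z, r, hr, hrO, hz, hz1, hz2, hspan⟩ := exists_adapted_coords hR hp hm hmN
    (fun q hq l hl => hrank q hq l (by omega)) hQrank hint
  have hRb := hR.mono Metric.isOpen_ball hrO
  obtain ⟨hchain, hlast⟩ := fderiv_timeDeriv_coord_of_outSpan_eq hRb hz hm hmN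
    (fun q hq => hrank q (hrO hq)) hz1 hz2 hspan
  have hnext : ∀ {h h' : Jet n N → ℝ}, (∀ q ∈ Metric.ball p r, h q = h' q) →
      ∀ q ∈ Metric.ball p r, timeDeriv (affineSystem f g) N h q =
        timeDeriv (affineSystem f g) N h' q := fun hh q hq => by
    simp only [timeDeriv, fderiv_eq_of_ball hh hq]
  set j₀ : Fin n := ⟨k 0 - 1, by omega⟩ with hj₀
  set jn : Fin n := ⟨n - 1, by omega⟩ with hjn
  have hout : ∀ q ∈ Metric.ball p r, outDeriv (affineSystem f g) N φ 0 (k 0) q =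
      timeDeriv (affineSystem f g) N (fun q => z j₀ q.1) q := by
    intro q hq
    rw [← hnext (fun q hq => hz1 q hq (k 0 - 1) (by omega)) q hq, ← outDeriv_succ,
      Nat.sub_add_cancel hk0]
  have H : AffineFrame f g φ k s X p r z j₀ := ⟨hf, hg, hRb, hz, hout⟩
  obtain ⟨e, he, hpe, hes, ⟨ρ, hρ, het⟩, hsm, hsm'⟩ := H.exists_stateDiffeo hr
  have hjn_not : fderiv ℝ (timeDeriv (affineSystem f g) N fun q => z jn q.1) p ∉
      frameSpan (affineSystem f g) N φ k s z 0 n 1 0 p := fun hcon =>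
    hlast p (Metric.mem_ball_self hr) m le_rfl jn (by simp [hjn]; omega)
      (frameSpan_mono (by omega) (by omega) le_rfl p hcon)
  obtain ⟨e', he', hpe', hes', hsm2, hsm2'⟩ :=
    H.exists_feedbackDiffeo hr hjn_not e.open_source hpe hes
  -- the derivatives of the coordinates of `e`
  have hde : ∀ x ∈ e.source, ∀ ξ i, fderiv ℝ e x ξ i = fderiv ℝ (z i) x ξ := by
    intro x hx ξ i
    have h1 : DifferentiableAt ℝ e x :=
      (hsm.contDiffAt (e.open_source.mem_nhds hx)).differentiableAt (by simp)
    have h2 : fderiv ℝ (fun x => e x i) x = _ := fderiv_apply h1 i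
    have h3 : (fun x => e x i) = z i := by rw [he]
    rw [h3] at h2
    rw [h2]
    rfl
  -- the functions `a^l`, `b^l` come from the coordinate `i` with `l = i + 1`; `ext` extends their
  -- arguments by the coordinates of `p`, on which they do not depend, and takes the value `0` for
  -- irrelevant `l`
  set A : Fin n → (Fin n → ℝ) → ℝ := fun i => driftCoeff f g (s 0) (z j₀) (z i) with hA
  set B : Fin n → (Fin n → ℝ) → ℝ := fun i => inputCoeff g (s 0) (z j₀) (z i) with hB
  set z₀ : Fin n → ℝ := fun i => z i p.1 with hz₀
  set ext : (Fin n → (Fin n → ℝ) → ℝ) → (l : ℕ) → (Fin (l + 1) → ℝ) → ℝ := fun C l y =>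
    if h : l - 1 < n then C ⟨l - 1, h⟩ (e.symm (extendCoords z₀ y)) else 0 with hext
  have hext' : ∀ (C : Fin n → (Fin n → ℝ) → ℝ) (i : Fin n), ext C ((i : ℕ) + 1) =
      fun y => C i (e.symm (extendCoords z₀ y)) := by
    intro C i
    funext y
    simp [hext]
  have hAs : ∀ i, ContDiffOn ℝ ∞ (A i) e.source := fun i x hx =>
    (H.contDiffAt_driftCoeff (hes hx) i).contDiffWithinAt
  have hBs : ∀ i, ContDiffOn ℝ ∞ (B i) e.source := fun i x hx =>
    (H.contDiffAt_inputCoeff (hes hx) i).contDiffWithinAt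
  have hcoeff : ∀ i : Fin n, (i : ℕ) + 1 < n → ∀ x ∈ e.source, ∀ ξ,
      (∀ j : Fin n, (j : ℕ) < i + 1 + 1 → fderiv ℝ e x ξ j = 0) →
      fderiv ℝ (A i) x ξ = 0 ∧ fderiv ℝ (B i) x ξ = 0 := by
    intro i hi x hx ξ hξ
    exact H.fderiv_coeff_eq_zero (c := i + 2) (fun q hq => hchain q hq i hi) (hes hx)
      fun l hl => by rw [← hde x hx]; exact hξ l hl
  have hsymm : ∀ C : (Fin n → ℝ) → ℝ, ContDiffOn ℝ ∞ C e.source →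
      ContDiffOn ℝ ∞ (fun y => C (e.symm y)) (Metric.ball z₀ ρ) := by
    intro C hC
    rw [← het]
    exact hC.comp hsm' fun y hy => e.map_target hy
  have hkerA : ∀ i : Fin n, (i : ℕ) + 1 < n → ∀ y ∈ Metric.ball z₀ ρ, ∀ η : Fin n → ℝ,
      (∀ j : Fin n, (j : ℕ) < i + 1 + 1 → η j = 0) →
      fderiv ℝ (fun y => A i (e.symm y)) y η = 0 := fun i hi y hy η hη =>
    fderiv_comp_symm_eq_zero hsm hsm' (hAs i) (fun x hx ξ hξ => (hcoeff i hi x hx ξ hξ).1)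
      (het ▸ hy) hη
  have hkerB : ∀ i : Fin n, (i : ℕ) + 1 < n → ∀ y ∈ Metric.ball z₀ ρ, ∀ η : Fin n → ℝ,
      (∀ j : Fin n, (j : ℕ) < i + 1 + 1 → η j = 0) →
      fderiv ℝ (fun y => B i (e.symm y)) y η = 0 := fun i hi y hy η hη =>
    fderiv_comp_symm_eq_zero hsm hsm' (hBs i) (fun x hx ξ hξ => (hcoeff i hi x hx ξ hξ).2)
      (het ▸ hy) hη
  have hvalA : ∀ (i : Fin n) (hi : (i : ℕ) + 1 + 1 ≤ n), ∀ y ∈ e.target,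
      ext A (i + 1) (firstCoords hi y) = A i (e.symm y) := by
    intro i hi y hy
    rw [hext']
    exact comp_extendCoords_firstCoords (c := fun y => A i (e.symm y)) hi (hsymm _ (hAs i))
      (hkerA i hi) (het ▸ hy)
  have hvalB : ∀ (i : Fin n) (hi : (i : ℕ) + 1 + 1 ≤ n), ∀ y ∈ e.target,
      ext B (i + 1) (firstCoords hi y) = B i (e.symm y) := by
    intro i hi y hy
    rw [hext']
    exact comp_extendCoords_firstCoords (c := fun y => B i (e.symm y)) hi (hsymm _ (hBs i))
      (hkerB i hi) (het ▸ hy)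
  have hindex : ∀ l, k 0 + k 1 ≤ l → ∀ hl : l + 1 ≤ n, ∃ i : Fin n, l = (i : ℕ) + 1 :=
    fun l hl1 hl2 => ⟨⟨l - 1, by omega⟩, by simp; omega⟩
  -- the transformed system is triangular
  have hconj : ∀ y ∈ e'.source, fderiv ℝ e y.1 (affineSystem f g y.1 y.2) =
      triangularSystem k (ext A) (ext B) (e' y).1 (e' y).2 := by
    rintro ⟨x, u⟩ hxu
    have hx : x ∈ e.source := (hes' hxu).1
    have hq : (x, Function.update p.2 0 u) ∈ Metric.ball p r :=
      update_mem_ball (hes hx) (hes' hxu).2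
    have hfst : (e' (x, u)).1 = e x := by rw [he', he]
    have hv0 : (e' (x, u)).2 0 = fderiv ℝ (z j₀) x (affineSystem f g x u) := by rw [he']; rfl
    have hv1 : (e' (x, u)).2 1 = fderiv ℝ (z jn) x (affineSystem f g x u) := by rw [he']; rfl
    have htd : ∀ i, timeDeriv (affineSystem f g) N (fun q => z i q.1)
        (x, Function.update p.2 0 u) = fderiv ℝ (z i) x (affineSystem f g x u) := by
      intro i
      rw [timeDeriv, fderiv_comp_fst ((hz.smooth _ hq i).differentiableAt (by simp))]
      simp [totalField]
    funext i
    simp only [triangularSystem]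
    rw [hde x hx, hfst]
    rcases eq_or_ne ((i : ℕ) + 1) n with h | h
    · rw [dif_pos h, hv1, show jn = i from Fin.ext (by simp [hjn]; omega)]
    rw [dif_neg h]
    rcases eq_or_ne ((i : ℕ) + 1) (k 0) with h' | h'
    · rw [if_pos h', hv0, show j₀ = i from Fin.ext (by simp [hj₀]; omega)]
    rw [if_neg h']
    rcases Nat.lt_or_ge ((i : ℕ) + 1) (k 0 + k 1) with h'' | h''
    · rw [if_pos h'', ← htd i, he]
      rcases Nat.lt_or_ge (i : ℕ) (k 0) with hi | hi
      · rw [← hnext (fun q hq => hz1 q hq i hi) _ hq, ← outDeriv_succ,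
          hz1 _ hq (i + 1) (by omega)]
      · obtain ⟨i', hi'⟩ := Nat.exists_eq_add_of_le hi
        have hi0 : i = ⟨k 0 + i', by omega⟩ := Fin.ext hi'
        have h1 : timeDeriv (affineSystem f g) N (fun q => z i q.1) (x, Function.update p.2 0 u) =
            z ⟨k 0 + (i' + 1), by omega⟩ x := by
          refine (congrArg (fun j => timeDeriv (affineSystem f g) N (fun q => z j q.1) _)
            hi0).trans ?_
          rw [← hnext (fun q hq => hz2 q hq i' (by omega)) _ hq, ← outDeriv_succ,
            hz2 _ hq (i' + 1) (by omega)]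
        rw [h1]
        exact congrArg (fun j => z j x) (Fin.ext (by simp; omega))
    · have hi : (i : ℕ) + 1 < n := by omega
      rw [if_neg (by omega), hvalA i hi _ (e.map_source hx), hvalB i hi _ (e.map_source hx),
        e.left_inv hx, hv0, ← htd i, ← htd j₀]
      exact H.timeDeriv_eq (fun q hq => hchain q hq i hi) hq
  refine ⟨by omega, ext A, ext B, ⟨e, e', hpe, hpe', hsm, hsm', hsm2, hsm2',
    fun q hq => (hes' hq).1, fun q hq => by rw [he', he], hconj⟩,
    ⟨⟨0, by omega⟩, ⟨k 0, by omega⟩, rfl, rfl, fun x hx => ?_⟩, ?_, ?_, ?_⟩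
  · have hq := mem_ball_jet (hes hx)
    simp only [he]
    exact ⟨hz1 _ hq 0 hk0, hz2 _ hq 0 hk1⟩
  · intro l hl1 hl2
    obtain ⟨i, rfl⟩ := hindex l hl1 hl2
    simp only [hext', het]
    exact ⟨contDiffOn_comp_extendCoords (c := fun y => A i (e.symm y)) hl2 (hsymm _ (hAs i)),
      contDiffOn_comp_extendCoords (c := fun y => B i (e.symm y)) hl2 (hsymm _ (hBs i))⟩
  · intro hk y hy
    obtain ⟨i, hi⟩ := hindex _ le_rfl hk
    have hi1 : (i : ℕ) + 1 < n := by omega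
    have hx := e.map_target hy
    have hq := mem_ball_jet (p := p) (hes hx)
    have hval : ∀ l (hl : l = (i : ℕ) + 1) (hl' : l + 1 ≤ n),
        ext B l (firstCoords hl' y) = B i (e.symm y) := by
      rintro _ rfl hl'
      exact hvalB i hl' y hy
    rw [hval _ hi hk]
    -- here `ż^i = φ²_[k₂]`, on which the inputs act, by the relative degree
    intro h0
    have hi2 : i = ⟨k 0 + (k 1 - 1), by omega⟩ := Fin.ext (by simp; omega)
    have h1 : ∀ q ∈ Metric.ball p r, outDeriv (affineSystem f g) N φ 1 (k 1) q =
        timeDeriv (affineSystem f g) N (fun q => z i q.1) q := by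
      intro q hq
      rw [hi2, ← hnext (fun q hq => hz2 q hq (k 1 - 1) (by omega)) q hq, ← outDeriv_succ,
        Nat.sub_add_cancel hk1]
    have h2 := hRb.vertical 1 _ hq
    rw [fderiv_eq_of_ball h1 hq, H.vertical_single hq,
      H.stateLie_eq_mul (hes hx) (hchain _ hq i hi1)] at h2
    exact h2 (by rw [show inputCoeff g (s 0) (z j₀) (z i) (e.symm y) = 0 from h0, zero_mul])
  · intro l hl1 hl2 y hy
    obtain ⟨i, rfl⟩ := hindex l hl1 hl2
    have hi1 : (i : ℕ) + 1 < n := hl2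
    have hx := e.map_target hy
    by_contra! hcon
    -- otherwise `ż^i` would be a function of `z^1, …, z^{i+1}` and `v¹`, against `hlast`
    obtain ⟨hA0, hB0⟩ := hcon
    rw [hext', partialLast_comp_extendCoords (c := fun y => A i (e.symm y)) hl2 (hsymm _ (hAs i))
      (hkerA i hi1) (het ▸ hy), ← e.right_inv hy] at hA0
    rw [hext', partialLast_comp_extendCoords (c := fun y => B i (e.symm y)) hl2 (hsymm _ (hBs i))
      (hkerB i hi1) (het ▸ hy), ← e.right_inv hy] at hB0
    refine hlast _ (mem_ball_jet (hes hx)) ((i : ℕ) + 1 - (k 0 + k 1)) (by omega) i (by omega)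
      (frameSpan_mono (c := i + 1) (by omega) (by omega) le_rfl _
      (H.fderiv_timeDeriv_mem_of_coeff (c := i + 2) (fun q hq => hchain q hq i hi1) (hes hx)
        (fun ξ hξ => ?_) fun ξ hξ => ?_))
    · exact fderiv_eq_zero_of_fderiv_comp_symm hsm hsm' (hAs i) hi1
        (fun x hx ξ hξ => (hcoeff i hi1 x hx ξ hξ).1) hx hA0
        fun j hj => by rw [hde _ hx]; exact hξ j hj
    · exact fderiv_eq_zero_of_fderiv_comp_symm hsm hsm' (hBs i) hi1
        (fun x hx ξ hξ => (hcoeff i hi1 x hx ξ hξ).2) hx hB0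
        fun j hj => by rw [hde _ hx]; exact hξ j hj

end IntegrableToTriangular

end TwoInput

theorem theorem1 {n N : ℕ}
    (X : Set (Fin n → ℝ)) (hX : IsOpen X)
    (f : (Fin n → ℝ) → (Fin n → ℝ)) (g : Fin 2 → (Fin n → ℝ) → (Fin n → ℝ))
    (φ : Fin 2 → (Fin n → ℝ) → ℝ)
    (hf : ContDiffOn ℝ ∞ f X) (hg : ∀ j, ContDiffOn ℝ ∞ (g j) X)
    (hφ : ∀ j, ContDiffOn ℝ ∞ (φ j) X)
    (p : TwoInput.Jet n N) (hp : p.1 ∈ X)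
    (k R : Fin 2 → ℕ)
    (hk : ∀ j, TwoInput.HasRelativeDegree (TwoInput.affineSystem f g) N φ j (k j) p)
    (hR : Minimal (TwoInput.FlatParametrization (TwoInput.affineSystem f g) N φ p) R)
    (hN : ∀ j, R j ≤ N)
    (hrank : ∀ l : ℕ, (∀ j, k j - 1 + l ≤ R j) → TwoInput.ConstantRankNear
      (TwoInput.codistP (TwoInput.affineSystem f g) N φ (fun j => k j - 1 + l)) p) :
    TwoInput.EquivToTriangular (TwoInput.affineSystem f g) φ k p.1 (p.2 0) ↔
      ∀ l : ℕ, (∀ j, k j - 1 + l ≤ R j - 1) → TwoInput.CompletelyIntegrableNear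
        (TwoInput.codistQ (TwoInput.affineSystem f g) N φ (fun j => k j - 1 + l)) p := by
  obtain ⟨s, O, hpO, hreg⟩ := TwoInput.exists_regularOn hX
    (TwoInput.contDiffOn_affineSystem hf hg) hφ hp hk
  obtain ⟨W, hW, hWo, hpW⟩ := mem_nhds_iff.1 (hR.prop.eventually_span hX
    (TwoInput.contDiffOn_affineSystem hf hg) hφ hp)
  have hreg' := hreg.mono (hreg.isOpen.inter hWo) inter_subset_left
  obtain ⟨m, hm, hkm, O', hO', hO'o, hpO', hfull, hQ⟩ := TwoInput.exists_defect hreg' ⟨hpO, hpW⟩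
    (fun q hq => (hW hq.2).1) (fun q hq => (hW hq.2).2) hN hrank
  have hregO := hreg'.mono hO'o hO'
  have hk0 := hregO.one_le 0
  have hk1 := hregO.one_le 1
  have hmN : m ≤ N := by
    have := hkm 0
    have := hN 0
    omega
  constructor
  · intro hE l _
    exact TwoInput.completelyIntegrableNear_of_equiv hregO hpO' hm hmN
      (fun q hq l hl => hfull q hq l (by omega)) hE l
  · intro hint
    refine TwoInput.equivToTriangular_of_integrable hf hg hregO hpO' hm hmN hfull hQ fun l hl => ?_
    have h1 := hint l fun j => by
      have := hkm j
      have := hregO.one_le j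
      omega
    have h2 : TwoInput.codistQ (TwoInput.affineSystem f g) N φ (fun j => k j - 1 + l) =
        fun q => TwoInput.outSpan (TwoInput.affineSystem f g) N φ (k 0 + l) (k 1 + l) q ⊓
          TwoInput.spanDx n N := by
      funext q
      rw [TwoInput.codistQ, TwoInput.codistP_eq_outSpan]
      simp only [show k 0 - 1 + l + 1 = k 0 + l by omega, show k 1 - 1 + l + 1 = k 1 + l by omega]
    rwa [h2] at h1
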